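/- Let $\alpha=\frac{1+i\sqrt3}{2}$, let $\mathcal E=\{x+y\alpha: x,y\in\mathbb Z\}$, and let $\mathcal T$ be the triangulation of $\mathbb C$ by unit equilateral triangles with vertex set $\mathcal E$. Let $\beta=a+b\alpha$ with $a,b\in\mathbb Z$ relatively prime, let $G_\beta$ be the group generated by the order $3$ rotations about the points of $\beta\mathcal E$, and let $\mathcal T(\beta)=\mathcal T/G_\beta$. *Definitions.* An Eisenstein trapezoid is an isosceles trapezoid (the bottom, i.e. the shorter parallel side, may degenerate to a point) whose sides lie in the $1$-skeleton of $\mathcal T$. If its diagonal sides have length $p$ and its top (the longer parallel side) has length $q$, its aspect ratio is $p/q\in(0,1]$; it is primitive if $\gcd(p,q)=1$. A trapezoid necklace centered at $0$ is a union of six primitive Eisenstein trapezoids $X_i$ ($i\in\mathbb Z/6$) with pairwise disjoint interiors, such that $\alpha X_i=X_{i+1}$ and $X_i\cap X_{i+1}$ is a single point, a common vertex. A necklace $Y$ follows a necklace $X$ if the top of each $Y_i$ is a side of some $X_j$, and a diagonal side of $Y_i$ is a side of one of the two trapezoids of $X$ adjacent to $X_j$. A flower of $\beta$ consists of necklaces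 $X^{0},\dots,X^{n-1}$ centered at $0$ ($n\ge 0$), each following the one before, the last of aspect ratio $1$ (if $n\geq 1$), together with the six unit triangles $T_i$ ($0\le i<6$) with vertices $0,\alpha^i,\alpha^{i+1}$, such that all the trapezoids have pairwise disjoint interiors, their interiors are disjoint from those of the six triangles, and the convex hull of the flower is the regular hexagon $H_\beta$ with vertices $\alpha^i\beta$. The necklaces are colored alternately black and white and the six triangles are colored alternately black and white (four choices in all); the flower is capped by giving the rest of $H_\beta$ the color opposite to that of $X^0$ (for $n=0$ there is no rest). The slow Gauss map is $\gamma(r)=\frac1r-1$ for $r\ge\frac12$ and $\gamma(r)=1/(\frac1r-1)$ for $r<\frac12$. A $2$-coloring of the faces of $\mathcal T(\beta)$ is good if around each vertex the numbers of black and of white faces are congruent mod $3$. *Claim.* 1. $\mathcal T(\beta)$ is a triangulation of the sphere (a finite, connected, closed, nondegenerate triangulated surface of Euler characteristic $2$, where several edges may have the same two endpoints). Three of its vertices have degree $2$ and all others have degree $6$. A face $2$-coloring of $\mathcal T(\beta)$ is good if and only if it comes from a proper vertex $4$-coloring, that is, a face is black exactly when the simplicial map to the oriented tetrahedron defined by the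 vertex coloring preserves its orientation. 2. The translates of $H_\beta$ by $\beta(1+\alpha)\mathcal E$ tile the plane. 3. There are coprime integers $0\le p\le q$ such that a symmetry of $\mathcal E$ fixing $0$ takes $p+q\alpha$ to $\beta$ (with $(p,q)=(a,b)$ if $0\le a\le b$), and there is a flower of $\beta$ with the following properties. - The $k$-th necklace $X^k$ has aspect ratio $\gamma^k(p/q)$ for $0\le k<n$. - Let $p/q=0:c_1:c_2:\cdots:c_m$ be the continued fraction expansion (with $c_m\ge2$, except that $1=0:1$; it is empty if $p/q=0$). Then $n=c_1+\dots+c_m$, and for each $j$ the following holds for $k=c_1+\dots+c_{j-1}$: every trapezoid of $X^k$ is the first stripe of an Eisenstein trapezoid made of $c_j$ stripes, one from each of $X^k,\dots,X^{k+c_j-1}$, the bottom of each stripe being the top of the next; and no trapezoid so striped with $c_j+1$ stripes starts at $X^k$ or (if $k\geq 1$) at $X^{k-1}$. - For each of the four choices of colors there is exactly one coloring of the faces of $\mathcal T$ that agrees with the colored capped flower and its translates by $\beta(1+\alpha)\mathcal E$. This coloring is $G_\beta$-invariant, and it descends to a face coloring $\mathcal C(\beta)$ of $\mathcal T(\beta)$.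 The coloring $\mathcal C(\beta)$ is good, and it comes from a proper vertex $4$-coloring of $\mathcal T(\beta)$. -/

import Mathlib

open scoped ComplexConjugate

namespace Eisenstein

noncomputable section

/-! ### The Eisenstein lattice and its triangulation of the plane -/

/-- The sixth root of unity `(1 + i √3) / 2`. -/
def α : ℂ := ⟨1 / 2, Real.sqrt 3 / 2⟩

theorem α_sq : α ^ 2 = α - 1 := by
  have h : Real.sqrt 3 * Real.sqrt 3 = 3 := Real.mul_self_sqrt (by norm_num)
  apply Complex.ext
  · simp [α, pow_two]
    nlinarith [h]
  · simp [α, pow_two]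
    ring

theorem α_cube : α ^ 3 = -1 := by
  have h := α_sq
  linear_combination (α + 1) * h

/-- The Eisenstein integers, as a subset of the plane. -/
def lattice : Set ℂ := {z | ∃ x y : ℤ, z = x + y * α}

/-- Vertices of the equilateral triangulation of the plane. -/
abbrev Vertex : Type := {z : ℂ // z ∈ lattice}

/-- Edges: closed segments joining lattice points at distance one. -/
abbrev Edge : Type :=
  {s : Set ℂ // ∃ p ∈ lattice, ∃ u : ℂ, u ^ 6 = 1 ∧ s = segment ℝ p (p + u)}

/-- The closed triangle with vertices `p`, `p + u`, `p + α u`, listed counterclockwise. -/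
def triangle (p u : ℂ) : Set ℂ := convexHull ℝ {p, p + u, p + α * u}

/-- Faces: closed unit triangles with vertices in the lattice. -/
abbrev Face : Type :=
  {F : Set ℂ // ∃ p ∈ lattice, ∃ u : ℂ, u ^ 6 = 1 ∧ F = triangle p u}

/-! ### The group and the quotient triangulation -/

/-- The rotation of order three about `p`. -/
def rot (p : ℂ) : Equiv.Perm ℂ where
  toFun z := p + α ^ 2 * (z - p)
  invFun z := p + α ^ 4 * (z - p)
  left_inv z := by
    have h := α_cube
    linear_combination (α ^ 3 - 1) * (z - p) * h
  right_inv z := by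
    have h := α_cube
    linear_combination (α ^ 3 - 1) * (z - p) * h

/-- The group generated by the order three rotations in the points `β e`, with `e` in the
lattice. -/
def G (β : ℂ) : Subgroup (Equiv.Perm ℂ) :=
  Subgroup.closure {g | ∃ e ∈ lattice, g = rot (β * e)}

/-- Two subsets of the plane are equivalent if a group element carries one to the other. -/
def setSetoid (β : ℂ) : Setoid (Set ℂ) where
  r A B := ∃ g ∈ G β, g '' A = B
  iseqv :=
    { refl := fun A => ⟨1, one_mem _, by simp⟩
      symm := by
        rintro A B ⟨g, hg, rfl⟩
        refine ⟨g⁻¹, inv_mem hg, ?_⟩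
        simp [Set.image_image]
      trans := by
        rintro A B C ⟨g, hg, rfl⟩ ⟨h, hh, rfl⟩
        refine ⟨h * g, mul_mem hh hg, ?_⟩
        simp [Set.image_image] }

def vertexSetoid (β : ℂ) : Setoid Vertex := (setSetoid β).comap (fun v => {v.1})
def edgeSetoid (β : ℂ) : Setoid Edge := (setSetoid β).comap Subtype.val
def faceSetoid (β : ℂ) : Setoid Face := (setSetoid β).comap Subtype.val

/-- Vertices, edges and faces of the quotient triangulation `T(β)`. -/
abbrev TVertex (β : ℂ) : Type := Quotient (vertexSetoid β)
abbrev TEdge (β : ℂ) : Type := Quotient (edgeSetoid β)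
abbrev TFace (β : ℂ) : Type := Quotient (faceSetoid β)

def toTVertex (β : ℂ) (v : Vertex) : TVertex β := Quotient.mk (vertexSetoid β) v
def toTEdge (β : ℂ) (e : Edge) : TEdge β := Quotient.mk (edgeSetoid β) e
def toTFace (β : ℂ) (F : Face) : TFace β := Quotient.mk (faceSetoid β) F

/-- Incidences in `T(β)`: some representatives are incident in the plane. -/
def incVE (β : ℂ) (v : TVertex β) (e : TEdge β) : Prop :=
  ∃ (v' : Vertex) (e' : Edge), toTVertex β v' = v ∧ toTEdge β e' = e ∧ v'.1 ∈ e'.1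

def incVF (β : ℂ) (v : TVertex β) (f : TFace β) : Prop :=
  ∃ (v' : Vertex) (F : Face), toTVertex β v' = v ∧ toTFace β F = f ∧ v'.1 ∈ F.1

def incEF (β : ℂ) (e : TEdge β) (f : TFace β) : Prop :=
  ∃ (e' : Edge) (F : Face), toTEdge β e' = e ∧ toTFace β F = f ∧ e'.1 ⊆ F.1

/-- Finite vertex, edge and face sets with incidence relations form a triangulation of the
sphere: cells are nondegenerate segments and triangles, the triangles fit together to a closed
connected surface (two triangles at each edge, a single cycle of triangles around each vertex),
and the Euler characteristic is two. Several edges may have the same two endpoints. -/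
structure IsSphereTriangulation {V E F : Type} (ve : V → E → Prop) (vf : V → F → Prop)
    (ef : E → F → Prop) : Prop where
  finite_vertices : Finite V
  finite_edges : Finite E
  finite_faces : Finite F
  edge_vertices : ∀ e, {v | ve v e}.ncard = 2
  face_vertices : ∀ f, {v | vf v f}.ncard = 3
  face_edges : ∀ f, {e | ef e f}.ncard = 3
  incidence_trans : ∀ v e f, ve v e → ef e f → vf v f
  face_side : ∀ v w f, vf v f → vf w f → v ≠ w → ∃! e, ef e f ∧ ve v e ∧ ve w e
  edge_faces : ∀ e, {f | ef e f}.ncard = 2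
  link_connected : ∀ v f g, vf v f → vf v g →
    Relation.ReflTransGen (fun f g => vf v f ∧ vf v g ∧ ∃ e, ve v e ∧ ef e f ∧ ef e g) f g
  connected : ∀ v w, Relation.ReflTransGen (fun v w => ∃ e, ve v e ∧ ve w e) v w
  euler : (Nat.card V : ℤ) - Nat.card E + Nat.card F = 2

/-- The degree of a vertex of `T(β)`. -/
def degree (β : ℂ) (v : TVertex β) : ℕ := {e | incVE β v e}.ncard

/-! ### Good colorings. Colors are Booleans; `true` is black, `false` is white. -/

/-- A face coloring is good if around each vertex the numbers of black and of white faces are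
congruent modulo three. -/
def IsGood (β : ℂ) (C : TFace β → Bool) : Prop :=
  ∀ v : TVertex β,
    {f | incVF β v f ∧ C f = true}.ncard ≡ {f | incVF β v f ∧ C f = false}.ncard [MOD 3]

/-- Proper vertex coloring with four colors: adjacent vertices have distinct colors. -/
def IsProper (β : ℂ) (κ : TVertex β → Fin 4) : Prop :=
  ∀ v w : Vertex, ‖v.1 - w.1‖ = 1 → κ (toTVertex β v) ≠ κ (toTVertex β w)

/-- The ordered triples of vertices of the tetrahedron that are positively oriented faces:
the images of one oriented face under the rotations of the tetrahedron, which are the even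
permutations of its four vertices. -/
def PositiveTriple (x y z : Fin 4) : Prop :=
  ∃ σ : Equiv.Perm (Fin 4), Equiv.Perm.sign σ = 1 ∧ σ 0 = x ∧ σ 1 = y ∧ σ 2 = z

/-- `C` is the face coloring of the simplicial map to the tetrahedron given by `κ`: a face is
black if and only if the map preserves its orientation. -/
def Induces (β : ℂ) (κ : TVertex β → Fin 4) (C : TFace β → Bool) : Prop :=
  ∀ (F : Face) (p q r : Vertex) (u : ℂ), u ^ 6 = 1 → q.1 = p.1 + u → r.1 = p.1 + α * u →
    F.1 = triangle p.1 u →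
    (C (toTFace β F) = true ↔
      PositiveTriple (κ (toTVertex β p)) (κ (toTVertex β q)) (κ (toTVertex β r)))

/-! ### Trapezoids and necklaces -/

/-- An Eisenstein trapezoid with labelled sides. The top starts at the lattice point `corner`,
runs in the direction `dir` and has length `topLen`; the trapezoid lies to the right of it.
The diagonal sides have length `diag` and make angles of 60 degrees with the top. If
`diag = topLen` it is a triangle, and the bottom is a point. -/
structure Trapezoid where
  corner : ℂ
  dir : ℂ
  diag : ℕ
  topLen : ℕ
  corner_mem : corner ∈ lattice
  dir_pow : dir ^ 6 = 1
  diag_pos : 0 < diag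
  diag_le : diag ≤ topLen

namespace Trapezoid

variable (X : Trapezoid)

def topLeft : ℂ := X.corner
def topRight : ℂ := X.corner + X.topLen * X.dir
def bottomLeft : ℂ := X.topLeft + X.diag * (X.dir * α⁻¹)
def bottomRight : ℂ := X.topRight + X.diag * (X.dir * α⁻¹ * α⁻¹)

def vertices : Set ℂ := {X.topLeft, X.topRight, X.bottomLeft, X.bottomRight}
def region : Set ℂ := convexHull ℝ X.vertices

def top : Set ℂ := segment ℝ X.topLeft X.topRight
def bottom : Set ℂ := segment ℝ X.bottomLeft X.bottomRight
def left : Set ℂ := segment ℝ X.topLeft X.bottomLeft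
def right : Set ℂ := segment ℝ X.topRight X.bottomRight
def sides : Set (Set ℂ) := {X.top, X.bottom, X.left, X.right}

def Primitive : Prop := Nat.Coprime X.diag X.topLen
def aspect : ℚ := (X.diag : ℚ) / X.topLen

end Trapezoid

/-- Six primitive trapezoids form a trapezoid necklace with center `0`: multiplication by `α`
carries each one, with its labelled sides, to the next. -/
structure IsNecklace (X : ZMod 6 → Trapezoid) : Prop where
  primitive : ∀ i, (X i).Primitive
  disjoint : ∀ i j, i ≠ j → Disjoint (interior (X i).region) (interior (X j).region)
  meet : ∀ i, ∃ z, (X i).region ∩ (X (i + 1)).region = {z} ∧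
    z ∈ (X i).vertices ∧ z ∈ (X (i + 1)).vertices
  rotate : ∀ i, (X (i + 1)).corner = α * (X i).corner ∧ (X (i + 1)).dir = α * (X i).dir ∧
    (X (i + 1)).diag = (X i).diag ∧ (X (i + 1)).topLen = (X i).topLen

/-- `Y` is the necklace that follows `X` inwards: the top of each trapezoid of `Y` is a side
of a trapezoid of `X`, and one of its diagonal sides is a side of a trapezoid of `X` adjacent
to that one. -/
def IsNext (X Y : ZMod 6 → Trapezoid) : Prop :=
  ∀ i, ∃ j j', (j' = j + 1 ∨ j = j' + 1) ∧ (Y i).top ∈ (X j).sides ∧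
    ((Y i).left ∈ (X j').sides ∨ (Y i).right ∈ (X j').sides)

/-! ### Flowers -/

/-- The six unit triangles around the center. -/
def core (i : ℕ) : Set ℂ := convexHull ℝ {0, α ^ i, α ^ (i + 1)}

/-- The hexagon with vertices `α ^ i β`. -/
def hexagon (β : ℂ) : Set ℂ := convexHull ℝ {z | ∃ i : ℕ, z = α ^ i * β}

/-- The union of the necklaces `X 0, …, X (n - 1)` and of the six unit triangles around the
center. -/
def flower (n : ℕ) (X : ℕ → ZMod 6 → Trapezoid) : Set ℂ :=
  (⋃ k < n, ⋃ i, (X k i).region) ∪ ⋃ i < 6, core i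

/-- The necklaces `X 0, …, X (n - 1)`, listed from the outside to the inside, make up a flower
whose capped version (its convex hull) is the hexagon with vertices `α ^ i β`. -/
structure IsFlower (β : ℂ) (n : ℕ) (X : ℕ → ZMod 6 → Trapezoid) : Prop where
  necklace : ∀ k < n, IsNecklace (X k)
  next : ∀ k, k + 1 < n → IsNext (X k) (X (k + 1))
  innermost : ∀ k, k + 1 = n → ∀ i, (X k i).aspect = 1
  disjoint : ∀ k < n, ∀ l < n, k ≠ l → ∀ i j,
    Disjoint (interior (X k i).region) (interior (X l j).region)
  disjoint_core : ∀ k < n, ∀ i j, Disjoint (interior (X k i).region) (interior (core j))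
  hull : convexHull ℝ (flower n X) = hexagon β

/-- The translations of the hexagonal tiling. -/
def tileLattice (β : ℂ) : Set ℂ := {t | ∃ e ∈ lattice, t = β * (1 + α) * e}

/-- The translate of the set `S` by `t`. -/
def translate (t : ℂ) (S : Set ℂ) : Set ℂ := (fun z => t + z) '' S

/-- The translates of the hexagon tile the plane. -/
def HexagonsTile (β : ℂ) : Prop :=
  (⋃ t ∈ tileLattice β, translate t (hexagon β)) = Set.univ ∧
  ∀ t ∈ tileLattice β, ∀ t' ∈ tileLattice β, t ≠ t' →
    Disjoint (interior (translate t (hexagon β))) (interior (translate t' (hexagon β)))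

/-- The color `x` for even indices, the opposite color for odd ones. -/
def alternate (x : Bool) (k : ℕ) : Bool := if Even k then x else !x

/-- `c` is the coloring obtained by tiling the plane by translates of the filled and capped
flower. The necklaces have alternating colors, with `o` the color of the outermost one; the six
triangles around the center have alternating colors, starting with `e`; and the caps, which
make up the rest of the hexagon, have the color opposite to that of the outermost necklace. -/
structure IsTilingColoring (β : ℂ) (n : ℕ) (X : ℕ → ZMod 6 → Trapezoid) (o e : Bool)
    (c : Face → Bool) : Prop where
  necklace : ∀ t ∈ tileLattice β, ∀ k < n, ∀ i, ∀ F : Face,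
    F.1 ⊆ translate t (X k i).region → c F = alternate o k
  core : ∀ t ∈ tileLattice β, ∀ i < 6, ∀ F : Face,
    F.1 = translate t (core i) → c F = alternate e i
  cap : ∀ t ∈ tileLattice β, ∀ F : Face,
    (F.1 ∩ translate t (hexagon β \ flower n X)).Nonempty → c F = !o

/-- Invariance of a planar face coloring under the group. -/
def IsInvariant (β : ℂ) (c : Face → Bool) : Prop :=
  ∀ g ∈ G β, ∀ F F' : Face, g '' F.1 = F'.1 → c F' = c F

/-! ### The slow Gauss map and continued fractions -/

def slowGauss (r : ℚ) : ℚ := if 1 / 2 ≤ r then 1 / r - 1 else 1 / (1 / r - 1)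

/-- The value `1 / (c₁ + 1 / (c₂ + ⋯))` of a finite continued fraction. -/
def cfValue : List ℕ → ℚ
  | [] => 0
  | c :: l => 1 / (c + cfValue l)

/-- `l` lists the partial quotients `c₁, c₂, …` of the continued fraction expansion
`0 : c₁ : c₂ : ⋯` of `r`, where a last partial quotient `1` is allowed only in `1 = 0 : 1`. -/
def IsCFExpansion (l : List ℕ) (r : ℚ) : Prop :=
  (∀ c ∈ l, 0 < c) ∧ (l ≠ [1] → l.getLast? ≠ some 1) ∧ cfValue l = r

/-- `Z` is a striped trapezoid of the flower: its `m` stripes are one trapezoid from each of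
the necklaces `X k, …, X (k + m - 1)`, the first being `X k i₀`, and the top of each further
stripe is the bottom of the one before. -/
def IsStriped (n : ℕ) (X : ℕ → ZMod 6 → Trapezoid) (k m : ℕ) (i₀ : ZMod 6) (Z : Trapezoid) :
    Prop :=
  0 < m ∧ k + m ≤ n ∧ Z.top = (X k i₀).top ∧
  ∃ i : ℕ → ZMod 6, i 0 = i₀ ∧ Z.region = (⋃ s < m, (X (k + s) (i s)).region) ∧
    ∀ s, s + 1 < m → (X (k + s) (i s)).bottom = (X (k + (s + 1)) (i (s + 1))).top

/-- Each trapezoid of the necklace `X k` is the first stripe of a striped trapezoid with `m`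
stripes, and stripes can be added neither at its bottom nor at its top. -/
def IsMaximalBlock (n : ℕ) (X : ℕ → ZMod 6 → Trapezoid) (k m : ℕ) : Prop :=
  (∀ i, ∃ Z, IsStriped n X k m i Z) ∧
  (∀ i, ¬ ∃ Z, IsStriped n X k (m + 1) i Z) ∧
  ∀ k', k' + 1 = k → ∀ i, ¬ ∃ Z, IsStriped n X k' (m + 1) i Z

/-- `p + q α`, with `p ≤ q` coprime, is the image of `β` under a symmetry of the lattice
fixing `0`. -/
def IsReduction (β : ℂ) (p q : ℕ) : Prop :=
  p ≤ q ∧ Nat.Coprime p q ∧ ∃ u : ℂ, u ^ 6 = 1 ∧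
    (β = u * (p + q * α) ∨ β = u * conj ((p : ℂ) + q * α))

end

end Eisenstein

open scoped ComplexConjugate

namespace Eisenstein

noncomputable section

/-! ### Sixth roots of unity and coordinates -/

/-! All geometry is reduced to integer arithmetic. A lattice polygon with sides in the six lattice
directions is cut out by the functionals `h i`, and a unit triangle lies in it exactly when its
scaled barycenter `bary v i` satisfies the tripled bounds (`triangle_subset_poly_iff`). Two polygons
with a common interior point share a whole face (`exists_face_of_mem_interior_poly`), so
disjointness and coverings become statements about barycenters, within reach of `omega`.

The sphere. The elements of `G β` are the maps z ↦ α^(2j) z + t with t in β(1+α)E. Reduction modulo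
1+α (`col`) is therefore an invariant proper 3-coloring of the vertices, so no edge or face is
folded in the quotient. The points with nontrivial stabilizer are those of βE (`IsCone`). They form
three classes, and at each of them six edges become two. Counting incidences gives Euler
characteristic 2.

Good colorings. Passing the faces around a vertex turns the tetrahedron by thirds about the image of
that vertex, one way for black and the other for white. The holonomy around a lattice point is thus
trivial if and only if the signed count of faces vanishes modulo 3, and then the vertex coloring can
be developed over the plane (`exists_develops`). It is determined by its values on one edge. It is
invariant under the rotation about a cone point exactly when the two faces of the quotient there
have opposite colors (`isGood_iff_exists`).

The flower. A state (τ, p, q) stands for a star polygon with six tips, the complement of six cones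
of 120 degrees (`InStar`). The reentrant corners of the star are the tips of the star of
`nextState`, which is a step of the subtractive Euclidean algorithm. The trapezoids of the necklace
fill the difference of two successive stars (`InTrap.inStar`, `exists_inTrap`, `inTrap_unique`), and
the last star is the core. Maximal sequences of subtractions of the same number are the divisions of
the Euclidean algorithm; this gives the continued fraction and the stripes (`exists_cf`,
`IsBlock.isMaximalBlock`).

Goodness of the flower coloring. Modulo 3, the number of faces of a star at a vertex counts the
convex and reentrant corners there (`inStar_count`). The reentrant corners of one star being the
tips of the next, the signed sums of the nested stars telescope, and only the outermost tips survive
(`flowerColor_sum`). Since a and b are coprime, the tips are the only lattice points on the boundary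
of the hexagon (`eq_tip_of_boundary`). Hence a vertex off βE sees a single capped flower, and its
sum is zero. A point of βE is a tile center, where the core alternates, or a tip, where two adjacent
faces have opposite colors (`planeColor_tip_ne`). The tiling coloring is consistent because a cap
never meets a face of another flower (`not_inStar_of_cap`). -/

theorem α_pow_six : α ^ 6 = 1 := by
  linear_combination (α ^ 3 - 1) * α_cube

/-- The sixth roots of unity, indexed additively. -/
def zeta (i : ZMod 6) : ℂ := α ^ i.val

theorem α_pow_mod (n : ℕ) : α ^ (n % 6) = α ^ n := by
  conv_rhs => rw [← Nat.mod_add_div n 6, pow_add, pow_mul, α_pow_six, one_pow, mul_one]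

theorem zeta_natCast (n : ℕ) : zeta (n : ZMod 6) = α ^ n := by
  rw [zeta, ZMod.val_natCast, α_pow_mod]

theorem zeta_add (i j : ZMod 6) : zeta (i + j) = zeta i * zeta j := by
  rw [zeta, zeta, zeta, ZMod.val_add, α_pow_mod, pow_add]

@[simp] theorem zeta_zero : zeta 0 = 1 := by simp [zeta]

@[simp] theorem zeta_one : zeta 1 = α := by
  have := zeta_natCast 1
  simpa using this

theorem α_ne_zero : α ≠ 0 := by
  intro h
  have := α_cube
  rw [h] at this
  norm_num at this

theorem zeta_two : zeta 2 = α - 1 := by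
  rw [← α_sq, show (2 : ZMod 6) = 1 + 1 by decide, zeta_add, zeta_one, sq]

theorem zeta_three : zeta 3 = -1 := by
  rw [show (3 : ZMod 6) = 1 + 2 by decide, zeta_add, zeta_one, zeta_two]
  linear_combination α_sq

theorem zeta_four : zeta 4 = -α := by
  rw [show (4 : ZMod 6) = 1 + 3 by decide, zeta_add, zeta_one, zeta_three]; ring

theorem zeta_five : zeta 5 = 1 - α := by
  rw [show (5 : ZMod 6) = 2 + 3 by decide, zeta_add, zeta_two, zeta_three]; ring

theorem zeta_mul_neg (i : ZMod 6) : zeta i * zeta (-i) = 1 := by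
  rw [← zeta_add, add_neg_cancel, zeta_zero]

theorem zeta_neg (i : ZMod 6) : zeta (-i) = (zeta i)⁻¹ :=
  eq_inv_of_mul_eq_one_right (zeta_mul_neg i)

theorem zeta_pow_six (i : ZMod 6) : zeta i ^ 6 = 1 := by
  rw [zeta, ← pow_mul, mul_comm, pow_mul, α_pow_six, one_pow]

theorem α_inv : α⁻¹ = zeta 5 := by
  rw [show (5 : ZMod 6) = -1 by decide, zeta_neg, zeta_one]

theorem pow_six_eq_one_iff {u : ℂ} : u ^ 6 = 1 ↔ ∃ i, u = zeta i := by
  constructor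
  · intro h
    have h2 : (u - zeta 0) * (u - zeta 1) * (u - zeta 2) * (u - zeta 3) * (u - zeta 4)
        * (u - zeta 5) = 0 := by
      rw [zeta_zero, zeta_one, zeta_two, zeta_three, zeta_four, zeta_five]
      linear_combination h + (u ^ 2 - 1) * (-2 * (u ^ 2 + 1) + (α ^ 2 - α + 1)) * α_sq
    simp only [mul_eq_zero, sub_eq_zero] at h2
    rcases h2 with ((((h | h) | h) | h) | h) | h <;> exact ⟨_, h⟩
  · rintro ⟨i, rfl⟩
    exact zeta_pow_six i

/-- The first coordinate of `z = x + y α`. -/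
def xCoord : ℂ →ₗ[ℝ] ℝ := Complex.reLm - (Real.sqrt 3)⁻¹ • Complex.imLm

/-- The first coordinate of `z` rotated by `zeta i`. These six functionals are the outward
normals of the lattice directions. -/
def h (i : ZMod 6) : ℂ →ₗ[ℝ] ℝ := xCoord ∘ₗ LinearMap.mulLeft ℝ (zeta i)

theorem h_apply (i : ZMod 6) (z : ℂ) : h i z = xCoord (zeta i * z) := rfl

theorem h_zeta_mul (i j : ZMod 6) (z : ℂ) : h i (zeta j * z) = h (i + j) z := by
  rw [h_apply, h_apply, zeta_add, mul_assoc]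

theorem sqrt_three_ne_zero : Real.sqrt 3 ≠ 0 := by positivity

theorem xCoord_apply (z : ℂ) : xCoord z = z.re - (Real.sqrt 3)⁻¹ * z.im := rfl

theorem xCoord_mk (x y : ℝ) : xCoord (x + y * α) = x := by
  have := sqrt_three_ne_zero
  rw [xCoord_apply]
  simp [α]
  field_simp
  ring

theorem h_add_three (i : ZMod 6) (z : ℂ) : h (i + 3) z = -h i z := by
  rw [h_apply, h_apply, zeta_add, zeta_three, ← map_neg]; congr 1; ring

theorem h_add_two (i : ZMod 6) (z : ℂ) : h (i + 2) z = h (i + 1) z - h i z := by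
  rw [h_apply, h_apply, h_apply, zeta_add, zeta_add, zeta_two, zeta_one, ← map_sub]
  congr 1; ring

theorem h_one (z : ℂ) : h 1 z = -h 4 z := by
  have := h_add_three 1 z
  rw [show (1 : ZMod 6) + 3 = 4 by decide] at this
  linarith

theorem h_two (z : ℂ) : h 2 z = -h 0 z - h 4 z := by
  have := h_add_two 0 z
  simp only [zero_add] at this
  rw [this, h_one]; ring

theorem h_three (z : ℂ) : h 3 z = -h 0 z := by simpa using h_add_three 0 z

theorem h_five (z : ℂ) : h 5 z = h 0 z + h 4 z := by
  have := h_add_three 2 z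
  rw [show (2 : ZMod 6) + 3 = 5 by decide] at this
  rw [this, h_two]; ring

theorem eq_coords (z : ℂ) : z = h 0 z + h 4 z * α := by
  have h3 := sqrt_three_ne_zero
  have h1 : h 0 z = z.re - (Real.sqrt 3)⁻¹ * z.im := by
    rw [h_apply, zeta_zero, one_mul, xCoord_apply]
  have h4 : h 4 z = 2 * (Real.sqrt 3)⁻¹ * z.im := by
    rw [h_apply, zeta_four, xCoord_apply]
    simp [α]
    field_simp
    have : Real.sqrt 3 ^ 2 = 3 := Real.sq_sqrt (by norm_num)
    linear_combination z.im * this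
  rw [h1, h4]
  apply Complex.ext
  · simp [α]; ring
  · simp [α]; field_simp
    have : Real.sqrt 3 ^ 2 = 3 := Real.sq_sqrt (by norm_num)
    rw [this]

theorem h_zero_mk (x y : ℝ) : h 0 (x + y * α) = x := by
  rw [h_apply, zeta_zero, one_mul, xCoord_mk]

theorem h_four_mk (x y : ℝ) : h 4 (x + y * α) = y := by
  have : -α * (x + y * α) = y + ((-x - y : ℝ) : ℂ) * α := by
    push_cast
    linear_combination (-y : ℂ) * α_sq
  rw [h_apply, zeta_four, this, xCoord_mk]

theorem ext_coords {z w : ℂ} (h0 : h 0 z = h 0 w) (h4 : h 4 z = h 4 w) : z = w := by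
  rw [eq_coords z, eq_coords w, h0, h4]

theorem h_real_mul (i : ZMod 6) (r : ℝ) (z : ℂ) : h i (r * z) = r * h i z := by
  rw [← Complex.real_smul, map_smul, smul_eq_mul]

/-- The point with integer coordinates `v`. -/
def toC (v : ℤ × ℤ) : ℂ := v.1 + v.2 * α

/-- The integer version of the functionals `h i`. -/
def hz (i : ZMod 6) (v : ℤ × ℤ) : ℤ :=
  (![v.1, -v.2, -v.1 - v.2, -v.1, v.2, v.1 + v.2] : Fin 6 → ℤ) i

@[simp] theorem hz_zero (v : ℤ × ℤ) : hz 0 v = v.1 := rfl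
@[simp] theorem hz_one (v : ℤ × ℤ) : hz 1 v = -v.2 := rfl
@[simp] theorem hz_two (v : ℤ × ℤ) : hz 2 v = -v.1 - v.2 := rfl
@[simp] theorem hz_three (v : ℤ × ℤ) : hz 3 v = -v.1 := rfl
@[simp] theorem hz_four (v : ℤ × ℤ) : hz 4 v = v.2 := rfl
@[simp] theorem hz_five (v : ℤ × ℤ) : hz 5 v = v.1 + v.2 := rfl

/-- Unrolling the six directions turns statements about polygons into finite lists of linear
inequalities for `linarith` and `omega`. -/
theorem forall_zmod_six {p : ZMod 6 → Prop} :
    (∀ i, p i) ↔ p 0 ∧ p 1 ∧ p 2 ∧ p 3 ∧ p 4 ∧ p 5 :=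
  ⟨fun H => ⟨H 0, H 1, H 2, H 3, H 4, H 5⟩, fun ⟨h0, h1, h2, h3, h4, h5⟩ i => by
    fin_cases i <;> assumption⟩

theorem exists_zmod_six {p : ZMod 6 → Prop} :
    (∃ i, p i) ↔ p 0 ∨ p 1 ∨ p 2 ∨ p 3 ∨ p 4 ∨ p 5 := by
  constructor
  · rintro ⟨i, hi⟩
    revert hi
    revert i
    rw [forall_zmod_six]
    tauto
  · rintro (H | H | H | H | H | H) <;> exact ⟨_, H⟩

theorem h_toC (i : ZMod 6) (v : ℤ × ℤ) : h i (toC v) = hz i v := by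
  have h0 : h 0 (toC v) = v.1 := by
    have := h_zero_mk v.1 v.2
    push_cast at this; exact this
  have h4 : h 4 (toC v) = v.2 := by
    have := h_four_mk v.1 v.2
    push_cast at this; exact this
  revert i
  rw [forall_zmod_six]
  simp [h_one, h_two, h_three, h_five, h0, h4]

theorem toC_injective : Function.Injective toC := by
  intro v w hvw
  have h0 := h_toC 0 v
  have h4 := h_toC 4 v
  rw [hvw, h_toC] at h0 h4
  simp at h0 h4
  exact Prod.ext h0.symm h4.symm

theorem toC_inj {v w : ℤ × ℤ} : toC v = toC w ↔ v = w := toC_injective.eq_iff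

@[simp] theorem toC_add (v w : ℤ × ℤ) : toC (v + w) = toC v + toC w := by
  simp [toC]; ring

@[simp] theorem toC_neg (v : ℤ × ℤ) : toC (-v) = -toC v := by
  simp [toC]; ring

@[simp] theorem toC_sub (v w : ℤ × ℤ) : toC (v - w) = toC v - toC w := by
  simp [toC]; ring

@[simp] theorem toC_zero : toC 0 = 0 := by simp [toC]

@[simp] theorem toC_smul (n : ℤ) (v : ℤ × ℤ) : toC (n • v) = n * toC v := by
  simp [toC]; ring

theorem hz_add (i : ZMod 6) (v w : ℤ × ℤ) : hz i (v + w) = hz i v + hz i w := by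
  have : ((hz i (v + w) : ℤ) : ℝ) = (hz i v + hz i w : ℤ) := by
    push_cast
    rw [← h_toC, ← h_toC, ← h_toC, toC_add, map_add]
  exact_mod_cast this

theorem hz_smul (i : ZMod 6) (n : ℤ) (v : ℤ × ℤ) : hz i (n • v) = n * hz i v := by
  revert i
  rw [forall_zmod_six]
  simp
  refine ⟨?_, ?_⟩ <;> ring

theorem hz_sub (i : ZMod 6) (v w : ℤ × ℤ) : hz i (v - w) = hz i v - hz i w := by
  have := hz_add i (v - w) w
  rw [sub_add_cancel] at this
  linarith

/-- Rotation of integer coordinates. -/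
def ro (i : ZMod 6) (v : ℤ × ℤ) : ℤ × ℤ := (hz i v, hz (i + 4) v)

theorem toC_ro (i : ZMod 6) (v : ℤ × ℤ) : toC (ro i v) = zeta i * toC v := by
  apply ext_coords
  · rw [h_toC, h_zeta_mul, zero_add, h_toC]; rfl
  · rw [h_toC, h_zeta_mul, add_comm, h_toC]; rfl

theorem hz_ro (i j : ZMod 6) (v : ℤ × ℤ) : hz i (ro j v) = hz (i + j) v := by
  have : ((hz i (ro j v) : ℤ) : ℝ) = hz (i + j) v := by
    rw [← h_toC, ← h_toC, toC_ro, h_zeta_mul]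
  exact_mod_cast this

@[simp] theorem ro_zero (v : ℤ × ℤ) : ro 0 v = v := rfl

theorem ro_ro (i j : ZMod 6) (v : ℤ × ℤ) : ro i (ro j v) = ro (i + j) v :=
  toC_injective (by simp only [toC_ro, zeta_add, mul_assoc])

theorem ro_add (i : ZMod 6) (v w : ℤ × ℤ) : ro i (v + w) = ro i v + ro i w :=
  toC_injective (by simp only [toC_ro, toC_add, mul_add])

theorem ro_sub (i : ZMod 6) (v w : ℤ × ℤ) : ro i (v - w) = ro i v - ro i w :=
  toC_injective (by simp only [toC_ro, toC_sub, mul_sub])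

theorem ro_smul (i : ZMod 6) (n : ℤ) (v : ℤ × ℤ) : ro i (n • v) = n • ro i v :=
  toC_injective (by simp only [toC_ro, toC_smul]; ring)

theorem ro_three (v : ℤ × ℤ) : ro 3 v = -v :=
  toC_injective (by simp only [toC_ro, toC_neg, zeta_three]; ring)

theorem ro_add_three (i : ZMod 6) (v : ℤ × ℤ) : ro (i + 3) v = -ro i v := by
  rw [add_comm, ← ro_ro, ro_three]

/-- The six unit vectors. -/
def unit (i : ZMod 6) : ℤ × ℤ := ro i (1, 0)

theorem toC_unit (i : ZMod 6) : toC (unit i) = zeta i := by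
  rw [unit, toC_ro]; simp [toC]

theorem ro_unit (i j : ZMod 6) : ro i (unit j) = unit (i + j) := ro_ro _ _ _

theorem unit_add_three (i : ZMod 6) : unit (i + 3) = -unit i := ro_add_three _ _

@[simp] theorem unit_zero : unit 0 = (1, 0) := rfl
@[simp] theorem unit_one : unit 1 = (0, 1) := rfl
@[simp] theorem unit_two : unit 2 = (-1, 1) := rfl
@[simp] theorem unit_three : unit 3 = (-1, 0) := rfl
@[simp] theorem unit_four : unit 4 = (0, -1) := rfl
@[simp] theorem unit_five : unit 5 = (1, -1) := rfl

/-! ### The lattice -/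

theorem mem_lattice_iff {z : ℂ} : z ∈ lattice ↔ ∃ v, z = toC v :=
  ⟨fun ⟨x, y, hz⟩ => ⟨(x, y), hz⟩, fun ⟨v, hv⟩ => ⟨v.1, v.2, hv⟩⟩

theorem toC_mem (v : ℤ × ℤ) : toC v ∈ lattice := mem_lattice_iff.2 ⟨v, rfl⟩

theorem lattice_add {z w : ℂ} (hz : z ∈ lattice) (hw : w ∈ lattice) : z + w ∈ lattice := by
  obtain ⟨v, rfl⟩ := mem_lattice_iff.1 hz
  obtain ⟨v', rfl⟩ := mem_lattice_iff.1 hw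
  exact mem_lattice_iff.2 ⟨v + v', by simp⟩

theorem lattice_neg {z : ℂ} (hz : z ∈ lattice) : -z ∈ lattice := by
  obtain ⟨v, rfl⟩ := mem_lattice_iff.1 hz
  exact mem_lattice_iff.2 ⟨-v, by simp⟩

theorem lattice_mul {z w : ℂ} (hz : z ∈ lattice) (hw : w ∈ lattice) : z * w ∈ lattice := by
  obtain ⟨x, y, rfl⟩ := hz
  obtain ⟨x', y', rfl⟩ := hw
  refine ⟨x * x' - y * y', x * y' + y * x' + y * y', ?_⟩
  push_cast
  linear_combination (y * y' : ℂ) * α_sq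

theorem zeta_mem (i : ZMod 6) : zeta i ∈ lattice := by
  rw [← toC_unit]; exact toC_mem _

theorem lattice_zeta_mul {z : ℂ} (i : ZMod 6) (hz : z ∈ lattice) : zeta i * z ∈ lattice :=
  lattice_mul (zeta_mem i) hz

theorem int_mem_lattice (n : ℤ) : (n : ℂ) ∈ lattice := ⟨n, 0, by simp⟩

/-! ### Lattice polygons and faces -/

/-- The lattice polygon with bounds `c` for the six functionals `h i`. -/
def poly (c : ZMod 6 → ℤ) : Set ℂ := {z | ∀ i, h i z ≤ c i}

/-- The bounds of the unit triangle `0, 1, α`. -/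
def supp (i : ZMod 6) : ℤ := (![1, 0, 0, 0, 1, 1] : Fin 6 → ℤ) i

/-- The bounds of the unit triangle `v, v + unit i, v + unit (i + 1)`. -/
def faceBound (v : ℤ × ℤ) (i j : ZMod 6) : ℤ := hz j v + supp (i + j)

/-- The trapezoid with top from `c` to `c + q u` and diagonal sides of length `d`, where
`u = zeta j`. -/
theorem convexHull_trapezoid (c : ℂ) (j : ZMod 6) (d q : ℝ) (hd : 0 < d) (hdq : d ≤ q) :
    convexHull ℝ {c, c + q * zeta j, c + d * (zeta j * α⁻¹),
      c + q * zeta j + d * (zeta j * α⁻¹ * α⁻¹)} =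
    {z | h (-j) (z - c) ≤ q ∧ 0 ≤ h (5 - j) (z - c) ∧ -d ≤ h (4 - j) (z - c) ∧
      h (4 - j) (z - c) ≤ 0} := by
  have e0 : ∀ w, h (-j) (zeta j * w) = h 0 w := fun w => by rw [h_zeta_mul]; simp
  have e4 : ∀ w, h (4 - j) (zeta j * w) = h 4 w := fun w => by rw [h_zeta_mul]; simp
  have e5 : ∀ w, h (5 - j) (zeta j * w) = h 0 w + h 4 w := fun w => by
    rw [h_zeta_mul, ← h_five]; simp
  have key : ∀ x y : ℝ, h (-j) (zeta j * (x + y * α)) = x ∧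
      h (4 - j) (zeta j * (x + y * α)) = y ∧ h (5 - j) (zeta j * (x + y * α)) = x + y := by
    intro x y
    rw [e0, e4, e5, h_zero_mk, h_four_mk]
    exact ⟨rfl, rfl, rfl⟩
  have hα5 : α⁻¹ = 1 - α := by rw [α_inv, zeta_five]
  have hα4 : α⁻¹ * α⁻¹ = -α := by
    rw [hα5]; linear_combination α_sq
  apply Set.Subset.antisymm
  · apply convexHull_min
    · intro z hz
      have : ∃ x y : ℝ, z - c = zeta j * (x + y * α) ∧ x ≤ q ∧ 0 ≤ x + y ∧ -d ≤ y ∧ y ≤ 0 := by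
        rcases hz with rfl | rfl | rfl | rfl
        · exact ⟨0, 0, by simp, by linarith, by linarith, by linarith, by linarith⟩
        · exact ⟨q, 0, by push_cast; ring, by linarith, by linarith, by linarith, by linarith⟩
        · refine ⟨d, -d, ?_, by linarith, by linarith, by linarith, by linarith⟩
          rw [hα5]; push_cast; ring
        · refine ⟨q, -d, ?_, by linarith, by linarith, by linarith, by linarith⟩
          rw [mul_assoc, hα4]; push_cast; ring
      obtain ⟨x, y, hxy, h1, h2, h3, h4⟩ := this
      obtain ⟨k0, k4, k5⟩ := key x y
      simp only [Set.mem_ofPred_eq, hxy, k0, k4, k5]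
      exact ⟨h1, h2, h3, h4⟩
    · intro z hz w hw a b ha hb hab
      have hc : a • z + b • w - c = a • (z - c) + b • (w - c) := by
        have : (c : ℂ) = (a : ℂ) * c + b * c := by
          rw [← add_mul, ← Complex.ofReal_add, hab, Complex.ofReal_one, one_mul]
        simp only [Complex.real_smul]
        linear_combination -this
      have comb : ∀ r s t : ℝ, r ≤ t → s ≤ t → a * r + b * s ≤ t := fun r s t hr hs => by
        have h1 := mul_le_mul_of_nonneg_left hr ha
        have h2 := mul_le_mul_of_nonneg_left hs hb
        have h3 : a * t + b * t = t := by rw [← add_mul, hab, one_mul]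
        linarith
      obtain ⟨z1, z2, z3, z4⟩ := hz
      obtain ⟨w1, w2, w3, w4⟩ := hw
      simp only [Set.mem_ofPred_eq, hc, map_add, map_smul, smul_eq_mul]
      refine ⟨comb _ _ _ z1 w1, ?_, ?_, comb _ _ _ z4 w4⟩
      · have := comb _ _ _ (neg_nonpos.2 z2) (neg_nonpos.2 w2)
        linarith
      · have := comb _ _ _ (neg_le.1 z3) (neg_le.1 w3)
        linarith
  · rintro z ⟨h1, h2, h3, h4⟩
    set S : Set ℂ := {c, c + q * zeta j, c + d * (zeta j * α⁻¹),
      c + q * zeta j + d * (zeta j * α⁻¹ * α⁻¹)} with hS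
    obtain ⟨x, y, hz⟩ : ∃ x y : ℝ, z = c + zeta j * (x + y * α) := by
      refine ⟨h 0 (zeta (-j) * (z - c)), h 4 (zeta (-j) * (z - c)), ?_⟩
      rw [← eq_coords, ← mul_assoc, zeta_mul_neg]; ring
    obtain ⟨k0, k4, k5⟩ := key x y
    rw [hz, add_sub_cancel_left] at h1 h2 h3 h4
    rw [k0] at h1
    rw [k4] at h3 h4
    rw [k5] at h2
    have hconv := convex_convexHull ℝ S
    have hmem : ∀ w ∈ S, w ∈ convexHull ℝ S := fun w hw => subset_convexHull ℝ S hw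
    -- The parallel to the top through z cuts both diagonal sides at the fraction -y/d of their
    -- length, and z lies on the chord between the two cut points.
    have ht : -y / d ∈ Set.Icc (0 : ℝ) 1 :=
      ⟨div_nonneg (by linarith) hd.le, (div_le_one hd).2 (by linarith)⟩
    have hdc : (d : ℂ) ≠ 0 := by exact_mod_cast hd.ne'
    have hL := hconv.add_smul_sub_mem (hmem c (by simp [hS]))
      (hmem (c + d * (zeta j * α⁻¹)) (by simp [hS])) ht
    have hR := hconv.add_smul_sub_mem (hmem (c + q * zeta j) (by simp [hS]))
      (hmem (c + q * zeta j + d * (zeta j * α⁻¹ * α⁻¹)) (by simp [hS])) ht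
    have eL : c + (-y / d) • (c + d * (zeta j * α⁻¹) - c) = c + zeta j * (-y * (1 - α)) := by
      rw [Complex.real_smul, hα5]; push_cast; field_simp; ring
    have eR : c + q * zeta j + (-y / d) • (c + q * zeta j + d * (zeta j * α⁻¹ * α⁻¹)
        - (c + q * zeta j)) = c + zeta j * (q + y * α) := by
      rw [Complex.real_smul, mul_assoc (zeta j), hα4]; push_cast; field_simp; ring
    rw [eL] at hL
    rw [eR] at hR
    -- The chord has length q + y, which vanishes only at the apex of a triangle.
    rcases eq_or_ne (q + y) 0 with h0 | h0
    · have : x + y = 0 := by linarith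
      have hx : (x : ℂ) = -y := by
        have : x = -y := by linarith
        rw [this]; simp
      rw [hz, hx]
      convert hL using 2
      ring
    · have hpos : 0 < q + y := lt_of_le_of_ne (by linarith) h0.symm
      have hs : (x + y) / (q + y) ∈ Set.Icc (0 : ℝ) 1 :=
        ⟨div_nonneg h2 hpos.le, (div_le_one hpos).2 (by linarith)⟩
      have := hconv.add_smul_sub_mem hL hR hs
      convert this using 1
      have h0c : (q + y : ℂ) ≠ 0 := by exact_mod_cast h0
      rw [hz, Complex.real_smul]; push_cast; field_simp; ring

/-- A unit triangle is the degenerate trapezoid with d = q = 1 whose top is the side from v in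
direction i + 1. -/
theorem triangle_eq_poly (v : ℤ × ℤ) (i : ZMod 6) :
    triangle (toC v) (zeta i) = poly (faceBound v i) := by
  have H := convexHull_trapezoid (toC v) (i + 1) 1 1 one_pos le_rfl
  have hset : ({toC v, toC v + (1 : ℝ) * zeta (i + 1), toC v + (1 : ℝ) * (zeta (i + 1) * α⁻¹),
      toC v + (1 : ℝ) * zeta (i + 1) + (1 : ℝ) * (zeta (i + 1) * α⁻¹ * α⁻¹)} : Set ℂ) =
      {toC v, toC v + zeta i, toC v + α * zeta i} := by
    have e1 : zeta (i + 1) * α⁻¹ = zeta i := by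
      rw [zeta_add, zeta_one, mul_inv_cancel_right₀ α_ne_zero]
    have e2 : zeta (i + 1) = α * zeta i := by rw [zeta_add, zeta_one, mul_comm]
    have e3 : α * zeta i + zeta i * α⁻¹ = zeta i := by
      rw [α_inv, zeta_five]; ring
    rw [e1, e2]
    simp only [Complex.ofReal_one, one_mul, add_assoc, e3]
    ext z
    simp only [Set.mem_insert_iff, Set.mem_singleton_iff]
    tauto
  rw [hset] at H
  rw [triangle, H]
  ext z
  simp only [poly, Set.mem_ofPred_eq, faceBound]
  have e : ∀ j, h j z = h j (z - toC v) + hz j v := fun j => by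
    rw [map_sub, h_toC]; ring
  generalize z - toC v = w at e ⊢
  simp only [e]
  have e0 : h (-(i + 1)) w = h (-i) w + h (4 - i) w := by
    rw [show -(i + 1) = 5 - i by have : (-1 : ZMod 6) = 5 := by decide
                                 linear_combination this]
    have := h_add_two (3 - i) w
    rw [show 3 - i + 2 = 5 - i by ring, show 3 - i + 1 = 4 - i by ring] at this
    have h3 := h_add_three (-i) w
    rw [show -i + 3 = 3 - i by ring] at h3
    linarith
  have e3 : h (4 - (i + 1)) w = -h (-i) w := by
    rw [← h_add_three]; congr 2; ring
  have e5 : h (5 - (i + 1)) w = h (4 - i) w := by congr 2; ring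
  have hall : (∀ j, h j w + (hz j v : ℝ) ≤ ((hz j v + supp (i + j) : ℤ) : ℝ)) ↔
      ∀ j, h (j - i) w ≤ (supp j : ℝ) := by
    constructor
    · intro H j
      have := H (j - i)
      rw [add_sub_cancel] at this
      push_cast at this
      linarith
    · intro H j
      have := H (i + j)
      rw [add_sub_cancel_left] at this
      push_cast
      linarith
  rw [hall, forall_zmod_six, e0, e3, e5]
  have f0 : h (0 - i) w = h (-i) w := by rw [zero_sub]
  have f1 : h (1 - i) w = -h (4 - i) w := by
    rw [← h_add_three]; congr 2
    have : (7 : ZMod 6) = 1 := by decide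
    linear_combination -this
  have f3 : h (3 - i) w = -h (-i) w := by rw [← h_add_three]; congr 2; ring
  have f5 : h (5 - i) w = h (-i) w + h (4 - i) w := by
    have := h_add_two (3 - i) w
    rw [show 3 - i + 2 = 5 - i by ring, show 3 - i + 1 = 4 - i by ring] at this
    linarith
  have f2 : h (2 - i) w = -h (-i) w - h (4 - i) w := by
    have := h_add_two (-i) w
    rw [show -i + 2 = 2 - i by ring, show -i + 1 = 1 - i by ring] at this
    linarith
  rw [f0, f1, f2, f3, f5]
  simp only [supp]
  simp
  constructor
  · rintro ⟨a, b, c, d⟩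
    refine ⟨?_, ?_, ?_, ?_, ?_, ?_⟩ <;> linarith
  · rintro ⟨a, b, c, d, e, f⟩
    refine ⟨?_, ?_, ?_, ?_⟩ <;> linarith

/-! ### Interiors -/

theorem exists_add_mem_of_mem_interior {A : Set ℂ} {z : ℂ} (hz : z ∈ interior A) (d : ℂ) :
    ∃ ε : ℝ, 0 < ε ∧ z + ε * d ∈ A := by
  have hc : Continuous fun ε : ℝ => z + ε * d := by fun_prop
  have hopen := (isOpen_interior (s := A)).preimage hc
  have h0 : (0 : ℝ) ∈ (fun ε : ℝ => z + ε * d) ⁻¹' interior A := by simpa using hz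
  obtain ⟨r, hr, hball⟩ := Metric.isOpen_iff.1 hopen 0 h0
  refine ⟨r / 2, by linarith, interior_subset (hball ?_)⟩
  rw [Metric.mem_ball, Real.dist_eq, sub_zero, abs_of_pos (by linarith)]
  linarith

theorem h_zeta_neg (i : ZMod 6) : h i (zeta (-i)) = 1 := by
  rw [← mul_one (zeta (-i)), h_zeta_mul, add_neg_cancel]
  have := h_zero_mk 1 0
  simpa using this

theorem h_lt_of_mem_interior {A : Set ℂ} {z : ℂ} {i : ZMod 6} {r : ℝ} (hz : z ∈ interior A)
    (hA : ∀ w ∈ A, h i w ≤ r) : h i z < r := by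
  obtain ⟨ε, hε, hm⟩ := exists_add_mem_of_mem_interior hz (zeta (-i))
  have := hA _ hm
  rw [map_add, h_real_mul, h_zeta_neg] at this
  linarith

theorem supp_add_three (k : ZMod 6) : supp k + supp (k + 3) = 1 := by
  revert k; decide

theorem hz_add_three (k : ZMod 6) (v : ℤ × ℤ) : hz (k + 3) v = -hz k v := by
  revert k; rw [forall_zmod_six]
  refine ⟨?_, ?_, ?_, ?_, ?_, ?_⟩ <;> simp [hz, show (5 : ZMod 6) + 3 = 2 by decide,
    show (2 : ZMod 6) + 3 = 5 by decide, show (1 : ZMod 6) + 3 = 4 by decide,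
    show (4 : ZMod 6) + 3 = 1 by decide, show (3 : ZMod 6) + 3 = 0 by decide]
  · ring
  · ring

theorem faceBound_add_three (v : ℤ × ℤ) (i j : ZMod 6) :
    faceBound v i (j + 3) = 1 - faceBound v i j := by
  have := supp_add_three (i + j)
  rw [faceBound, faceBound, hz_add_three, ← add_assoc]
  linarith

/-- A lattice polygon that contains an inner point of a face contains the face. -/
theorem faceBound_le_of_mem {v : ℤ × ℤ} {i : ZMod 6} {z : ℂ} {c : ZMod 6 → ℤ}
    (hz : ∀ j, h j z < faceBound v i j) (hc : z ∈ poly c) (j : ZMod 6) :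
    faceBound v i j ≤ c j := by
  -- Opposite bounds of a face add up to one, so `h j` exceeds `faceBound v i j - 1` at inner
  -- points; integrality of `c j` does the rest.
  have h1 := hz (j + 3)
  rw [h_add_three, faceBound_add_three] at h1
  have h2 := hc j
  have : ((faceBound v i j : ℤ) : ℝ) < (c j + 1 : ℤ) := by push_cast at h1 ⊢; linarith
  have := Int.cast_lt.1 this
  omega

/-- The sum of two successive unit vectors, which is three times the barycenter of the face
between them. -/
def delta (i : ZMod 6) : ℤ × ℤ := unit i + unit (i + 1)

@[simp] theorem delta_zero : delta 0 = (1, 1) := rfl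
@[simp] theorem delta_one : delta 1 = (-1, 2) := rfl
@[simp] theorem delta_two : delta 2 = (-2, 1) := rfl
@[simp] theorem delta_three : delta 3 = (-1, -1) := rfl
@[simp] theorem delta_four : delta 4 = (1, -2) := rfl
@[simp] theorem delta_five : delta 5 = (2, -1) := rfl

theorem ro_delta (i j : ZMod 6) : ro i (delta j) = delta (i + j) := by
  rw [delta, ro_add, ro_unit, ro_unit, delta, add_assoc]

/-- Three times the barycenter of the face with vertices `v, v + unit i, v + unit (i + 1)`. -/
def bary (v : ℤ × ℤ) (i : ZMod 6) : ℤ × ℤ := (3 : ℤ) • v + delta i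

theorem hz_delta (i j : ZMod 6) :
    3 * supp (i + j) - 2 ≤ hz j (delta i) ∧ hz j (delta i) ≤ 3 * supp (i + j) - 1 := by
  revert i j; decide

theorem faceBound_bary (v : ℤ × ℤ) (i j : ZMod 6) :
    3 * faceBound v i j - 2 ≤ hz j (bary v i) ∧ hz j (bary v i) ≤ 3 * faceBound v i j - 1 := by
  have := hz_delta i j
  rw [bary, hz_add, hz_smul, faceBound]
  omega

/-- Each functional of the scaled barycenter is one or two less than three times the bound of the
face, so rounding up to a multiple of 3 recovers the bound. This is what allows a face to be
replaced by a single lattice point. -/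
theorem faceBound_le_iff {v : ℤ × ℤ} {i : ZMod 6} {c : ZMod 6 → ℤ} :
    (∀ j, faceBound v i j ≤ c j) ↔ ∀ j, hz j (bary v i) ≤ 3 * c j := by
  refine forall_congr' fun j => ?_
  have := faceBound_bary v i j
  omega

/-- These points run from the vertex v to the barycenter, reached at ε = 1/3. The parameter stays
free because `planeColor_sum_of_not_isCone` needs inner points arbitrarily close to v. -/
theorem inner_point (v : ℤ × ℤ) (i j : ZMod 6) {ε : ℝ} (h0 : 0 < ε) (h1 : ε ≤ 1 / 3) :
    h j (toC v + ε * toC (delta i)) < faceBound v i j := by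
  rw [map_add, h_real_mul, h_toC, h_toC, faceBound, Int.cast_add]
  have : ε * (hz j (delta i) : ℝ) < (supp (i + j) : ℝ) := by
    have key : (supp (i + j) = 0 ∧ hz j (delta i) < 0) ∨
        (supp (i + j) = 1 ∧ hz j (delta i) ≤ 2) := by
      revert i j; decide
    rcases key with ⟨k1, k2⟩ | ⟨k1, k2⟩
    · rw [k1]
      have : (hz j (delta i) : ℝ) < 0 := by exact_mod_cast k2
      simpa using mul_neg_of_pos_of_neg h0 this
    · rw [k1]
      have : (hz j (delta i) : ℝ) ≤ 2 := by exact_mod_cast k2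
      push_cast
      nlinarith
  linarith

theorem poly_subset_iff {v : ℤ × ℤ} {i : ZMod 6} {c : ZMod 6 → ℤ} :
    poly (faceBound v i) ⊆ poly c ↔ ∀ j, faceBound v i j ≤ c j := by
  constructor
  · intro H
    have h1 := fun j => inner_point v i j (ε := 1 / 3) (by norm_num) le_rfl
    exact faceBound_le_of_mem h1 (H fun j => (h1 j).le)
  · intro H z hz j
    exact (hz j).trans (by exact_mod_cast H j)

theorem triangle_subset_poly_iff {v : ℤ × ℤ} {i : ZMod 6} {c : ZMod 6 → ℤ} :
    triangle (toC v) (zeta i) ⊆ poly c ↔ ∀ j, hz j (bary v i) ≤ 3 * c j := by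
  rw [triangle_eq_poly, poly_subset_iff, faceBound_le_iff]

theorem triangle_inj {v w : ℤ × ℤ} {i j : ZMod 6} :
    triangle (toC v) (zeta i) = triangle (toC w) (zeta j) ↔ bary v i = bary w j := by
  constructor
  · intro H
    have h1 := poly_subset_iff.1 ((triangle_eq_poly v i ▸ triangle_eq_poly w j ▸ H).subset)
    have h2 := poly_subset_iff.1 ((triangle_eq_poly v i ▸ triangle_eq_poly w j ▸ H).superset)
    have h3 : ∀ k, faceBound v i k = faceBound w j k := fun k => le_antisymm (h1 k) (h2 k)
    have b1 := faceBound_bary v i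
    have b2 := faceBound_bary w j
    simp only [← h3] at b2
    rw [forall_zmod_six] at b1 b2
    simp only [hz_zero, hz_one, hz_two, hz_three, hz_four, hz_five] at b1 b2
    -- The bounds fix both coordinates of the scaled barycenter up to one. Their congruence modulo 3
    -- leaves two candidates, which the bound on the sum of the coordinates tells apart.
    have h3 : ∀ i, (delta i).1 % 3 = (delta i).2 % 3 := by decide
    have m1 : (bary v i).1 % 3 = (bary v i).2 % 3 := by
      have := h3 i
      simp only [bary, Prod.fst_add, Prod.snd_add, Prod.smul_fst, Prod.smul_snd, smul_eq_mul]
      omega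
    have m2 : (bary w j).1 % 3 = (bary w j).2 % 3 := by
      have := h3 j
      simp only [bary, Prod.fst_add, Prod.snd_add, Prod.smul_fst, Prod.smul_snd, smul_eq_mul]
      omega
    apply Prod.ext <;> omega
  · intro H
    have key : ∀ {v w : ℤ × ℤ} {i j : ZMod 6}, bary v i = bary w j →
        poly (faceBound v i) ⊆ poly (faceBound w j) := by
      intro v w i j H
      rw [poly_subset_iff, faceBound_le_iff, H]
      intro k
      have := faceBound_bary w j k
      omega
    rw [triangle_eq_poly, triangle_eq_poly]
    exact (key H).antisymm (key H.symm)

/-- Each point lies in a face that is contained in each polygon whose interior contains the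
point. -/
theorem exists_face (z : ℂ) : ∃ v i, z ∈ triangle (toC v) (zeta i) ∧
    ∀ j (c : ℤ), h j z < c → faceBound v i j ≤ c := by
  simp only [triangle_eq_poly, poly, Set.mem_ofPred_eq]
  set x := h 0 z with hx
  set y := h 4 z with hy
  have fx := Int.floor_le x
  have fx' := Int.lt_floor_add_one x
  have fy := Int.floor_le y
  have fy' := Int.lt_floor_add_one y
  have key : ∀ (r : ℝ) (c m : ℤ), (m : ℝ) ≤ r → r < c → m + 1 ≤ c := fun r c m h1 h2 => by
    have : (m : ℝ) < c := by linarith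
    have := Int.cast_lt.1 this
    omega
  have key2 : ∀ (r : ℝ) (c m : ℤ), r < m + 1 → -r < c → -m ≤ c := fun r c m h1 h2 => by
    have : ((-m - 1 : ℤ) : ℝ) < c := by push_cast; linarith
    have := Int.cast_lt.1 this
    omega
  -- The unit parallelogram at the floors of the coordinates is cut by its diagonal into a face of
  -- direction 0 and, seen from the opposite corner, a face of direction 3.
  rcases lt_or_ge (x + y) (⌊x⌋ + ⌊y⌋ + 1) with hs | hs
  · refine ⟨(⌊x⌋, ⌊y⌋), 0, ?_, ?_⟩
    · rw [forall_zmod_six]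
      simp only [h_one, h_two, h_three, h_five, ← hx, ← hy, faceBound, supp]
      simp
      refine ⟨?_, ?_, ?_, ?_, ?_, ?_⟩ <;> linarith
    · rw [forall_zmod_six]
      simp only [h_one, h_two, h_three, h_five, ← hx, ← hy, faceBound, supp]
      simp
      refine ⟨fun c hc => key _ _ _ fx hc, fun c hc => ?_, fun c hc => ?_, fun c hc => ?_,
        fun c hc => key _ _ _ fy hc, fun c hc => ?_⟩
      · have := key2 _ _ _ fy' hc; omega
      · have := key2 (x + y) c (⌊x⌋ + ⌊y⌋) (by push_cast; linarith) (by linarith); omega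
      · have := key2 _ _ _ fx' hc; omega
      · have := key (x + y) c (⌊x⌋ + ⌊y⌋) (by push_cast; linarith) (by linarith); omega
  · refine ⟨(⌊x⌋ + 1, ⌊y⌋ + 1), 3, ?_, ?_⟩
    · rw [forall_zmod_six]
      simp only [h_one, h_two, h_three, h_five, ← hx, ← hy, faceBound]
      simp [show ∀ k, supp k = (![1, 0, 0, 0, 1, 1] : Fin 6 → ℤ) k from fun _ => rfl,
        show (3 : ZMod 6) + 1 = 4 by decide, show (3 : ZMod 6) + 2 = 5 by decide,
        show (3 : ZMod 6) + 3 = 0 by decide, show (3 : ZMod 6) + 4 = 1 by decide,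
        show (3 : ZMod 6) + 5 = 2 by decide]
      refine ⟨?_, ?_, ?_, ?_, ?_, ?_⟩ <;> linarith
    · rw [forall_zmod_six]
      simp only [h_one, h_two, h_three, h_five, ← hx, ← hy, faceBound]
      simp [show ∀ k, supp k = (![1, 0, 0, 0, 1, 1] : Fin 6 → ℤ) k from fun _ => rfl,
        show (3 : ZMod 6) + 1 = 4 by decide, show (3 : ZMod 6) + 2 = 5 by decide,
        show (3 : ZMod 6) + 3 = 0 by decide, show (3 : ZMod 6) + 4 = 1 by decide,
        show (3 : ZMod 6) + 5 = 2 by decide]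
      refine ⟨fun c hc => key _ _ _ fx hc, fun c hc => ?_, fun c hc => ?_, fun c hc => ?_,
        fun c hc => key _ _ _ fy hc, fun c hc => ?_⟩
      · have := key2 _ _ _ fy' hc; omega
      · have := key2 (x + y) c (⌊x⌋ + ⌊y⌋ + 1) (by push_cast; linarith) (by linarith); omega
      · have := key2 _ _ _ fx' hc; omega
      · have := key (x + y) c (⌊x⌋ + ⌊y⌋ + 1) (by push_cast; linarith) (by linarith); omega

/-- This is how all disjointness claims are proved: overlapping polygons would share a face, and the
barycenter of that face would satisfy contradictory inequalities. -/
theorem exists_face_of_mem_interior_poly {z : ℂ} {c c' : ZMod 6 → ℤ}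
    (h1 : z ∈ interior (poly c)) (h2 : z ∈ interior (poly c')) :
    ∃ v i, (∀ j, hz j (bary v i) ≤ 3 * c j) ∧ ∀ j, hz j (bary v i) ≤ 3 * c' j := by
  obtain ⟨v, i, -, hj⟩ := exists_face z
  refine ⟨v, i, faceBound_le_iff.1 fun j => hj j _ ?_, faceBound_le_iff.1 fun j => hj j _ ?_⟩
  · exact h_lt_of_mem_interior h1 fun w hw => hw j
  · exact h_lt_of_mem_interior h2 fun w hw => hw j

/-- The possible values of `bary`. -/
def IsBary (B : ℤ × ℤ) : Prop := (B.1 - B.2) % 3 = 0 ∧ B.1 % 3 ≠ 0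

theorem isBary_bary (v : ℤ × ℤ) (i : ZMod 6) : IsBary (bary v i) := by
  have h3 : ∀ i, ((delta i).1 - (delta i).2) % 3 = 0 ∧ (delta i).1 % 3 ≠ 0 := by decide
  have := h3 i
  simp only [IsBary, bary, Prod.fst_add, Prod.snd_add, Prod.smul_fst, Prod.smul_snd, smul_eq_mul]
  omega

theorem toC_mem_triangle_iff {v w : ℤ × ℤ} {i : ZMod 6} :
    toC w ∈ triangle (toC v) (zeta i) ↔ w = v ∨ w = v + unit i ∨ w = v + unit (i + 1) := by
  constructor
  · rw [triangle_eq_poly]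
    intro H
    have H1 : ∀ j, hz j w ≤ hz j v + supp (i + j) := fun j => by
      have := H j
      rw [h_toC] at this
      exact_mod_cast this
    have H2 : ∀ j, hz j (ro (-i) (w - v)) ≤ supp j := fun j => by
      rw [hz_ro, hz_sub]
      have := H1 (j - i)
      rw [add_sub_cancel] at this
      rw [← sub_eq_add_neg]
      linarith
    have H3 : w = v + ro i (ro (-i) (w - v)) := by
      rw [ro_ro, add_neg_cancel, ro_zero]; abel
    generalize ro (-i) (w - v) = u at H2 H3
    rw [forall_zmod_six] at H2
    simp [supp] at H2
    have : u = 0 ∨ u = unit 0 ∨ u = unit 1 := by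
      obtain ⟨x, y⟩ := u
      simp only [unit_zero, unit_one, Prod.mk.injEq, Prod.mk_eq_zero] at H2 ⊢
      omega
    rw [H3]
    rcases this with rfl | rfl | rfl
    · left
      rw [show (0 : ℤ × ℤ) = (0 : ℤ) • 0 by simp, ro_smul]; simp
    · right; left; rw [ro_unit]; simp
    · right; right; rw [ro_unit]
  · intro H
    apply subset_convexHull
    rcases H with rfl | rfl | rfl
    · simp
    · simp [toC_unit]
    · simp [toC_unit, zeta_add, mul_comm]

/-! ### The group -/

theorem image_convexHull_affine (a t : ℂ) (S : Set ℂ) :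
    (fun z => a * z + t) '' convexHull ℝ S = convexHull ℝ ((fun z => a * z + t) '' S) :=
  ((LinearMap.mulLeft ℝ a).toAffineMap + AffineMap.const ℝ ℂ t).image_convexHull S

theorem mem_translate {t z : ℂ} {S : Set ℂ} : z ∈ translate t S ↔ z - t ∈ S := by
  constructor
  · rintro ⟨w, hw, rfl⟩; simpa using hw
  · intro H; exact ⟨z - t, H, by simp⟩

theorem tileLattice_zero (β : ℂ) : 0 ∈ tileLattice β := ⟨0, toC_zero ▸ toC_mem 0, by simp⟩

theorem tileLattice_add {β s t : ℂ} (hs : s ∈ tileLattice β) (ht : t ∈ tileLattice β) :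
    s + t ∈ tileLattice β := by
  obtain ⟨e, he, rfl⟩ := hs
  obtain ⟨f, hf, rfl⟩ := ht
  exact ⟨e + f, lattice_add he hf, by ring⟩

theorem tileLattice_neg {β t : ℂ} (ht : t ∈ tileLattice β) : -t ∈ tileLattice β := by
  obtain ⟨f, hf, rfl⟩ := ht
  exact ⟨-f, lattice_neg hf, by ring⟩

theorem tileLattice_sub {β s t : ℂ} (hs : s ∈ tileLattice β) (ht : t ∈ tileLattice β) :
    s - t ∈ tileLattice β := by
  rw [sub_eq_add_neg]; exact tileLattice_add hs (tileLattice_neg ht)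

theorem tileLattice_zeta_mul {β t : ℂ} (i : ZMod 6) (ht : t ∈ tileLattice β) :
    zeta i * t ∈ tileLattice β := by
  obtain ⟨f, hf, rfl⟩ := ht
  exact ⟨zeta i * f, lattice_zeta_mul i hf, by ring⟩

theorem rot_apply (p z : ℂ) : rot p z = p + α ^ 2 * (z - p) := rfl

theorem α_sq_eq_zeta : α ^ 2 = zeta 2 := by rw [zeta_two, α_sq]

/-- The translation part is (1 - α²)βe, and 1 - α² = (1 + α)α⁻¹. This is where the lattice β(1+α)E
comes from. -/
theorem rot_mul_apply (β e z : ℂ) :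
    rot (β * e) z = zeta 2 * z + β * (1 + α) * (zeta 5 * e) := by
  rw [rot_apply, α_sq_eq_zeta, zeta_two, zeta_five]
  linear_combination β * e * α_sq

theorem exists_of_mem_G {β : ℂ} {g : Equiv.Perm ℂ} (hg : g ∈ G β) :
    ∃ j : ZMod 6, ∃ t ∈ tileLattice β, ∀ z, g z = zeta (2 * j) * z + t := by
  induction hg using Subgroup.closure_induction with
  | mem g hg =>
    obtain ⟨e, he, rfl⟩ := hg
    refine ⟨1, _, ⟨zeta 5 * e, lattice_zeta_mul 5 he, rfl⟩, fun z => ?_⟩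
    rw [rot_mul_apply, mul_one]
  | one => exact ⟨0, 0, tileLattice_zero β, fun z => by simp⟩
  | mul g g' _ _ hg hg' =>
    obtain ⟨j, t, ht, hj⟩ := hg
    obtain ⟨j', t', ht', hj'⟩ := hg'
    refine ⟨j + j', zeta (2 * j) * t' + t,
      tileLattice_add (tileLattice_zeta_mul _ ht') ht, fun z => ?_⟩
    rw [Equiv.Perm.mul_apply, hj', hj, mul_add 2, zeta_add]; ring
  | inv g _ hg =>
    obtain ⟨j, t, ht, hj⟩ := hg
    refine ⟨-j, -(zeta (-(2 * j)) * t), tileLattice_neg (tileLattice_zeta_mul _ ht), fun z => ?_⟩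
    rw [Equiv.Perm.inv_eq_iff_eq, hj]
    have := zeta_mul_neg (2 * j)
    rw [mul_neg]
    linear_combination (t - z) * this

theorem exists_mem_G (β : ℂ) (j : ZMod 6) {t : ℂ} (ht : t ∈ tileLattice β) :
    ∃ g ∈ G β, ∀ z, g z = zeta (2 * j) * z + t := by
  have hgen : ∀ e ∈ lattice, rot (β * e) ∈ G β := fun e he => Subgroup.subset_closure ⟨e, he, rfl⟩
  have h0 : (0 : ℂ) ∈ lattice := toC_zero ▸ toC_mem 0
  have hpow : ∀ (n : ℕ) (z : ℂ), (rot (β * 0) ^ n) z = zeta (2 * n) * z := by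
    intro n
    induction n with
    | zero => intro z; simp
    | succ n ih =>
      intro z
      rw [pow_succ, Equiv.Perm.mul_apply, ih, rot_mul_apply]
      push_cast
      rw [mul_add 2, zeta_add]; ring_nf
  obtain ⟨e, he, rfl⟩ := ht
  -- The rotation about βαe after the inverse of the rotation about 0 is the translation by β(1+α)e;
  -- the power of the rotation about 0 supplies the linear part.
  refine ⟨rot (β * (zeta 1 * e)) * (rot (β * 0))⁻¹ * rot (β * 0) ^ j.val, ?_, fun z => ?_⟩
  · exact mul_mem (mul_mem (hgen _ (lattice_zeta_mul 1 he)) (inv_mem (hgen 0 h0)))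
      (pow_mem (hgen 0 h0) _)
  · rw [Equiv.Perm.mul_apply, Equiv.Perm.mul_apply, hpow]
    have : ∀ w, (rot (β * 0))⁻¹ w = zeta 4 * w := fun w => by
      rw [Equiv.Perm.inv_eq_iff_eq, rot_mul_apply, ← mul_assoc, ← zeta_add,
        show (2 : ZMod 6) + 4 = 0 by decide]
      simp
    rw [this, rot_mul_apply, ← mul_assoc, ← mul_assoc (zeta 5), ← zeta_add, ← zeta_add,
      show (2 : ZMod 6) + 4 = 0 by decide, show (5 : ZMod 6) + 1 = 0 by decide,
      ZMod.natCast_val, ZMod.cast_id]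
    simp

theorem image_triangle (i k : ZMod 6) (p t : ℂ) :
    (fun z => zeta k * z + t) '' triangle p (zeta i) =
      triangle (zeta k * p + t) (zeta (i + k)) := by
  rw [triangle, image_convexHull_affine, triangle]
  congr 1
  rw [Set.image_insert_eq, Set.image_insert_eq, Set.image_singleton, zeta_add]
  congr 2
  · ring
  · congr 1; ring

theorem image_segment_affine (a t p q : ℂ) :
    (fun z => a * z + t) '' segment ℝ p q = segment ℝ (a * p + t) (a * q + t) := by
  rw [← convexHull_pair, image_convexHull_affine, Set.image_pair, convexHull_pair]

/-! ### Cells with integer coordinates -/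

def vtx (v : ℤ × ℤ) : Vertex := ⟨toC v, toC_mem v⟩

def edg (v : ℤ × ℤ) (i : ZMod 6) : Edge :=
  ⟨segment ℝ (toC v) (toC v + zeta i), toC v, toC_mem v, zeta i, zeta_pow_six i, rfl⟩

def fac (v : ℤ × ℤ) (i : ZMod 6) : Face :=
  ⟨triangle (toC v) (zeta i), toC v, toC_mem v, zeta i, zeta_pow_six i, rfl⟩

theorem exists_vtx (v : Vertex) : ∃ w, v = vtx w := by
  obtain ⟨w, hw⟩ := mem_lattice_iff.1 v.2
  exact ⟨w, Subtype.ext hw⟩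

theorem exists_edg (e : Edge) : ∃ v i, e = edg v i := by
  obtain ⟨s, p, hp, u, hu, rfl⟩ := e
  obtain ⟨v, rfl⟩ := mem_lattice_iff.1 hp
  obtain ⟨i, rfl⟩ := pow_six_eq_one_iff.1 hu
  exact ⟨v, i, rfl⟩

theorem exists_fac (F : Face) : ∃ v i, F = fac v i := by
  obtain ⟨s, p, hp, u, hu, rfl⟩ := F
  obtain ⟨v, rfl⟩ := mem_lattice_iff.1 hp
  obtain ⟨i, rfl⟩ := pow_six_eq_one_iff.1 hu
  exact ⟨v, i, rfl⟩

theorem fac_inj {v w : ℤ × ℤ} {i j : ZMod 6} : fac v i = fac w j ↔ bary v i = bary w j := by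
  rw [fac, fac, Subtype.mk.injEq, triangle_inj]

theorem mem_fac {v w : ℤ × ℤ} {i : ZMod 6} :
    (vtx w).1 ∈ (fac v i).1 ↔ w = v ∨ w = v + unit i ∨ w = v + unit (i + 1) :=
  toC_mem_triangle_iff

theorem edg_subset_fac (v : ℤ × ℤ) (i : ZMod 6) : (edg v i).1 ⊆ (fac v i).1 := by
  apply (convex_convexHull ℝ _).segment_subset
  · exact toC_mem_triangle_iff.2 (Or.inl rfl)
  · have := toC_mem_triangle_iff (v := v) (i := i).2 (Or.inr (Or.inl rfl))
    rwa [toC_add, toC_unit] at this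

theorem mem_edg {v w : ℤ × ℤ} {i : ZMod 6} :
    (vtx w).1 ∈ (edg v i).1 ↔ w = v ∨ w = v + unit i := by
  constructor
  · intro H
    rcases mem_fac.1 (edg_subset_fac v i H) with rfl | rfl | rfl
    · exact Or.inl rfl
    · exact Or.inr rfl
    · exfalso
      obtain ⟨a, b, ha, hb, hab, hz⟩ := H
      have h1 := congrArg (h (2 - i)) hz
      simp only [vtx, map_add, map_smul, smul_eq_mul, toC_add] at h1
      have e1 : h (2 - i) (zeta i) = -1 := by
        rw [← mul_one (zeta i), h_zeta_mul, sub_add_cancel]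
        have := h_toC 2 (1, 0)
        simpa [toC] using this
      have e2 : h (2 - i) (toC (unit (i + 1))) = -1 := by
        rw [toC_unit, ← mul_one (zeta (i + 1)), h_zeta_mul, show 2 - i + (i + 1) = 3 by ring]
        have := h_toC 3 (1, 0)
        simpa [toC] using this
      have h2 := congrArg (h (3 - i)) hz
      simp only [vtx, map_add, map_smul, smul_eq_mul, toC_add] at h2
      have e3 : h (3 - i) (zeta i) = -1 := by
        rw [← mul_one (zeta i), h_zeta_mul, sub_add_cancel]
        have := h_toC 3 (1, 0)
        simpa [toC] using this
      have e4 : h (3 - i) (toC (unit (i + 1))) = 0 := by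
        rw [toC_unit, ← mul_one (zeta (i + 1)), h_zeta_mul, show 3 - i + (i + 1) = 4 by ring]
        have := h_toC 4 (1, 0)
        simpa [toC] using this
      rw [e1, e2] at h1
      rw [e3, e4] at h2
      have h3 : a * h (2 - i) (toC v) + b * h (2 - i) (toC v) = h (2 - i) (toC v) := by
        rw [← add_mul, hab, one_mul]
      have h4 : a * h (3 - i) (toC v) + b * h (3 - i) (toC v) = h (3 - i) (toC v) := by
        rw [← add_mul, hab, one_mul]
      linarith
  · rintro (rfl | rfl)
    · exact left_mem_segment ℝ _ _
    · simp only [vtx, edg, toC_add, toC_unit]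
      exact right_mem_segment ℝ _ _

theorem edg_reverse (v : ℤ × ℤ) (i : ZMod 6) : edg (v + unit i) (i + 3) = edg v i := by
  apply Subtype.ext
  simp only [edg, toC_add, toC_unit]
  rw [segment_symm, zeta_add, zeta_three]
  simp

theorem unit_injective : Function.Injective unit := by decide

theorem unit_ne_zero (i : ZMod 6) : unit i ≠ 0 := by revert i; decide

theorem edg_inj {v w : ℤ × ℤ} {i j : ZMod 6} :
    edg v i = edg w j ↔ (v = w ∧ i = j) ∨ (w = v + unit i ∧ j = i + 3) := by
  constructor
  · intro H
    have h1 : v = w ∨ v = w + unit j := mem_edg.1 (by rw [← H]; exact mem_edg.2 (Or.inl rfl))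
    have h2 : v + unit i = w ∨ v + unit i = w + unit j :=
      mem_edg.1 (by rw [← H]; exact mem_edg.2 (Or.inr rfl))
    rcases h1 with rfl | rfl
    · left
      rcases h2 with h2 | h2
      · exact absurd (by simpa using h2) (unit_ne_zero i)
      · exact ⟨rfl, unit_injective (add_left_cancel h2)⟩
    · right
      rcases h2 with h2 | h2
      · refine ⟨h2.symm, ?_⟩
        have : unit i = -unit j := by
          rw [add_assoc] at h2
          have := add_eq_left.1 h2
          exact eq_neg_of_add_eq_zero_right this
        rw [← unit_add_three] at this
        rw [unit_injective this, add_assoc, show (3 : ZMod 6) + 3 = 0 by decide, add_zero]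
      · exact absurd (by simpa using h2) (unit_ne_zero i)
  · rintro (⟨rfl, rfl⟩ | ⟨rfl, rfl⟩)
    · rfl
    · exact (edg_reverse v i).symm

theorem bary_rotate (v : ℤ × ℤ) (i : ZMod 6) : bary (v + unit i) (i + 2) = bary v i := by
  have : ∀ i, delta (i + 2) + (3 : ℤ) • unit i = delta i := by decide
  rw [bary, smul_add, add_assoc, add_comm _ (delta _), this, bary]

theorem fac_rotate (v : ℤ × ℤ) (i : ZMod 6) : fac (v + unit i) (i + 2) = fac v i :=
  fac_inj.2 (bary_rotate v i)

theorem unit_add_unit_two (i : ZMod 6) : unit i + unit (i + 2) = unit (i + 1) := by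
  revert i; decide

theorem fac_rotate' (v : ℤ × ℤ) (i : ZMod 6) : fac (v + unit (i + 1)) (i + 4) = fac v i := by
  rw [← fac_rotate v i, ← fac_rotate (v + unit i) (i + 2), add_assoc v, unit_add_unit_two,
    add_assoc i]
  rfl

/-- A face as seen from any of its vertices. -/
theorem exists_fac_eq_of_mem {v w : ℤ × ℤ} {i : ZMod 6} (hw : (vtx w).1 ∈ (fac v i).1) :
    ∃ j, fac v i = fac w j := by
  rcases mem_fac.1 hw with rfl | rfl | rfl
  · exact ⟨i, rfl⟩
  · exact ⟨_, (fac_rotate v i).symm⟩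
  · exact ⟨_, (fac_rotate' v i).symm⟩

theorem exists_edg_eq_of_mem {v w : ℤ × ℤ} {i : ZMod 6} (hw : (vtx w).1 ∈ (edg v i).1) :
    ∃ j, edg v i = edg w j := by
  rcases mem_edg.1 hw with rfl | rfl
  · exact ⟨i, rfl⟩
  · exact ⟨_, (edg_reverse v i).symm⟩

/-! ### Equality in the quotient -/

theorem toTVertex_eq {β : ℂ} {v w : ℤ × ℤ} : toTVertex β (vtx v) = toTVertex β (vtx w) ↔
    ∃ j : ZMod 6, ∃ t, toC t ∈ tileLattice β ∧ w = ro (2 * j) v + t := by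
  rw [toTVertex, toTVertex, Quotient.eq]
  constructor
  · rintro ⟨g, hg, H⟩
    obtain ⟨j, t, ht, hj⟩ := exists_of_mem_G hg
    simp only [Set.image_singleton, Set.singleton_eq_singleton_iff, vtx, hj] at H
    refine ⟨j, w - ro (2 * j) v, ?_, by abel⟩
    rw [toC_sub, toC_ro, ← H]
    simpa using ht
  · rintro ⟨j, t, ht, rfl⟩
    obtain ⟨g, hg, H⟩ := exists_mem_G β j ht
    refine ⟨g, hg, ?_⟩
    simp only [Set.image_singleton, vtx, H, toC_add, toC_ro]

theorem image_fac_eq (v t : ℤ × ℤ) (i k : ZMod 6) :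
    (fun z => zeta k * z + toC t) '' (fac v i).1 = (fac (ro k v + t) (i + k)).1 := by
  simp only [fac, image_triangle, toC_add, toC_ro]

theorem image_edg_eq (v t : ℤ × ℤ) (i k : ZMod 6) :
    (fun z => zeta k * z + toC t) '' (edg v i).1 = (edg (ro k v + t) (i + k)).1 := by
  simp only [edg, image_segment_affine, toC_add, toC_ro, zeta_add]
  congr 1; ring

theorem tileLattice_subset {β : ℂ} (hβ : β ∈ lattice) : tileLattice β ⊆ lattice := by
  rintro _ ⟨e, he, rfl⟩
  refine lattice_mul (lattice_mul hβ (lattice_add ?_ (zeta_one ▸ zeta_mem 1))) he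
  exact_mod_cast int_mem_lattice 1

theorem toTFace_eq {β : ℂ} (hβ : β ∈ lattice) {F F' : Face} : toTFace β F = toTFace β F' ↔
    ∃ j : ZMod 6, ∃ t, toC t ∈ tileLattice β ∧
      (fun z => zeta (2 * j) * z + toC t) '' F.1 = F'.1 := by
  rw [toTFace, toTFace, Quotient.eq]
  constructor
  · rintro ⟨g, hg, H⟩
    obtain ⟨j, t, ht, hj⟩ := exists_of_mem_G hg
    obtain ⟨t, rfl⟩ := mem_lattice_iff.1 (tileLattice_subset hβ ht)
    exact ⟨j, t, ht, by rw [← H]; exact Set.image_congr fun z _ => (hj z).symm⟩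
  · rintro ⟨j, t, ht, H⟩
    obtain ⟨g, hg, hj⟩ := exists_mem_G β j ht
    exact ⟨g, hg, by rw [← H]; exact Set.image_congr fun z _ => hj z⟩

theorem toTEdge_eq {β : ℂ} (hβ : β ∈ lattice) {F F' : Edge} : toTEdge β F = toTEdge β F' ↔
    ∃ j : ZMod 6, ∃ t, toC t ∈ tileLattice β ∧
      (fun z => zeta (2 * j) * z + toC t) '' F.1 = F'.1 := by
  rw [toTEdge, toTEdge, Quotient.eq]
  constructor
  · rintro ⟨g, hg, H⟩
    obtain ⟨j, t, ht, hj⟩ := exists_of_mem_G hg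
    obtain ⟨t, rfl⟩ := mem_lattice_iff.1 (tileLattice_subset hβ ht)
    exact ⟨j, t, ht, by rw [← H]; exact Set.image_congr fun z _ => (hj z).symm⟩
  · rintro ⟨j, t, ht, H⟩
    obtain ⟨g, hg, hj⟩ := exists_mem_G β j ht
    exact ⟨g, hg, by rw [← H]; exact Set.image_congr fun z _ => hj z⟩

theorem toTFace_fac_act {β : ℂ} (hβ : β ∈ lattice) (v : ℤ × ℤ) (i j : ZMod 6) {t : ℤ × ℤ}
    (ht : toC t ∈ tileLattice β) :
    toTFace β (fac (ro (2 * j) v + t) (i + 2 * j)) = toTFace β (fac v i) :=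
  ((toTFace_eq hβ).2 ⟨j, t, ht, image_fac_eq v t i _⟩).symm

theorem toTEdge_edg_act {β : ℂ} (hβ : β ∈ lattice) (v : ℤ × ℤ) (i j : ZMod 6) {t : ℤ × ℤ}
    (ht : toC t ∈ tileLattice β) :
    toTEdge β (edg (ro (2 * j) v + t) (i + 2 * j)) = toTEdge β (edg v i) :=
  ((toTEdge_eq hβ).2 ⟨j, t, ht, image_edg_eq v t i _⟩).symm

theorem toTVertex_act {β : ℂ} (v : ℤ × ℤ) (j : ZMod 6) {t : ℤ × ℤ}
    (ht : toC t ∈ tileLattice β) :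
    toTVertex β (vtx (ro (2 * j) v + t)) = toTVertex β (vtx v) :=
  (toTVertex_eq.2 ⟨j, t, ht, rfl⟩).symm

theorem toTFace_fac_eq {β : ℂ} (hβ : β ∈ lattice) {v w : ℤ × ℤ} {i k : ZMod 6} :
    toTFace β (fac v i) = toTFace β (fac w k) ↔
    ∃ j : ZMod 6, ∃ t, toC t ∈ tileLattice β ∧ fac (ro (2 * j) v + t) (i + 2 * j) = fac w k := by
  rw [toTFace_eq hβ]
  simp only [image_fac_eq, ← Subtype.ext_iff]

theorem toTEdge_edg_eq {β : ℂ} (hβ : β ∈ lattice) {v w : ℤ × ℤ} {i k : ZMod 6} :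
    toTEdge β (edg v i) = toTEdge β (edg w k) ↔
    ∃ j : ZMod 6, ∃ t, toC t ∈ tileLattice β ∧ edg (ro (2 * j) v + t) (i + 2 * j) = edg w k := by
  rw [toTEdge_eq hβ]
  simp only [image_edg_eq, ← Subtype.ext_iff]

theorem exists_toTVertex {β : ℂ} (v : TVertex β) : ∃ w, v = toTVertex β (vtx w) := by
  obtain ⟨v, rfl⟩ := Quotient.exists_rep v
  obtain ⟨w, rfl⟩ := exists_vtx v
  exact ⟨w, rfl⟩

theorem exists_toTEdge {β : ℂ} (v : TEdge β) : ∃ w i, v = toTEdge β (edg w i) := by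
  obtain ⟨v, rfl⟩ := Quotient.exists_rep v
  obtain ⟨w, i, rfl⟩ := exists_edg v
  exact ⟨w, i, rfl⟩

theorem exists_toTFace {β : ℂ} (v : TFace β) : ∃ w i, v = toTFace β (fac w i) := by
  obtain ⟨v, rfl⟩ := Quotient.exists_rep v
  obtain ⟨w, i, rfl⟩ := exists_fac v
  exact ⟨w, i, rfl⟩

/-! ### Incidences in the quotient -/

theorem delta_injective : Function.Injective delta := by decide

theorem fac_eq_cases {v w : ℤ × ℤ} {i k : ZMod 6} (H : fac v i = fac w k) :
    (v = w ∧ i = k) ∨ (v = w + unit k ∧ i = k + 2) ∨ (v = w + unit (k + 1) ∧ i = k + 4) := by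
  have hv : (vtx v).1 ∈ (fac w k).1 := by rw [← H]; exact mem_fac.2 (Or.inl rfl)
  have key : ∀ {i j}, fac v i = fac v j → i = j := fun h =>
    delta_injective (add_left_cancel (fac_inj.1 h))
  rcases mem_fac.1 hv with h | h | h <;> subst h
  · exact Or.inl ⟨rfl, key H⟩
  · exact Or.inr (Or.inl ⟨rfl, key (H.trans (fac_rotate w k).symm)⟩)
  · exact Or.inr (Or.inr ⟨rfl, key (H.trans (fac_rotate' w k).symm)⟩)

section
variable {β : ℂ}

/-- A group element that carries an equivalent vertex to v carries its faces to faces at v, so all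
incidences at a class can be read off at one representative. -/
theorem incVF_iff (hβ : β ∈ lattice) {v : ℤ × ℤ} {f : TFace β} :
    incVF β (toTVertex β (vtx v)) f ↔ ∃ k, f = toTFace β (fac v k) := by
  constructor
  · rintro ⟨v', F, hv, rfl, hvF⟩
    obtain ⟨v', rfl⟩ := exists_vtx v'
    obtain ⟨w, i, rfl⟩ := exists_fac F
    obtain ⟨k, hk⟩ := exists_fac_eq_of_mem hvF
    obtain ⟨j, t, ht, rfl⟩ := toTVertex_eq.1 hv
    exact ⟨k + 2 * j, by rw [hk, toTFace_fac_act hβ v' k j ht]⟩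
  · rintro ⟨k, rfl⟩
    exact ⟨_, _, rfl, rfl, mem_fac.2 (Or.inl rfl)⟩

theorem incVE_iff (hβ : β ∈ lattice) {v : ℤ × ℤ} {e : TEdge β} :
    incVE β (toTVertex β (vtx v)) e ↔ ∃ k, e = toTEdge β (edg v k) := by
  constructor
  · rintro ⟨v', F, hv, rfl, hvF⟩
    obtain ⟨v', rfl⟩ := exists_vtx v'
    obtain ⟨w, i, rfl⟩ := exists_edg F
    obtain ⟨k, hk⟩ := exists_edg_eq_of_mem hvF
    obtain ⟨j, t, ht, rfl⟩ := toTVertex_eq.1 hv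
    exact ⟨k + 2 * j, by rw [hk, toTEdge_edg_act hβ v' k j ht]⟩
  · rintro ⟨k, rfl⟩
    exact ⟨_, _, rfl, rfl, mem_edg.2 (Or.inl rfl)⟩

theorem incVF_fac_iff (hβ : β ∈ lattice) {w : ℤ × ℤ} {i : ZMod 6} {v : TVertex β} :
    incVF β v (toTFace β (fac w i)) ↔ v = toTVertex β (vtx w) ∨
      v = toTVertex β (vtx (w + unit i)) ∨ v = toTVertex β (vtx (w + unit (i + 1))) := by
  constructor
  · intro H
    obtain ⟨v, rfl⟩ := exists_toTVertex v
    obtain ⟨k, hk⟩ := (incVF_iff hβ).1 H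
    obtain ⟨j, t, ht, H⟩ := (toTFace_fac_eq hβ).1 hk.symm
    rw [← toTVertex_act v j ht]
    rcases fac_eq_cases H with ⟨h, -⟩ | ⟨h, -⟩ | ⟨h, -⟩ <;> rw [h] <;> simp
  · rintro (rfl | rfl | rfl)
    · exact (incVF_iff hβ).2 ⟨_, rfl⟩
    · exact (incVF_iff hβ).2 ⟨_, by rw [fac_rotate]⟩
    · exact (incVF_iff hβ).2 ⟨_, by rw [fac_rotate']⟩

theorem incVE_edg_iff (hβ : β ∈ lattice) {w : ℤ × ℤ} {i : ZMod 6} {v : TVertex β} :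
    incVE β v (toTEdge β (edg w i)) ↔ v = toTVertex β (vtx w) ∨
      v = toTVertex β (vtx (w + unit i)) := by
  constructor
  · intro H
    obtain ⟨v, rfl⟩ := exists_toTVertex v
    obtain ⟨k, hk⟩ := (incVE_iff hβ).1 H
    obtain ⟨j, t, ht, H⟩ := (toTEdge_edg_eq hβ).1 hk.symm
    rw [← toTVertex_act v j ht]
    rcases edg_inj.1 H.symm with ⟨h, -⟩ | ⟨h, -⟩ <;> rw [h] <;> simp
  · rintro (rfl | rfl)
    · exact (incVE_iff hβ).2 ⟨_, rfl⟩
    · exact (incVE_iff hβ).2 ⟨_, by rw [edg_reverse]⟩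

theorem exists_of_edg_subset {w : ℤ × ℤ} {i : ZMod 6} {F : Face} (H : (edg w i).1 ⊆ F.1) :
    F = fac w i ∨ F = fac w (i - 1) := by
  obtain ⟨v, k, rfl⟩ := exists_fac F
  obtain ⟨j, hj⟩ := exists_fac_eq_of_mem (H (mem_edg.2 (Or.inl rfl)))
  rw [hj] at H ⊢
  have h2 := mem_fac.1 (H (mem_edg.2 (Or.inr rfl)))
  rcases h2 with h2 | h2 | h2
  · exact absurd (by simpa using h2) (unit_ne_zero i)
  · left; rw [unit_injective (add_left_cancel h2)]
  · right; rw [unit_injective (add_left_cancel h2), add_sub_cancel_right]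

theorem edg_subset_fac' (v : ℤ × ℤ) (i : ZMod 6) : (edg v i).1 ⊆ (fac v (i - 1)).1 := by
  have h := edg_subset_fac (v + unit i) (i + 3)
  rw [edg_reverse] at h
  have h2 := fac_rotate' v (i - 1)
  rw [sub_add_cancel, show i - 1 + 4 = i + 3 by ring] at h2
  rwa [h2] at h

theorem incEF_edg_iff (hβ : β ∈ lattice) {w : ℤ × ℤ} {i : ZMod 6} {f : TFace β} :
    incEF β (toTEdge β (edg w i)) f ↔ f = toTFace β (fac w i) ∨
      f = toTFace β (fac w (i - 1)) := by
  constructor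
  · rintro ⟨E, F, hE, rfl, hEF⟩
    obtain ⟨v, k, rfl⟩ := exists_edg E
    obtain ⟨j, t, ht, H⟩ := (toTEdge_edg_eq hβ).1 hE
    have h1 := toTFace_fac_act hβ v k j ht
    have h2 := toTFace_fac_act hβ v (k - 1) j ht
    have hF := exists_of_edg_subset hEF
    rcases edg_inj.1 H.symm with ⟨hv, hk⟩ | ⟨hv, hk⟩
    · rw [← hv] at h1 h2
      rcases hF with rfl | rfl
      · left; rw [← h1, hk]
      · right; rw [← h2, hk]; congr 2; ring
    · rw [hv] at h1 h2
      rcases hF with rfl | rfl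
      · right
        rw [← h1, hk, show i + 3 = i - 1 + 4 by ring]
        have := fac_rotate' w (i - 1)
        rw [sub_add_cancel] at this
        rw [this]
      · left
        rw [← h2, show k - 1 + 2 * j = i + 2 by linear_combination hk, fac_rotate]
  · rintro (rfl | rfl)
    · exact ⟨_, _, rfl, rfl, edg_subset_fac w i⟩
    · exact ⟨_, _, rfl, rfl, edg_subset_fac' w i⟩

theorem incEF_fac_iff (hβ : β ∈ lattice) {w : ℤ × ℤ} {i : ZMod 6} {e : TEdge β} :
    incEF β e (toTFace β (fac w i)) ↔ e = toTEdge β (edg w i) ∨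
      e = toTEdge β (edg (w + unit i) (i + 2)) ∨ e = toTEdge β (edg w (i + 1)) := by
  constructor
  · intro H
    obtain ⟨v, k, rfl⟩ := exists_toTEdge e
    have rev : ∀ v i, edg v (i + 1) = edg (v + unit (i + 1)) (i + 4) := fun v i => by
      rw [← edg_reverse v (i + 1), show i + 1 + 3 = i + 4 by ring]
    rcases (incEF_edg_iff hβ).1 H with h | h
    · obtain ⟨j, t, ht, H⟩ := (toTFace_fac_eq hβ).1 h.symm
      rw [← toTEdge_edg_act hβ v k j ht, rev w]
      rcases fac_eq_cases H with ⟨h, h'⟩ | ⟨h, h'⟩ | ⟨h, h'⟩ <;> rw [h, h'] <;> simp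
    · obtain ⟨j, t, ht, H⟩ := (toTFace_fac_eq hβ).1 h.symm
      rw [← toTEdge_edg_act hβ v k j ht]
      rcases fac_eq_cases H with ⟨h, h'⟩ | ⟨h, h'⟩ | ⟨h, h'⟩
      · right; right; rw [h]; congr 2; linear_combination h'
      · left
        rw [h, show k + 2 * j = i + 3 by linear_combination h', edg_reverse]
      · right; left
        rw [h, show k + 2 * j = (i + 2) + 3 by linear_combination h', ← unit_add_unit_two,
          ← add_assoc, edg_reverse]
  · rintro (rfl | rfl | rfl)
    · exact (incEF_edg_iff hβ).2 (Or.inl rfl)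
    · exact (incEF_edg_iff hβ).2 (Or.inl (by rw [fac_rotate]))
    · exact (incEF_edg_iff hβ).2 (Or.inr (by rw [add_sub_cancel_right]))

/-! ### The invariant three-coloring of the vertices -/

/-- The class of a lattice point modulo `1 + α`. -/
def col (v : ℤ × ℤ) : ZMod 3 := v.1 - v.2

theorem col_add (v w : ℤ × ℤ) : col (v + w) = col v + col w := by
  simp [col]; ring

/-- Modulo 1 + α one has α ≡ -1, so even powers of α act trivially on the residue classes. -/
theorem col_ro (j : ZMod 6) (v : ℤ × ℤ) : col (ro (2 * j) v) = col v := by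
  have h3 : (3 : ZMod 3) = 0 := by decide
  have : (2 * j) = 0 ∨ 2 * j = 2 ∨ 2 * j = 4 := by revert j; decide
  rcases this with h | h | h <;> rw [h]
  · rfl
  · simp only [ro, hz_two, show (2 : ZMod 6) + 4 = 0 by decide, hz_zero, col]
    push_cast
    linear_combination (-v.1 : ZMod 3) * h3
  · simp only [ro, hz_four, show (4 : ZMod 6) + 4 = 2 by decide, hz_two, col]
    push_cast
    linear_combination (v.2 : ZMod 3) * h3

theorem one_add_α : 1 + α = toC (1, 1) := by simp [toC]

theorem one_add_α_mul (v : ℤ × ℤ) : (1 + α) * toC v = toC (v.1 - v.2, v.1 + 2 * v.2) := by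
  simp only [toC]; push_cast; linear_combination (v.2 : ℂ) * α_sq

theorem one_add_α_ne_zero : 1 + α ≠ 0 := by
  rw [one_add_α, ← toC_zero, ne_eq, toC_inj]; decide

theorem col_eq_zero_iff {v : ℤ × ℤ} : col v = 0 ↔ ∃ w, toC v = (1 + α) * toC w := by
  constructor
  · intro H
    have : (3 : ℤ) ∣ v.1 - v.2 := by
      have := (ZMod.intCast_zmod_eq_zero_iff_dvd (v.1 - v.2) 3).1 (by simpa [col] using H)
      exact_mod_cast this
    obtain ⟨k, hk⟩ := this
    refine ⟨(v.1 - k, -k), ?_⟩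
    rw [one_add_α_mul, toC_inj]
    apply Prod.ext <;> simp; omega
  · rintro ⟨w, hw⟩
    rw [one_add_α_mul, toC_inj] at hw
    have h3 : (3 : ZMod 3) = 0 := by decide
    rw [hw, col]
    push_cast
    linear_combination (-w.2 : ZMod 3) * h3

theorem col_of_tile (hβ : β ∈ lattice) {t : ℤ × ℤ} (ht : toC t ∈ tileLattice β) : col t = 0 := by
  obtain ⟨e, he, H⟩ := ht
  obtain ⟨w, hw⟩ := mem_lattice_iff.1 (lattice_mul hβ he)
  exact col_eq_zero_iff.2 ⟨w, by rw [H, ← hw]; ring⟩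

theorem col_act (hβ : β ∈ lattice) (v : ℤ × ℤ) (j : ZMod 6) {t : ℤ × ℤ}
    (ht : toC t ∈ tileLattice β) : col (ro (2 * j) v + t) = col v := by
  rw [col_add, col_ro, col_of_tile hβ ht, add_zero]

/-- The colors of the vertices of the quotient. -/
def colV (v : TVertex β) : ZMod 3 := col (exists_toTVertex v).choose

theorem colV_mk (hβ : β ∈ lattice) (v : ℤ × ℤ) : colV (toTVertex β (vtx v)) = col v := by
  have h := (exists_toTVertex (toTVertex β (vtx v))).choose_spec
  rw [colV]
  obtain ⟨j, t, ht, hw⟩ := toTVertex_eq.1 h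
  rw [hw, col_act hβ _ _ ht]

/-- The sums of the colors of the two ends of an edge. -/
def colE (e : TEdge β) : ZMod 3 :=
  2 * col (exists_toTEdge e).choose + col (unit (exists_toTEdge e).choose_spec.choose)

theorem colE_mk (hβ : β ∈ lattice) (v : ℤ × ℤ) (i : ZMod 6) :
    colE (toTEdge β (edg v i)) = 2 * col v + col (unit i) := by
  have h := (exists_toTEdge (toTEdge β (edg v i))).choose_spec.choose_spec
  rw [colE]
  generalize (exists_toTEdge (toTEdge β (edg v i))).choose_spec.choose = k at h ⊢
  generalize (exists_toTEdge (toTEdge β (edg v i))).choose = w at h ⊢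
  obtain ⟨j, t, ht, H⟩ := (toTEdge_edg_eq hβ).1 h
  have hc := col_act hβ v j ht
  have hu : ∀ i j, col (unit (i + 2 * j)) = col (unit i) := by decide
  have hu' : ∀ i, col (unit (i + 3)) = -col (unit i) := by decide
  rcases edg_inj.1 H with ⟨h1, h2⟩ | ⟨h1, h2⟩
  · rw [← h1, ← h2, hc, hu]
  · rw [h1, h2, col_add, hc, hu', hu]
    ring

theorem col_unit_ne_zero (i : ZMod 6) : col (unit i) ≠ 0 := by revert i; decide

theorem vertex_ne (hβ : β ∈ lattice) (v : ℤ × ℤ) (i : ZMod 6) :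
    toTVertex β (vtx v) ≠ toTVertex β (vtx (v + unit i)) := by
  intro H
  have := congrArg colV H
  rw [colV_mk hβ, colV_mk hβ, col_add] at this
  exact col_unit_ne_zero i (by simpa using this)

/-! ### Fixed points and degrees -/

/-- The vertices at the rotation centers. -/
def IsCone (β : ℂ) (v : ℤ × ℤ) : Prop := ∃ e ∈ lattice, toC v = β * e

/-- The numbers 1 - α² and 1 - α⁴ are unit multiples of 1 + α. Hence the fixed point of z ↦ α^(2j) z
+ t is t / (1 + α) up to a unit, which lies in βE. -/
theorem isCone_of_act_eq {v t : ℤ × ℤ} {j : ZMod 6} (ht : toC t ∈ tileLattice β)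
    (hj : 2 * j ≠ 0) (H : v = ro (2 * j) v + t) : IsCone β v := by
  have h1 := congrArg toC H
  rw [toC_add, toC_ro] at h1
  obtain ⟨e, he, h2⟩ := ht
  rw [h2] at h1
  have key : ∀ j : ZMod 6, 2 * j ≠ 0 → 2 * j = 2 ∨ 2 * j = 4 := by decide
  rcases key j hj with h | h <;> rw [h] at h1
  · refine ⟨zeta 1 * e, lattice_zeta_mul 1 he, mul_left_cancel₀ one_add_α_ne_zero ?_⟩
    rw [zeta_two] at h1
    rw [zeta_one]
    linear_combination α * h1 + toC v * α_sq
  · refine ⟨e, he, mul_left_cancel₀ one_add_α_ne_zero ?_⟩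
    rw [zeta_four] at h1
    linear_combination h1

theorem IsCone.exists_act_eq {v : ℤ × ℤ} (hv : IsCone β v) (j : ZMod 6) :
    ∃ t, toC t ∈ tileLattice β ∧ ro (2 * j) v + t = v := by
  refine ⟨v - ro (2 * j) v, ?_, by abel⟩
  obtain ⟨e, he, h2⟩ := hv
  have : 2 * j = 0 ∨ 2 * j = 2 ∨ 2 * j = 4 := by revert j; decide
  rw [toC_sub, toC_ro, h2]
  rcases this with h | h | h <;> rw [h]
  · simpa using tileLattice_zero β
  · refine ⟨zeta 5 * e, lattice_zeta_mul 5 he, ?_⟩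
    rw [zeta_two, zeta_five]
    linear_combination β * e * α_sq
  · refine ⟨e, he, ?_⟩
    rw [zeta_four]; ring

/-- No group element reverses an edge: it preserves `col`, and the two ends have different values.
What remains is a rotation that fixes v. -/
theorem edge_eq_at (hβ : β ∈ lattice) {v : ℤ × ℤ} {i k : ZMod 6}
    (H : toTEdge β (edg v i) = toTEdge β (edg v k)) : i = k ∨ (IsCone β v ∧ ∃ j, k = i + 2 * j) := by
  obtain ⟨j, t, ht, H⟩ := (toTEdge_edg_eq hβ).1 H
  have hc := col_act hβ v j ht
  rcases edg_inj.1 H with ⟨h1, h2⟩ | ⟨h1, h2⟩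
  · by_cases hj : 2 * j = 0
    · left; rw [← h2, hj, add_zero]
    · exact Or.inr ⟨isCone_of_act_eq ht hj h1.symm, j, h2.symm⟩
  · exfalso
    rw [h1, col_add] at hc
    rw [h1, col_add, col_add] at hc
    have h3 := congrArg col h1
    rw [col_add, col_act hβ v j ht] at h3
    exact col_unit_ne_zero _ (by simpa using h3)

theorem face_eq_at (hβ : β ∈ lattice) {v : ℤ × ℤ} {i k : ZMod 6}
    (H : toTFace β (fac v i) = toTFace β (fac v k)) : i = k ∨ (IsCone β v ∧ ∃ j, k = i + 2 * j) := by
  obtain ⟨j, t, ht, H⟩ := (toTFace_fac_eq hβ).1 H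
  have hc := col_act hβ v j ht
  rcases fac_eq_cases H with ⟨h1, h2⟩ | ⟨h1, h2⟩ | ⟨h1, h2⟩
  · by_cases hj : 2 * j = 0
    · left; rw [← h2, hj, add_zero]
    · exact Or.inr ⟨isCone_of_act_eq ht hj h1.symm, j, h2.symm⟩
  all_goals
    exfalso
    rw [h1, col_add] at hc
    exact col_unit_ne_zero _ (by simpa using hc)

theorem IsCone.edge_eq (hβ : β ∈ lattice) {v : ℤ × ℤ} (hv : IsCone β v) (i j : ZMod 6) :
    toTEdge β (edg v (i + 2 * j)) = toTEdge β (edg v i) := by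
  obtain ⟨t, ht, H⟩ := hv.exists_act_eq j
  have := toTEdge_edg_act hβ v i j ht
  rwa [H] at this

theorem IsCone.face_eq (hβ : β ∈ lattice) {v : ℤ × ℤ} (hv : IsCone β v) (i j : ZMod 6) :
    toTFace β (fac v (i + 2 * j)) = toTFace β (fac v i) := by
  obtain ⟨t, ht, H⟩ := hv.exists_act_eq j
  have := toTFace_fac_act hβ v i j ht
  rwa [H] at this

theorem degree_of_isCone (hβ : β ∈ lattice) {v : ℤ × ℤ} (hv : IsCone β v) :
    degree β (toTVertex β (vtx v)) = 2 := by
  have : {e | incVE β (toTVertex β (vtx v)) e} =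
      {toTEdge β (edg v 0), toTEdge β (edg v 1)} := by
    ext e
    simp only [Set.mem_ofPred_eq, incVE_iff hβ, Set.mem_insert_iff, Set.mem_singleton_iff]
    constructor
    · rintro ⟨k, rfl⟩
      have : ∃ j, k = 0 + 2 * j ∨ k = 1 + 2 * j := by revert k; decide
      obtain ⟨j, rfl | rfl⟩ := this
      · exact Or.inl (hv.edge_eq hβ _ _)
      · exact Or.inr (hv.edge_eq hβ _ _)
    · rintro (rfl | rfl) <;> exact ⟨_, rfl⟩
  rw [degree, this, Set.ncard_pair]
  intro H
  rcases edge_eq_at hβ H with h | ⟨-, h⟩ <;> revert h <;> decide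

theorem degree_of_not_isCone (hβ : β ∈ lattice) {v : ℤ × ℤ} (hv : ¬IsCone β v) :
    degree β (toTVertex β (vtx v)) = 6 := by
  have : {e | incVE β (toTVertex β (vtx v)) e} = Set.range fun k => toTEdge β (edg v k) := by
    ext e
    simp only [Set.mem_ofPred_eq, incVE_iff hβ, Set.mem_range, eq_comm]
  have hinj : Function.Injective fun k => toTEdge β (edg v k) := fun i k H =>
    (edge_eq_at hβ H).resolve_right fun h => hv h.1
  rw [degree, this, ← Set.image_univ, Set.ncard_image_of_injective _ hinj, Set.ncard_univ,
    Nat.card_eq_fintype_card]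
  rfl

theorem degree_eq_two_iff (hβ : β ∈ lattice) {v : ℤ × ℤ} :
    degree β (toTVertex β (vtx v)) = 2 ↔ IsCone β v := by
  refine ⟨fun H => ?_, degree_of_isCone hβ⟩
  by_contra hv
  rw [degree_of_not_isCone hβ hv] at H
  omega

theorem ncard_degree_two (hβ : β ∈ lattice) (h0 : β ≠ 0) : {v | degree β v = 2}.ncard = 3 := by
  obtain ⟨b, rfl⟩ := mem_lattice_iff.1 hβ
  have hcone : IsCone (toC b) 0 := ⟨0, toC_zero ▸ toC_mem 0, by simp⟩
  have hcone1 : IsCone (toC b) b := ⟨1, by simpa using int_mem_lattice 1, by simp⟩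
  have hcone2 : IsCone (toC b) (-b) := ⟨-1, by simpa using int_mem_lattice (-1), by simp⟩
  have h1 : (1 : ℂ) ∈ lattice := by simpa using int_mem_lattice 1
  -- The cone points βe and βf are equivalent exactly when e ≡ f modulo 1 + α, which leaves three
  -- classes.
  have key : ∀ {v w e f : ℤ × ℤ}, toC v = toC b * toC e → toC w = toC b * toC f →
      (toTVertex (toC b) (vtx v) = toTVertex (toC b) (vtx w) ↔ col e = col f) := by
    intro v w e f hv hw
    constructor
    · intro H
      obtain ⟨j, t, ⟨g, hg, ht⟩, H⟩ := toTVertex_eq.1 H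
      obtain ⟨g, rfl⟩ := mem_lattice_iff.1 hg
      have : f = ro (2 * j) e + (g.1 - g.2, g.1 + 2 * g.2) := by
        apply toC_injective
        rw [toC_add, ← one_add_α_mul, toC_ro]
        apply mul_left_cancel₀ h0
        rw [← hw, H, toC_add, toC_ro, hv, ht]; ring
      rw [this, col_act h1]
      exact ⟨toC g, toC_mem g, by rw [one_mul, one_add_α_mul]⟩
    · intro H
      have : col (f - e) = 0 := by
        have := col_add (f - e) e
        rw [sub_add_cancel, H] at this
        simpa using this
      obtain ⟨g, hg⟩ := col_eq_zero_iff.1 this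
      rw [toC_sub] at hg
      refine toTVertex_eq.2 ⟨0, w - v, ⟨toC g, toC_mem g, ?_⟩, by simp⟩
      rw [toC_sub, hw, hv, mul_assoc, ← hg]; ring
  have e0 : toC 0 = toC b * toC 0 := by simp
  have e1 : toC b = toC b * toC (1, 0) := by simp [toC]
  have e2 : toC (-b) = toC b * toC (-1, 0) := by simp [toC]; ring
  have : {v | degree (toC b) v = 2} = {toTVertex (toC b) (vtx 0), toTVertex (toC b) (vtx b),
      toTVertex (toC b) (vtx (-b))} := by
    ext v
    obtain ⟨v, rfl⟩ := exists_toTVertex v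
    simp only [Set.mem_ofPred_eq, degree_eq_two_iff hβ, Set.mem_insert_iff, Set.mem_singleton_iff]
    constructor
    · rintro ⟨e, he, hv⟩
      obtain ⟨e, rfl⟩ := mem_lattice_iff.1 he
      rw [key hv e0, key hv e1, key hv e2]
      have h3 : ∀ c : ZMod 3, c = col 0 ∨ c = col (1, 0) ∨ c = col (-1, 0) := by decide
      exact h3 _
    · rintro (h | h | h)
      · rw [← degree_eq_two_iff hβ, h, degree_eq_two_iff hβ]; exact hcone
      · rw [← degree_eq_two_iff hβ, h, degree_eq_two_iff hβ]; exact hcone1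
      · rw [← degree_eq_two_iff hβ, h, degree_eq_two_iff hβ]; exact hcone2
  rw [this, Set.ncard_eq_three]
  refine ⟨_, _, _, ?_, ?_, ?_, rfl⟩
  · rw [ne_eq, key e0 e1]; decide
  · rw [ne_eq, key e0 e2]; decide
  · rw [ne_eq, key e1 e2]; decide

end

/-! ### The quotient is a triangulated sphere -/

theorem sum_ncard_comm {A B : Type} [Fintype A] [Fintype B] (r : A → B → Prop) :
    ∑ a, {b | r a b}.ncard = ∑ b, {a | r a b}.ncard := by
  classical
  have h1 : ∀ a, {b | r a b}.ncard = (Finset.bipartiteAbove r Finset.univ a).card := fun a => by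
    rw [Set.ncard_eq_toFinset_card']
    congr 1
    ext b
    simp [Finset.bipartiteAbove]
  have h2 : ∀ b, {a | r a b}.ncard = (Finset.bipartiteBelow r Finset.univ b).card := fun b => by
    rw [Set.ncard_eq_toFinset_card']
    congr 1
    ext a
    simp [Finset.bipartiteBelow]
  simp only [h1, h2]
  exact Finset.sum_card_bipartiteAbove_eq_sum_card_bipartiteBelow r

/-- Three times the norm of `a + b α`. -/
theorem exists_period {β : ℂ} (hβ : β ∈ lattice) (h0 : β ≠ 0) :
    ∃ M : ℕ, 0 < M ∧ ∀ v : ℤ × ℤ, toC ((M : ℤ) • v) ∈ tileLattice β := by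
  obtain ⟨b, rfl⟩ := mem_lattice_iff.1 hβ
  have hpos : 0 < b.1 ^ 2 + b.1 * b.2 + b.2 ^ 2 := by
    have : b ≠ 0 := fun h => h0 (by rw [h, toC_zero])
    by_contra hn
    apply this
    have h2 : b.2 = 0 := by nlinarith [sq_nonneg (2 * b.1 + b.2), sq_nonneg b.2]
    have h1 : b.1 = 0 := by rw [h2] at hn; nlinarith [sq_nonneg b.1]
    exact Prod.ext h1 h2
  refine ⟨(3 * (b.1 ^ 2 + b.1 * b.2 + b.2 ^ 2)).toNat, by omega, fun v => ?_⟩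
  rw [Int.toNat_of_nonneg (by omega)]
  -- The first factor is the conjugate of β, and 2 - α is the conjugate of 1 + α; their product with
  -- β(1 + α) is three times the norm of β.
  refine ⟨toC (b.1 + b.2, -b.2) * (toC (2, -1) * toC v),
    lattice_mul (toC_mem _) (lattice_mul (toC_mem _) (toC_mem _)), ?_⟩
  rw [toC_smul]
  simp only [toC]
  push_cast
  have : (1 + α) * (2 - α) = 3 := by linear_combination -α_sq
  have h2 : ((b.1 : ℂ) + b.2 * α) * (b.1 + b.2 + -b.2 * α) = b.1 ^ 2 + b.1 * b.2 + b.2 ^ 2 := by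
    linear_combination -(b.2 : ℂ) ^ 2 * α_sq
  rw [← h2, ← this]; ring

section
variable {β : ℂ}

/-! ### Finiteness of the quotient -/

theorem finite_darts (hβ : β ∈ lattice) (h0 : β ≠ 0) :
    ∃ M : ℕ, ∀ v : ℤ × ℤ, ∃ (w : Fin M × Fin M) (t : ℤ × ℤ), toC t ∈ tileLattice β ∧
      v = ((w.1 : ℤ), (w.2 : ℤ)) + t := by
  obtain ⟨M, hM, H⟩ := exists_period hβ h0
  refine ⟨M, fun v => ⟨⟨⟨(v.1 % M).toNat, ?_⟩, ⟨(v.2 % M).toNat, ?_⟩⟩,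
    (M : ℤ) • (v.1 / M, v.2 / M), H _, ?_⟩⟩
  · have := Int.emod_lt_of_pos v.1 (Int.natCast_pos.2 hM)
    omega
  · have := Int.emod_lt_of_pos v.2 (Int.natCast_pos.2 hM)
    omega
  · have h1 := Int.emod_nonneg v.1 (Int.natCast_pos.2 hM).ne'
    have h2 := Int.emod_nonneg v.2 (Int.natCast_pos.2 hM).ne'
    apply Prod.ext
    · simp only [Prod.fst_add, Prod.smul_fst, smul_eq_mul]
      rw [Int.toNat_of_nonneg h1, Int.emod_add_mul_ediv]
    · simp only [Prod.snd_add, Prod.smul_snd, smul_eq_mul]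
      rw [Int.toNat_of_nonneg h2, Int.emod_add_mul_ediv]

theorem finite_TVertex (hβ : β ∈ lattice) (h0 : β ≠ 0) : Finite (TVertex β) := by
  obtain ⟨M, H⟩ := finite_darts hβ h0
  refine Finite.of_surjective
    (fun w : Fin M × Fin M => toTVertex β (vtx ((w.1 : ℤ), (w.2 : ℤ)))) fun v => ?_
  obtain ⟨v, rfl⟩ := exists_toTVertex v
  obtain ⟨w, t, ht, rfl⟩ := H v
  refine ⟨w, ?_⟩
  have := toTVertex_act ((w.1 : ℤ), (w.2 : ℤ)) 0 ht
  simpa using this.symm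

theorem finite_TEdge (hβ : β ∈ lattice) (h0 : β ≠ 0) : Finite (TEdge β) := by
  obtain ⟨M, H⟩ := finite_darts hβ h0
  refine Finite.of_surjective
    (fun w : (Fin M × Fin M) × ZMod 6 => toTEdge β (edg ((w.1.1 : ℤ), (w.1.2 : ℤ)) w.2))
    fun v => ?_
  obtain ⟨v, i, rfl⟩ := exists_toTEdge v
  obtain ⟨w, t, ht, rfl⟩ := H v
  refine ⟨(w, i), ?_⟩
  have := toTEdge_edg_act hβ ((w.1 : ℤ), (w.2 : ℤ)) i 0 ht
  simpa using this.symm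

theorem finite_TFace (hβ : β ∈ lattice) (h0 : β ≠ 0) : Finite (TFace β) := by
  obtain ⟨M, H⟩ := finite_darts hβ h0
  refine Finite.of_surjective
    (fun w : (Fin M × Fin M) × ZMod 6 => toTFace β (fac ((w.1.1 : ℤ), (w.1.2 : ℤ)) w.2))
    fun v => ?_
  obtain ⟨v, i, rfl⟩ := exists_toTFace v
  obtain ⟨w, t, ht, rfl⟩ := H v
  refine ⟨(w, i), ?_⟩
  have := toTFace_fac_act hβ ((w.1 : ℤ), (w.2 : ℤ)) i 0 ht
  simpa using this.symm

/-! ### Local structure and connectedness of the quotient -/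

theorem ncard_edge_vertices (hβ : β ∈ lattice) (e : TEdge β) : {v | incVE β v e}.ncard = 2 := by
  obtain ⟨v, i, rfl⟩ := exists_toTEdge e
  have : {w | incVE β w (toTEdge β (edg v i))} =
      {toTVertex β (vtx v), toTVertex β (vtx (v + unit i))} := by
    ext w
    simp [incVE_edg_iff hβ]
  rw [this, Set.ncard_pair (vertex_ne hβ v i)]

theorem ncard_face_vertices (hβ : β ∈ lattice) (f : TFace β) : {v | incVF β v f}.ncard = 3 := by
  obtain ⟨v, i, rfl⟩ := exists_toTFace f
  rw [Set.ncard_eq_three]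
  refine ⟨_, _, _, vertex_ne hβ v i, vertex_ne hβ v (i + 1), ?_, ?_⟩
  · rw [← unit_add_unit_two, ← add_assoc]
    exact vertex_ne hβ _ _
  · ext w
    simp [incVF_fac_iff hβ]

theorem edge_ne (hβ : β ∈ lattice) (v : ℤ × ℤ) (i : ZMod 6) :
    toTEdge β (edg v i) ≠ toTEdge β (edg (v + unit i) (i + 2)) ∧
    toTEdge β (edg v i) ≠ toTEdge β (edg v (i + 1)) ∧
    toTEdge β (edg (v + unit i) (i + 2)) ≠ toTEdge β (edg v (i + 1)) := by
  have h1 : ∀ i, 2 * col (unit i) + col (unit (i + 2)) ≠ col (unit i) := by decide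
  have h2 : ∀ i, col (unit i) ≠ col (unit (i + 1)) := by decide
  have h3 : ∀ i, 2 * col (unit i) + col (unit (i + 2)) ≠ col (unit (i + 1)) := by decide
  refine ⟨fun H => ?_, fun H => ?_, fun H => ?_⟩ <;>
    · have := congrArg colE H
      simp only [colE_mk hβ, col_add, mul_add] at this
      first
      | exact h1 i (by linear_combination -this)
      | exact h2 i (by linear_combination this)
      | exact h3 i (by linear_combination this)

theorem ncard_face_edges (hβ : β ∈ lattice) (f : TFace β) : {e | incEF β e f}.ncard = 3 := by
  obtain ⟨v, i, rfl⟩ := exists_toTFace f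
  obtain ⟨h1, h2, h3⟩ := edge_ne hβ v i
  rw [Set.ncard_eq_three]
  refine ⟨_, _, _, h1, h2, h3, ?_⟩
  ext w
  simp [incEF_fac_iff hβ]

theorem face_ne (hβ : β ∈ lattice) (v : ℤ × ℤ) (i : ZMod 6) :
    toTFace β (fac v i) ≠ toTFace β (fac v (i - 1)) := by
  have h1 : ∀ i : ZMod 6, i ≠ i - 1 := by decide
  have h2 : ∀ i : ZMod 6, ¬∃ j, i - 1 = i + 2 * j := by decide
  intro H
  rcases face_eq_at hβ H with h | ⟨-, h⟩
  · exact h1 i h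
  · exact h2 i h

theorem ncard_edge_faces (hβ : β ∈ lattice) (e : TEdge β) : {f | incEF β e f}.ncard = 2 := by
  obtain ⟨v, i, rfl⟩ := exists_toTEdge e
  have : {f | incEF β (toTEdge β (edg v i)) f} =
      {toTFace β (fac v i), toTFace β (fac v (i - 1))} := by
    ext w
    simp [incEF_edg_iff hβ]
  rw [this, Set.ncard_pair (face_ne hβ v i)]

/-- Two vertices may be joined by several edges, but every edge joining them has the sum of their
colors as its `colE`, and the three sides of one face have different values of `colE`. -/
theorem existsUnique_side (hβ : β ∈ lattice) {v w : TVertex β} {f : TFace β} (hv : incVF β v f)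
    (hw : incVF β w f) (hne : v ≠ w) : ∃! e, incEF β e f ∧ incVE β v e ∧ incVE β w e := by
  have hcol : ∀ e, incVE β v e → incVE β w e → colE e = colV v + colV w := by
    intro e h1 h2
    obtain ⟨x, i, rfl⟩ := exists_toTEdge e
    rw [colE_mk hβ]
    rcases (incVE_edg_iff hβ).1 h1 with rfl | rfl <;> rcases (incVE_edg_iff hβ).1 h2 with rfl | rfl
    · exact absurd rfl hne
    · rw [colV_mk hβ, colV_mk hβ, col_add]; ring
    · rw [colV_mk hβ, colV_mk hβ, col_add]; ring
    · exact absurd rfl hne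
  obtain ⟨v, rfl⟩ := exists_toTVertex v
  obtain ⟨k, rfl⟩ := (incVF_iff hβ).1 hv
  have hex : ∃ e, incEF β e (toTFace β (fac v k)) ∧ incVE β (toTVertex β (vtx v)) e ∧
      incVE β w e := by
    rcases (incVF_fac_iff hβ).1 hw with rfl | rfl | rfl
    · exact absurd rfl hne
    · exact ⟨toTEdge β (edg v k), (incEF_fac_iff hβ).2 (Or.inl rfl),
        (incVE_edg_iff hβ).2 (Or.inl rfl), (incVE_edg_iff hβ).2 (Or.inr rfl)⟩
    · exact ⟨toTEdge β (edg v (k + 1)), (incEF_fac_iff hβ).2 (Or.inr (Or.inr rfl)),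
        (incVE_edg_iff hβ).2 (Or.inl rfl), (incVE_edg_iff hβ).2 (Or.inr rfl)⟩
  obtain ⟨e, h1, h2, h3⟩ := hex
  refine ⟨e, ⟨h1, h2, h3⟩, ?_⟩
  rintro e' ⟨h1', h2', h3'⟩
  have hc := (hcol e h2 h3).trans (hcol e' h2' h3').symm
  have hdist : ∀ i, 2 * col (unit i) + col (unit (i + 2)) ≠ col (unit i) ∧
      col (unit i) ≠ col (unit (i + 1)) ∧
      2 * col (unit i) + col (unit (i + 2)) ≠ col (unit (i + 1)) := by decide
  obtain ⟨d1, d2, d3⟩ := hdist k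
  rcases (incEF_fac_iff hβ).1 h1 with rfl | rfl | rfl <;>
  rcases (incEF_fac_iff hβ).1 h1' with rfl | rfl | rfl <;>
  first
  | rfl
  | (exfalso
     simp only [colE_mk hβ, col_add, mul_add] at hc
     first
     | exact d1 (by linear_combination hc)
     | exact d1 (by linear_combination -hc)
     | exact d2 (by linear_combination hc)
     | exact d2 (by linear_combination -hc)
     | exact d3 (by linear_combination hc)
     | exact d3 (by linear_combination -hc))

theorem link_connected (hβ : β ∈ lattice) {v : TVertex β} {f g : TFace β} (hf : incVF β v f)
    (hg : incVF β v g) :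
    Relation.ReflTransGen (fun f g => incVF β v f ∧ incVF β v g ∧
      ∃ e, incVE β v e ∧ incEF β e f ∧ incEF β e g) f g := by
  obtain ⟨v, rfl⟩ := exists_toTVertex v
  obtain ⟨k, rfl⟩ := (incVF_iff hβ).1 hf
  obtain ⟨l, rfl⟩ := (incVF_iff hβ).1 hg
  have key : ∀ n : ℕ, Relation.ReflTransGen (fun f g => incVF β (toTVertex β (vtx v)) f ∧
      incVF β (toTVertex β (vtx v)) g ∧
      ∃ e, incVE β (toTVertex β (vtx v)) e ∧ incEF β e f ∧ incEF β e g)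
      (toTFace β (fac v k)) (toTFace β (fac v (k + n))) := by
    intro n
    induction n with
    | zero => simpa using Relation.ReflTransGen.refl
    | succ n ih =>
      refine ih.tail ⟨(incVF_iff hβ).2 ⟨_, rfl⟩, (incVF_iff hβ).2 ⟨_, rfl⟩,
        toTEdge β (edg v (k + n + 1)), (incVE_iff hβ).2 ⟨_, rfl⟩,
        (incEF_edg_iff hβ).2 (Or.inr ?_), (incEF_edg_iff hβ).2 (Or.inl ?_)⟩
      · rw [add_sub_cancel_right]
      · push_cast; rw [add_assoc]
  have := key (l - k).val
  rwa [ZMod.natCast_val, ZMod.cast_id, add_sub_cancel] at this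

theorem TVertex_connected (hβ : β ∈ lattice) (v w : TVertex β) :
    Relation.ReflTransGen (fun v w => ∃ e, incVE β v e ∧ incVE β w e) v w := by
  obtain ⟨v, rfl⟩ := exists_toTVertex v
  obtain ⟨w, rfl⟩ := exists_toTVertex w
  have step : ∀ (v : ℤ × ℤ) (i : ZMod 6) (n : ℕ),
      Relation.ReflTransGen (fun v w => ∃ e, incVE β v e ∧ incVE β w e)
        (toTVertex β (vtx v)) (toTVertex β (vtx (v + (n : ℤ) • unit i))) := by
    intro v i n
    induction n with
    | zero => simpa using Relation.ReflTransGen.refl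
    | succ n ih =>
      refine ih.tail ⟨toTEdge β (edg (v + (n : ℤ) • unit i) i),
        (incVE_edg_iff hβ).2 (Or.inl rfl), (incVE_edg_iff hβ).2 (Or.inr ?_)⟩
      congr 2
      push_cast
      rw [add_smul, one_smul, add_assoc]
  have stepz : ∀ (v : ℤ × ℤ) (i : ZMod 6) (n : ℤ),
      Relation.ReflTransGen (fun v w => ∃ e, incVE β v e ∧ incVE β w e)
        (toTVertex β (vtx v)) (toTVertex β (vtx (v + n • unit i))) := by
    intro v i n
    rcases Int.eq_nat_or_neg n with ⟨m, rfl | rfl⟩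
    · exact step v i m
    · have := step v (i + 3) m
      rwa [unit_add_three, smul_neg, ← neg_smul] at this
  have h := (stepz v 0 (w.1 - v.1)).trans (stepz _ 1 (w.2 - v.2))
  convert h using 3
  apply Prod.ext <;> simp

/-- Double counting gives 3F = 2E and 2E = 6V - 3·4, whence V - E + F = V - E/3 = 2. -/
theorem euler_eq_two (hβ : β ∈ lattice) (h0 : β ≠ 0) :
    (Nat.card (TVertex β) : ℤ) - Nat.card (TEdge β) + Nat.card (TFace β) = 2 := by
  classical
  have := finite_TVertex hβ h0
  have := finite_TEdge hβ h0
  have := finite_TFace hβ h0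
  have := Fintype.ofFinite (TVertex β)
  have := Fintype.ofFinite (TEdge β)
  have := Fintype.ofFinite (TFace β)
  have h1 := sum_ncard_comm (incEF β)
  simp only [ncard_edge_faces hβ, ncard_face_edges hβ, Finset.sum_const, Finset.card_univ,
    smul_eq_mul] at h1
  have h2 := sum_ncard_comm (incVE β)
  simp only [ncard_edge_vertices hβ, Finset.sum_const, Finset.card_univ, smul_eq_mul] at h2
  have h3 : ∀ v, {e | incVE β v e}.ncard + (if degree β v = 2 then 4 else 0) = 6 := by
    intro v
    obtain ⟨v, rfl⟩ := exists_toTVertex v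
    change degree β _ + _ = 6
    by_cases hv : IsCone β v
    · rw [degree_of_isCone hβ hv, if_pos rfl]
    · rw [degree_of_not_isCone hβ hv, if_neg (by norm_num)]
  have h4 := Finset.sum_congr rfl fun v (_ : v ∈ Finset.univ) => h3 v
  rw [Finset.sum_add_distrib, h2, Finset.sum_ite, Finset.sum_const_zero, Finset.sum_const,
    Finset.sum_const] at h4
  have h5 : (Finset.univ.filter fun v => degree β v = 2).card = 3 := by
    rw [← ncard_degree_two hβ h0, Set.ncard_eq_toFinset_card']
    congr 1
    ext v
    simp
  rw [h5] at h4
  simp only [smul_eq_mul, Finset.card_univ] at h4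
  rw [Nat.card_eq_fintype_card, Nat.card_eq_fintype_card, Nat.card_eq_fintype_card]
  omega

theorem isSphereTriangulation (hβ : β ∈ lattice) (h0 : β ≠ 0) :
    IsSphereTriangulation (incVE β) (incVF β) (incEF β) where
  finite_vertices := finite_TVertex hβ h0
  finite_edges := finite_TEdge hβ h0
  finite_faces := finite_TFace hβ h0
  edge_vertices := ncard_edge_vertices hβ
  face_vertices := ncard_face_vertices hβ
  face_edges := ncard_face_edges hβ
  incidence_trans v e f hv he := by
    obtain ⟨v, rfl⟩ := exists_toTVertex v
    obtain ⟨k, rfl⟩ := (incVE_iff hβ).1 hv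
    rcases (incEF_edg_iff hβ).1 he with rfl | rfl <;> exact (incVF_iff hβ).2 ⟨_, rfl⟩
  face_side _ _ _ := existsUnique_side hβ
  edge_faces := ncard_edge_faces hβ
  link_connected _ _ _ := link_connected hβ
  connected := TVertex_connected hβ
  euler := euler_eq_two hβ h0

end

/-! ### Good colorings in the plane -/

/-- Black counts `1`, white counts `-1`. -/
def sgn (b : Bool) : ZMod 3 := if b then 1 else -1

/-- The condition on a lifted face coloring that makes the coloring good. -/
def PlanarGood (β : ℂ) (c : ℤ × ℤ → ZMod 6 → Bool) : Prop :=
  (∀ v, ∑ i, sgn (c v i) = 0) ∧ ∀ v, IsCone β v → c v 0 ≠ c v 1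

theorem card_modEq_iff (c : ZMod 6 → Bool) :
    {k | c k = true}.ncard ≡ {k | c k = false}.ncard [MOD 3] ↔ ∑ i, sgn (c i) = 0 := by
  rw [← ZMod.natCast_eq_natCast_iff, Set.ncard_eq_toFinset_card', Set.ncard_eq_toFinset_card']
  have : ∑ i, sgn (c i) = ((Finset.univ.filter fun i => c i = true).card : ZMod 3) -
      ((Finset.univ.filter fun i => c i = false).card : ZMod 3) := by
    simp only [sgn]
    rw [Finset.sum_ite]
    simp [sub_eq_add_neg]
  rw [this, sub_eq_zero]
  simp only [Set.toFinset_ofPred]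

/-- At a vertex that is not a cone point the six faces stay distinct in the quotient. At a cone
point they become two, so the coloring is good there only with one face of each color; the sum over
the six planar faces vanishes anyway, since each class is counted three times. -/
theorem isGood_iff {β : ℂ} (hβ : β ∈ lattice) (C : TFace β → Bool) :
    IsGood β C ↔ PlanarGood β fun v i => C (toTFace β (fac v i)) := by
  have hset : ∀ (v : ℤ × ℤ) (b : Bool),
      {f | incVF β (toTVertex β (vtx v)) f ∧ C f = b} =
      (fun k => toTFace β (fac v k)) '' {k | C (toTFace β (fac v k)) = b} := by
    intro v b
    ext f
    simp only [incVF_iff hβ, Set.mem_ofPred_eq, Set.mem_image]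
    constructor
    · rintro ⟨⟨k, rfl⟩, h⟩; exact ⟨k, h, rfl⟩
    · rintro ⟨k, h, rfl⟩; exact ⟨⟨k, rfl⟩, h⟩
  have hnc : ∀ v, ¬IsCone β v →
      ({f | incVF β (toTVertex β (vtx v)) f ∧ C f = true}.ncard ≡
        {f | incVF β (toTVertex β (vtx v)) f ∧ C f = false}.ncard [MOD 3] ↔
        ∑ i, sgn (C (toTFace β (fac v i))) = 0) := by
    intro v hv
    have hinj : Function.Injective fun k => toTFace β (fac v k) := fun i k H =>
      (face_eq_at hβ H).resolve_right fun h => hv h.1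
    rw [hset, hset, Set.ncard_image_of_injective _ hinj, Set.ncard_image_of_injective _ hinj,
      card_modEq_iff fun k => C (toTFace β (fac v k))]
  have hcone : ∀ v, IsCone β v →
      ({f | incVF β (toTVertex β (vtx v)) f ∧ C f = true}.ncard ≡
        {f | incVF β (toTVertex β (vtx v)) f ∧ C f = false}.ncard [MOD 3] ↔
        C (toTFace β (fac v 0)) ≠ C (toTFace β (fac v 1))) := by
    intro v hv
    have hne : toTFace β (fac v 0) ≠ toTFace β (fac v 1) := fun H => face_ne hβ v 1 H.symm
    have hpair : ∀ f, incVF β (toTVertex β (vtx v)) f ↔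
        f = toTFace β (fac v 0) ∨ f = toTFace β (fac v 1) := by
      intro f
      rw [incVF_iff hβ]
      constructor
      · rintro ⟨k, rfl⟩
        have : ∃ j, k = 0 + 2 * j ∨ k = 1 + 2 * j := by revert k; decide
        obtain ⟨j, rfl | rfl⟩ := this
        · exact Or.inl (hv.face_eq hβ _ _)
        · exact Or.inr (hv.face_eq hβ _ _)
      · rintro (rfl | rfl) <;> exact ⟨_, rfl⟩
    simp only [hpair]
    generalize toTFace β (fac v 0) = f0 at hne ⊢
    generalize toTFace β (fac v 1) = f1 at hne ⊢
    have hs : ∀ b, {f | (f = f0 ∨ f = f1) ∧ C f = b} =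
        (if C f0 = b then {f0} else ∅) ∪ (if C f1 = b then {f1} else ∅) := by
      intro b
      ext f
      simp only [Set.mem_ofPred_eq, Set.mem_union]
      constructor
      · rintro ⟨rfl | rfl, h⟩
        · left; rw [if_pos h]; rfl
        · right; rw [if_pos h]; rfl
      · split_ifs with h1 h2 h2 <;> simp +contextual [h1, h2]
        rintro (rfl | rfl) <;> simp [h1, h2]
    rw [hs, hs]
    have hp := Set.ncard_pair hne
    have hu : ({f0} ∪ {f1} : Set (TFace β)) = {f0, f1} := rfl
    cases h0 : C f0 <;> cases h1 : C f1 <;> simp [hu, hp, Nat.ModEq]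
  have hsum : ∀ v, IsCone β v → ∑ i, sgn (C (toTFace β (fac v i))) = 0 := by
    intro v hv
    have h2 := hv.face_eq hβ 0 1
    have h4 := hv.face_eq hβ 0 2
    have h3 := hv.face_eq hβ 1 1
    have h5 := hv.face_eq hβ 1 2
    have : ∀ f : ZMod 6 → ZMod 3, ∑ i, f i = f 0 + f 1 + f 2 + f 3 + f 4 + f 5 := fun f =>
      Fin.sum_univ_six f
    rw [this, show (2 : ZMod 6) = 0 + 2 * 1 by decide, show (4 : ZMod 6) = 0 + 2 * 2 by decide,
      show (3 : ZMod 6) = 1 + 2 * 1 by decide, show (5 : ZMod 6) = 1 + 2 * 2 by decide,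
      h2, h3, h4, h5]
    generalize sgn (C (toTFace β (fac v 0))) = x
    generalize sgn (C (toTFace β (fac v 1))) = y
    revert x y; decide
  constructor
  · intro H
    refine ⟨fun v => ?_, fun v hv => (hcone v hv).1 (H _)⟩
    by_cases hv : IsCone β v
    · exact hsum v hv
    · exact (hnc v hv).1 (H _)
  · rintro ⟨H1, H2⟩ v
    obtain ⟨v, rfl⟩ := exists_toTVertex v
    by_cases hv : IsCone β v
    · exact (hcone v hv).2 (H2 v hv)
    · exact (hnc v hv).2 (H1 v)

/-! ### Oriented faces of the tetrahedron -/

/-- The third vertex of the positively oriented face of the tetrahedron that starts with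
`x, y`. -/
def nxt (x y : Fin 4) : Fin 4 :=
  (![![0, 2, 3, 1], ![3, 1, 0, 2], ![1, 3, 2, 0], ![2, 0, 1, 3]] : Fin 4 → Fin 4 → Fin 4) x y

/-- The third vertex of the face with orientation `c` that starts with `x, y`. -/
def third (c : Bool) (x y : Fin 4) : Fin 4 := if c then nxt x y else nxt x (nxt x y)

theorem positiveTriple_iff (x y z : Fin 4) : PositiveTriple x y z ↔ x ≠ y ∧ z = nxt x y := by
  have h1 : ∀ σ : Equiv.Perm (Fin 4), Equiv.Perm.sign σ = 1 →
      σ 0 ≠ σ 1 ∧ σ 2 = nxt (σ 0) (σ 1) := by decide +kernel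
  have h2 : ∀ x y : Fin 4, x ≠ y → ∃ σ : Equiv.Perm (Fin 4), Equiv.Perm.sign σ = 1 ∧ σ 0 = x ∧
      σ 1 = y := by decide +kernel
  constructor
  · rintro ⟨σ, h, rfl, rfl, rfl⟩
    exact h1 σ h
  · rintro ⟨h, rfl⟩
    obtain ⟨σ, hσ, rfl, rfl⟩ := h2 x y h
    exact ⟨σ, hσ, rfl, rfl, (h1 σ hσ).2⟩

theorem third_third_not (c : Bool) (x y : Fin 4) : third c x (third (!c) x y) = y := by
  revert c x y; decide

/-- Rotation of an edge of the tetrahedron about its first vertex. -/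
def turn (c : Bool) : Equiv.Perm (Fin 4 × Fin 4) where
  toFun s := (s.1, third c s.1 s.2)
  invFun s := (s.1, third (!c) s.1 s.2)
  left_inv s := by
    have := third_third_not (!c) s.1 s.2
    rw [Bool.not_not] at this
    exact Prod.ext rfl this
  right_inv s := Prod.ext rfl (third_third_not c s.1 s.2)

/-! ### Development of a flat connection on `ℤ × ℤ` -/

theorem exists_int_orbit {S : Type} (f : ℤ → Equiv.Perm S) (s₀ : S) :
    ∃ t : ℤ → S, t 0 = s₀ ∧ ∀ n, t (n + 1) = f n (t n) := by
  let p : ℕ → S := Nat.rec s₀ fun k s => f k s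
  let q : ℕ → S := Nat.rec s₀ fun k s => (f (-(k : ℤ) - 1)).symm s
  refine ⟨fun n => if 0 ≤ n then p n.toNat else q (-n).toNat, by simp [p], fun n => ?_⟩
  rcases lt_or_ge n 0 with hn | hn
  · obtain ⟨k, rfl⟩ : ∃ k : ℕ, n = -(k : ℤ) - 1 := ⟨(-n - 1).toNat, by omega⟩
    have h1 : q (-(-(k : ℤ) - 1)).toNat = (f (-(k : ℤ) - 1)).symm (q k) := by
      rw [show (-(-(k : ℤ) - 1)).toNat = k + 1 by omega]
    simp only [if_neg hn.not_ge, h1, Equiv.apply_symm_apply]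
    rcases Nat.eq_zero_or_pos k with rfl | hk
    · simp [p, q]
    · rw [if_neg (by omega)]
      congr 1; omega
  · obtain ⟨k, rfl⟩ := Int.eq_ofNat_of_zero_le hn
    simp only [if_pos hn, if_pos (show (0 : ℤ) ≤ k + 1 by omega)]
    rw [show ((k : ℤ) + 1).toNat = k + 1 by omega]
    rfl

/-- The permutations `a` and `b` are the parallel transports along horizontal and vertical edges,
and `hab` is flatness on the unit squares. One transports up the axis m = 0 and then along each row;
flatness carries the vertical rule from column to column. -/
theorem exists_development {S : Type} (a b : ℤ → ℤ → Equiv.Perm S)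
    (hab : ∀ m n s, b (m + 1) n (a m n s) = a m (n + 1) (b m n s)) (s₀ : S) :
    ∃ s : ℤ → ℤ → S, s 0 0 = s₀ ∧ (∀ m n, s (m + 1) n = a m n (s m n)) ∧
      ∀ m n, s m (n + 1) = b m n (s m n) := by
  obtain ⟨t, ht0, ht⟩ := exists_int_orbit (b 0) s₀
  choose s hs0 hs using fun n => exists_int_orbit (fun m => a m n) (t n)
  refine ⟨fun m n => s n m, (hs0 0).trans ht0, fun m n => hs n m, fun m n => ?_⟩
  induction m using Int.induction_on with
  | zero => simp only [hs0, ht]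
  | succ i ih => simp only [hs, ih, hab]
  | pred i ih =>
    apply (a (-(i : ℤ) - 1) (n + 1)).injective
    have h1 := hs (n + 1) (-(i : ℤ) - 1)
    have h2 := hs n (-(i : ℤ) - 1)
    rw [sub_add_cancel] at h1 h2
    change s (n + 1) (-(i : ℤ)) = b (-(i : ℤ)) n (s n (-(i : ℤ))) at ih
    change a (-(i : ℤ) - 1) (n + 1) (s (n + 1) (-(i : ℤ) - 1)) =
      a (-(i : ℤ) - 1) (n + 1) (b (-(i : ℤ) - 1) n (s n (-(i : ℤ) - 1)))
    rw [← h1, ih, h2, ← hab, sub_add_cancel]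

/-! ### Vertex colorings with given face coloring -/

/-- The vertex coloring `κ` of the lattice is proper, and it maps the faces to the tetrahedron
with the orientations given by `c`. -/
def Develops (c : ℤ × ℤ → ZMod 6 → Bool) (κ : ℤ × ℤ → Fin 4) : Prop :=
  ∀ v i, κ v ≠ κ (v + unit i) ∧ κ (v + unit (i + 1)) = third (c v i) (κ v) (κ (v + unit i))

theorem Develops.sum_eq_zero {c : ℤ × ℤ → ZMod 6 → Bool} {κ : ℤ × ℤ → Fin 4}
    (H : Develops c κ) (v : ℤ × ℤ) : ∑ i, sgn (c v i) = 0 := by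
  -- For fixed x this numbers the three other vertices of the tetrahedron cyclically, so that a
  -- black face adds one and a white face subtracts one. The sum around v then telescopes.
  let lab : Fin 4 → Fin 4 → ZMod 3 := fun x y =>
    (![![0, 0, 1, 2], ![0, 0, 2, 1], ![0, 1, 0, 2], ![0, 2, 1, 0]] : Fin 4 → Fin 4 → ZMod 3) x y
  have hlab : ∀ b x y, x ≠ y → lab x (third b x y) = lab x y + sgn b := by decide
  have h1 : ∀ i, sgn (c v i) =
      lab (κ v) (κ (v + unit (i + 1))) - lab (κ v) (κ (v + unit i)) := fun i => by
    obtain ⟨h1, h2⟩ := H v i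
    rw [h2, hlab _ _ _ h1]; ring
  simp only [h1]
  rw [Finset.sum_sub_distrib, sub_eq_zero]
  exact Fintype.sum_equiv (Equiv.addRight (1 : ZMod 6)) _ _ fun i => rfl

theorem third_rotate {c : Bool} {x y z : Fin 4} (h : x ≠ y) (hz : z = third c x y) :
    y ≠ z ∧ x = third c y z := by
  subst hz
  revert c x y; decide

/-- The state at (m, n) is the pair of colors of (m, n) and (m+1, n). `U` and `D` are the lower and
upper faces of the unit square, and `a`, `b` transport the state across them. That they commute is
the vanishing of the color sum at (m+1, n+1). -/
theorem exists_develops {c : ℤ × ℤ → ZMod 6 → Bool}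
    (hc : ∀ v i, c (v + unit i) (i + 2) = c v i) (hsum : ∀ v, ∑ i, sgn (c v i) = 0) :
    ∃ κ, Develops c κ := by
  let U : ℤ → ℤ → Bool := fun m n => c (m, n) 0
  let D : ℤ → ℤ → Bool := fun m n => c (m + 1, n) 1
  let flip : Equiv.Perm (Fin 4 × Fin 4) := Equiv.prodComm _ _
  let a : ℤ → ℤ → Equiv.Perm (Fin 4 × Fin 4) := fun m n =>
    ((flip.trans (turn (U m n)).symm).trans (turn (D m n)).symm).trans (turn (U (m + 1) n)).symm
  let b : ℤ → ℤ → Equiv.Perm (Fin 4 × Fin 4) := fun m n =>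
    (((turn (U m n)).trans flip).trans (turn (U m n))).trans (turn (D m n))
  have e0 : ∀ m n, c (m, n) 2 = U (m - 1) n := fun m n => by
    have := hc (m - 1, n) 0
    simpa using this
  have e1 : ∀ m n, c (m, n) 4 = U m (n - 1) := fun m n => by
    have := hc (m + 1, n - 1) 2
    simp only [unit_two, Prod.mk_add_mk, show (2 : ZMod 6) + 2 = 4 by decide] at this
    rw [show (m, n) = (m + 1 + -1, n - 1 + 1) by simp, this, e0]
    simp
  have e2 : ∀ m n, c (m, n) 1 = D (m - 1) n := fun m n => by simp [D]
  have e3 : ∀ m n, c (m, n) 3 = D (m - 1) (n - 1) := fun m n => by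
    have := hc (m, n - 1) 1
    simp only [unit_one, Prod.mk_add_mk, show (1 : ZMod 6) + 2 = 3 by decide] at this
    rw [show (m, n) = (m + 0, n - 1 + 1) by simp, this, e2]
  have e4 : ∀ m n, c (m, n) 5 = D m (n - 1) := fun m n => by
    have := hc (m + 1, n) 3
    simp only [unit_three, Prod.mk_add_mk, show (3 : ZMod 6) + 2 = 5 by decide] at this
    rw [show (m, n) = (m + 1 + -1, n + 0) by simp, this, e3]
    simp
  have hs : ∀ m n, sgn (U (m + 1) (n + 1)) + sgn (D m (n + 1)) + sgn (U m (n + 1)) +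
      sgn (D m n) + sgn (U (m + 1) n) + sgn (D (m + 1) n) = 0 := by
    intro m n
    have h1 := hsum (m + 1, n + 1)
    have h2 : ∀ f : ZMod 6 → ZMod 3, ∑ i, f i = f 0 + f 1 + f 2 + f 3 + f 4 + f 5 := fun f =>
      Fin.sum_univ_six f
    rw [h2, e0, e1, e2, e3, e4] at h1
    simpa only [add_sub_cancel_right] using h1
  -- Within a square, the right side is reached from the bottom side either around the lower right
  -- corner or around the upper left one, with the same result.
  have tri : ∀ u d s, (turn d).symm ((turn u).symm (flip s)) =
      flip (turn d (flip (turn d (turn u (flip (turn u s)))))) := by decide +kernel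
  -- Turns about the same vertex commute and have order three, so six of them compose to the
  -- identity when their signs cancel modulo 3; here three of them are moved to the other side.
  have six : ∀ c0 c1 c2 c3 c4 c5 s,
      sgn c0 + sgn c1 + sgn c2 + sgn c3 + sgn c4 + sgn c5 = 0 →
      (turn c0).symm ((turn c1).symm ((turn c2).symm s)) = turn c5 (turn c4 (turn c3 s)) := by
    decide +kernel
  have flip_flip : ∀ s, flip (flip s) = s := fun _ => rfl
  obtain ⟨s, hs0, hsa, hsb⟩ := exists_development a b (by
    intro m n s
    simp only [a, b, Equiv.trans_apply]
    rw [six _ _ _ _ _ _ _ (hs m n), Equiv.apply_symm_apply, tri]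
    rfl) (0, 1)
  -- All transports preserve both the pairs of equal colors and the pairs of distinct ones, so
  -- properness spreads from the initial pair (0, 1).
  have hturn : ∀ c (s : Fin 4 × Fin 4), (turn c s).1 = (turn c s).2 ↔ s.1 = s.2 := by decide
  have hturn' : ∀ c (s : Fin 4 × Fin 4),
      ((turn c).symm s).1 = ((turn c).symm s).2 ↔ s.1 = s.2 := by decide
  have hflip : ∀ s, (flip s).1 = (flip s).2 ↔ s.1 = s.2 := fun s => eq_comm
  have ha : ∀ m n, (s (m + 1) n).1 = (s (m + 1) n).2 ↔ (s m n).1 = (s m n).2 := fun m n => by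
    simp only [hsa, a, Equiv.trans_apply, hturn', hflip]
  have hb : ∀ m n, (s m (n + 1)).1 = (s m (n + 1)).2 ↔ (s m n).1 = (s m n).2 := fun m n => by
    simp only [hsb, b, Equiv.trans_apply, hturn, hflip]
  have hnd0 : ∀ n, (s 0 n).1 ≠ (s 0 n).2 := by
    intro n
    induction n using Int.induction_on with
    | zero => rw [hs0]; decide
    | succ i ih => rwa [ne_eq, hb]
    | pred i ih => rwa [ne_eq, ← hb, sub_add_cancel]
  have hnd : ∀ m n, (s m n).1 ≠ (s m n).2 := by
    intro m n
    induction m using Int.induction_on with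
    | zero => exact hnd0 n
    | succ i ih => rwa [ne_eq, ha]
    | pred i ih => rwa [ne_eq, ← ha, sub_add_cancel]
  have k1 : ∀ m n, (s (m + 1) n).1 = (s m n).2 := fun m n => by rw [hsa]; rfl
  have k2 : ∀ m n, (s m (n + 1)).1 = third (U m n) (s m n).1 (s m n).2 := fun m n => by
    rw [hsb]; rfl
  have k3 : ∀ m n, (s m (n + 1)).1 = third (D m n) (s (m + 1) n).1 (s (m + 1) (n + 1)).1 := by
    intro m n
    have h1 := (third_rotate (hnd m n) (k2 m n)).2
    have h2 : (s (m + 1) (n + 1)).1 =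
        third (!D m n) (s m n).2 (third (!U m n) (s m n).2 (s m n).1) := by
      rw [k2, hsa]
      exact third_third_not _ _ _
    have h3 := third_third_not (!U m n) (s m n).2 (s m (n + 1)).1
    rw [Bool.not_not, ← h1] at h3
    rw [h2, k1, third_third_not, h3]
  let κ : ℤ × ℤ → Fin 4 := fun v => (s v.1 v.2).1
  have step : ∀ v i, (κ v ≠ κ (v + unit i) ∧
      κ (v + unit (i + 1)) = third (c v i) (κ v) (κ (v + unit i))) →
      (κ (v + unit i) ≠ κ (v + unit i + unit (i + 2)) ∧
      κ (v + unit i + unit (i + 2 + 1)) =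
        third (c (v + unit i) (i + 2)) (κ (v + unit i)) (κ (v + unit i + unit (i + 2)))) := by
    rintro v i ⟨h1, h2⟩
    have h3 : v + unit i + unit (i + 2 + 1) = v := by
      rw [add_assoc i, show (2 : ZMod 6) + 1 = 3 by decide, unit_add_three, add_neg_cancel_right]
    rw [h3, add_assoc v, unit_add_unit_two, hc]
    exact third_rotate h1 h2
  have r0 : ∀ v, κ v ≠ κ (v + unit 0) ∧
      κ (v + unit (0 + 1)) = third (c v 0) (κ v) (κ (v + unit 0)) := by
    rintro ⟨m, n⟩
    simp only [zero_add, unit_zero, unit_one, Prod.mk_add_mk, add_zero, κ, k1, k2]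
    exact ⟨hnd m n, rfl⟩
  have r1 : ∀ v, κ v ≠ κ (v + unit 1) ∧
      κ (v + unit (1 + 1)) = third (c v 1) (κ v) (κ (v + unit 1)) := by
    rintro ⟨m, n⟩
    have h1 := k3 (m - 1) n
    rw [sub_add_cancel] at h1
    have h2 := (step (m - 1, n) 0 (r0 _))
    have h4 := hnd m n
    simp only [unit_one, show (1 : ZMod 6) + 1 = 2 by decide, unit_two, Prod.mk_add_mk, add_zero,
      κ, e2, ← sub_eq_add_neg]
    refine ⟨?_, h1⟩
    rw [k2]
    have h5 : ∀ c (x y : Fin 4), x ≠ y → x ≠ third c x y := by decide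
    exact h5 _ _ _ h4
  have rest : ∀ i, (∀ v, κ v ≠ κ (v + unit i) ∧
      κ (v + unit (i + 1)) = third (c v i) (κ v) (κ (v + unit i))) →
      ∀ v, κ v ≠ κ (v + unit (i + 2)) ∧
      κ (v + unit (i + 2 + 1)) = third (c v (i + 2)) (κ v) (κ (v + unit (i + 2))) := by
    intro i H v
    have := step (v - unit i) i (H _)
    rwa [sub_add_cancel] at this
  refine ⟨κ, fun v i => ?_⟩
  have : i = 0 ∨ i = 0 + 2 ∨ i = 0 + 2 + 2 ∨ i = 1 ∨ i = 1 + 2 ∨ i = 1 + 2 + 2 := by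
    revert i; decide
  rcases this with rfl | rfl | rfl | rfl | rfl | rfl
  · exact r0 v
  · exact rest _ r0 v
  · exact rest _ (rest _ r0) v
  · exact r1 v
  · exact rest _ r1 v
  · exact rest _ (rest _ r1) v

/-- Two adjacent colors determine all colors around a vertex, and from there the coloring is
determined from neighbor to neighbor. -/
theorem Develops.eq_of_eq {c : ℤ × ℤ → ZMod 6 → Bool} {κ κ' : ℤ × ℤ → Fin 4}
    (H : Develops c κ) (H' : Develops c κ') {v : ℤ × ℤ} {i : ZMod 6} (hv : κ v = κ' v)
    (hi : κ (v + unit i) = κ' (v + unit i)) : κ = κ' := by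
  have around : ∀ v, κ v = κ' v → ∀ i, κ (v + unit i) = κ' (v + unit i) →
      ∀ j, κ (v + unit j) = κ' (v + unit j) := by
    intro v hv i hi j
    have : ∀ n : ℕ, κ (v + unit (i + n)) = κ' (v + unit (i + n)) := by
      intro n
      induction n with
      | zero => simpa using hi
      | succ n ih =>
        push_cast
        rw [← add_assoc, (H v _).2, (H' v _).2, hv, ih]
    have h2 := this (j - i).val
    rwa [ZMod.natCast_val, ZMod.cast_id, add_sub_cancel] at h2
  let P : ℤ × ℤ → Prop := fun v => κ v = κ' v ∧ ∀ j, κ (v + unit j) = κ' (v + unit j)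
  have hstep : ∀ v j, P v → P (v + unit j) := by
    rintro v j ⟨h1, h2⟩
    refine ⟨h2 j, around _ (h2 j) (j + 3) ?_⟩
    rwa [unit_add_three, add_neg_cancel_right]
  have hmul : ∀ v j (n : ℕ), P v → P (v + (n : ℤ) • unit j) := by
    intro v j n hP
    induction n with
    | zero => simpa using hP
    | succ n ih =>
      have := hstep _ j ih
      push_cast
      rwa [add_smul, one_smul, ← add_assoc]
  have hmulz : ∀ v j (n : ℤ), P v → P (v + n • unit j) := by
    intro v j n hP
    rcases Int.eq_nat_or_neg n with ⟨m, rfl | rfl⟩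
    · exact hmul v j m hP
    · have := hmul v (j + 3) m hP
      rwa [unit_add_three, smul_neg, ← neg_smul] at this
  have h0 : P v := ⟨hv, around v hv i hi⟩
  funext w
  have := hmulz _ 1 (w.2 - v.2) (hmulz v 0 (w.1 - v.1) h0)
  have hw : v + (w.1 - v.1) • unit 0 + (w.2 - v.2) • unit 1 = w := by
    apply Prod.ext <;> simp
  rw [hw] at this
  exact this.1

/-! ### From the developed coloring to the quotient -/

theorem normSq_toC (v : ℤ × ℤ) :
    Complex.normSq (toC v) = ((v.1 ^ 2 + v.1 * v.2 + v.2 ^ 2 : ℤ) : ℝ) := by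
  have h3 : Real.sqrt 3 * Real.sqrt 3 = 3 := Real.mul_self_sqrt (by norm_num)
  simp only [Complex.normSq_apply, toC, α]
  simp
  linear_combination (v.2 : ℝ) ^ 2 / 4 * h3

theorem exists_unit_of_norm_eq_one {v : ℤ × ℤ} (H : ‖toC v‖ = 1) : ∃ i, v = unit i := by
  have h1 : v.1 ^ 2 + v.1 * v.2 + v.2 ^ 2 = 1 := by
    have := normSq_toC v
    rw [Complex.normSq_eq_norm_sq, H, one_pow] at this
    exact_mod_cast this.symm
  obtain ⟨x, y⟩ := v
  simp only at h1
  have hy1 : y ≤ 1 := by nlinarith [sq_nonneg (2 * x + y)]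
  have hy2 : -1 ≤ y := by nlinarith [sq_nonneg (2 * x + y)]
  have hx1 : x ≤ 1 := by nlinarith [sq_nonneg (2 * y + x)]
  have hx2 : -1 ≤ x := by nlinarith [sq_nonneg (2 * y + x)]
  rw [exists_zmod_six]
  simp only [unit_zero, unit_one, unit_two, unit_three, unit_four, unit_five, Prod.mk.injEq]
  interval_cases x <;> interval_cases y <;> simp_all

/-- Good face colorings are the face colorings of proper vertex colorings. -/
theorem isGood_iff_exists {β : ℂ} (hβ : β ∈ lattice) (C : TFace β → Bool) :
    IsGood β C ↔ ∃ κ, IsProper β κ ∧ Induces β κ C := by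
  rw [isGood_iff hβ]
  set c : ℤ × ℤ → ZMod 6 → Bool := fun v i => C (toTFace β (fac v i)) with hcdef
  have hc : ∀ v i, c (v + unit i) (i + 2) = c v i := fun v i => by
    simp only [hcdef, fac_rotate]
  have hnorm : ∀ v i, ‖(vtx v).1 - (vtx (v + unit i)).1‖ = 1 := fun v i => by
    have : ‖zeta i‖ = 1 := by
      have := congrArg norm (zeta_pow_six i)
      rw [norm_pow, norm_one] at this
      exact (pow_eq_one_iff_of_nonneg (norm_nonneg _) (by norm_num)).1 this
    simp only [vtx, toC_add, toC_unit, sub_add_cancel_left, norm_neg, this]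
  constructor
  · rintro ⟨h1, h2⟩
    obtain ⟨κ, hκ⟩ := exists_develops hc h1
    have hinv : ∀ g ∈ G β, ∀ v w, g (toC v) = toC w → κ v = κ w := by
      intro g hg
      induction hg using Subgroup.closure_induction with
      | mem g hg =>
        obtain ⟨e, he, rfl⟩ := hg
        intro v w hvw
        obtain ⟨x, hx⟩ := mem_lattice_iff.1 (lattice_mul hβ he)
        have hcone : IsCone β x := ⟨e, he, hx.symm⟩
        obtain ⟨t, ht, hxt⟩ := hcone.exists_act_eq 1
        -- The face coloring is invariant under the rotation about x, so κ composed with this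
        -- rotation develops the same face coloring. It remains to compare the two on one edge at x.
        have hdev : Develops c fun v => κ (ro (2 * 1) v + t) := by
          intro v i
          have := hκ (ro (2 * 1) v + t) (i + 2 * 1)
          have e1 : ∀ k, ro (2 * 1) (v + unit k) + t = ro (2 * 1) v + t + unit (k + 2 * 1) :=
            fun k => by rw [ro_add, ro_unit, add_comm k]; abel
          have e2 : c (ro (2 * 1) v + t) (i + 2 * 1) = c v i := by
            simp only [hcdef, toTFace_fac_act hβ v i 1 ht]
          rw [e2] at this
          simp only [e1]
          rw [show i + 1 + 2 * 1 = i + 2 * 1 + 1 by ring]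
          exact this
        have heq : κ = fun v => κ (ro (2 * 1) v + t) := by
          refine hκ.eq_of_eq hdev (v := x) (i := 0) (by rw [hxt]) ?_
          have e1 : ro (2 * 1) (x + unit 0) + t = x + unit 2 := by
            rw [ro_add, add_right_comm, hxt, ro_unit]; rfl
          rw [e1]
          have a0 := (hκ x 0).2
          have a1 := (hκ x 1).2
          rw [zero_add] at a0
          rw [show (1 : ZMod 6) + 1 = 2 by decide, a0] at a1
          -- Successive faces at x have opposite colors, so their two turns cancel and `x + unit 2`,
          -- the rotated image of `x + unit 0`, has the same color as `x + unit 0`.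
          have hcx : c x 1 = !c x 0 := by
            have := h2 x hcone
            revert this
            cases c x 0 <;> cases c x 1 <;> simp
          have h3 := third_third_not (!c x 0) (κ x) (κ (x + unit 0))
          rw [Bool.not_not] at h3
          rw [a1, hcx, h3]
        have hw : w = ro (2 * 1) v + t := by
          apply toC_injective
          rw [← hvw, toC_add, toC_ro, rot_apply, α_sq_eq_zeta, mul_one]
          have := congrArg toC hxt
          rw [toC_add, toC_ro, mul_one] at this
          rw [hx]
          linear_combination -this
        rw [hw]
        exact congrFun heq v
      | one =>
        intro v w hvw
        rw [toC_injective hvw]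
      | mul g g' hg hg' ih ih' =>
        intro v w hvw
        have hmem : g' (toC v) ∈ lattice := by
          obtain ⟨j, t, ht, hj⟩ := exists_of_mem_G hg'
          rw [hj]
          exact lattice_add (lattice_zeta_mul _ (toC_mem v)) (tileLattice_subset hβ ht)
        obtain ⟨x, hx⟩ := mem_lattice_iff.1 hmem
        exact (ih' v x hx).trans (ih x w (by rw [← hx]; exact hvw))
      | inv g hg ih =>
        intro v w hvw
        exact (ih w v ((Equiv.Perm.inv_eq_iff_eq.1 hvw).symm)).symm
    have hact : ∀ v w, toTVertex β (vtx v) = toTVertex β (vtx w) → κ v = κ w := by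
      intro v w H
      obtain ⟨j, t, ht, rfl⟩ := toTVertex_eq.1 H
      obtain ⟨g, hg, hj⟩ := exists_mem_G β j ht
      exact hinv g hg _ _ (by rw [hj, toC_add, toC_ro])
    let K : TVertex β → Fin 4 := fun v => κ (exists_toTVertex v).choose
    have hK : ∀ v, K (toTVertex β (vtx v)) = κ v := fun v =>
      (hact _ _ (exists_toTVertex (toTVertex β (vtx v))).choose_spec).symm
    refine ⟨K, ?_, ?_⟩
    · intro v w hvw
      obtain ⟨v, rfl⟩ := exists_vtx v
      obtain ⟨w, rfl⟩ := exists_vtx w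
      rw [hK, hK]
      simp only [vtx, ← toC_sub] at hvw
      obtain ⟨i, hi⟩ := exists_unit_of_norm_eq_one hvw
      have : v = w + unit i := by rw [← hi]; abel
      rw [this]
      exact (hκ w i).1.symm
    · intro F p q r u hu hq hr hF
      obtain ⟨v, rfl⟩ := exists_vtx p
      obtain ⟨i, rfl⟩ := pow_six_eq_one_iff.1 hu
      have eF : F = fac v i := Subtype.ext hF
      have eq : q = vtx (v + unit i) := Subtype.ext (by rw [hq]; simp [vtx, toC_unit])
      have er : r = vtx (v + unit (i + 1)) := Subtype.ext (by
        rw [hr]; simp [vtx, toC_unit, zeta_add, mul_comm])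
      rw [eF, eq, er, hK, hK, hK, positiveTriple_iff]
      obtain ⟨d1, d2⟩ := hκ v i
      change c v i = true ↔ _
      rw [d2]
      revert d1
      generalize c v i = b
      generalize κ v = x
      generalize κ (v + unit i) = y
      revert b x y
      decide
  · rintro ⟨K, hp, hi⟩
    have hdev : Develops c fun v => K (toTVertex β (vtx v)) := by
      intro v i
      have d1 := hp _ _ (hnorm v i)
      have d2 := hp _ _ (hnorm v (i + 1))
      have d3 := hp _ _ (hnorm (v + unit i) (i + 2))
      rw [add_assoc v, unit_add_unit_two] at d3
      have := hi (fac v i) (vtx v) (vtx (v + unit i)) (vtx (v + unit (i + 1))) (zeta i)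
        (zeta_pow_six i) (by simp [vtx, toC_unit]) (by simp [vtx, toC_unit, zeta_add, mul_comm]) rfl
      rw [positiveTriple_iff] at this
      change c v i = true ↔ _ at this
      refine ⟨d1, ?_⟩
      simp only
      revert d1 d2 d3 this
      generalize c v i = b
      generalize K (toTVertex β (vtx v)) = x
      generalize K (toTVertex β (vtx (v + unit i))) = y
      generalize K (toTVertex β (vtx (v + unit (i + 1)))) = z
      revert b x y z
      decide
    refine ⟨hdev.sum_eq_zero, fun v hv H => ?_⟩
    -- If the two colors agreed, two equal turns would carry the color of `v + unit 0` to that of `v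
    -- + unit 2`, which is the same vertex of the quotient; but two thirds of a turn move every
    -- neighbor.
    obtain ⟨t, ht, hvt⟩ := hv.exists_act_eq 1
    have e1 : ro (2 * 1) (v + unit 0) + t = v + unit 2 := by
      rw [ro_add, add_right_comm, hvt, ro_unit]; rfl
    have e2 := toTVertex_act (v + unit 0) 1 ht
    rw [e1] at e2
    obtain ⟨d1, a0⟩ := hdev v 0
    have a1 := (hdev v 1).2
    rw [zero_add] at a0
    simp only at a0 a1 d1
    rw [show (1 : ZMod 6) + 1 = 2 by decide, a0, ← H, e2] at a1
    revert d1 a1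
    generalize c v 0 = b
    generalize K (toTVertex β (vtx v)) = x
    generalize K (toTVertex β (vtx (v + unit 0))) = y
    revert b x y
    decide

/-! ### Hexagons -/

theorem core_eq (i : ℕ) : core i = triangle (toC 0) (zeta i) := by
  rw [core, triangle, toC_zero, zero_add, zero_add, zeta_natCast, pow_succ, mul_comm α]

/-- The signs of x, y and x + y select the sector between two successive unit vectors that contains
the point. -/
theorem mem_core_of_le {z : ℂ} (H : ∀ i, h i z ≤ 1) : ∃ i, z ∈ triangle (toC 0) (zeta i) := by
  have key : ∀ i, (∀ j, h j z ≤ supp (i + j)) → ∃ i, z ∈ triangle (toC 0) (zeta i) :=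
    fun i hi => ⟨i, by
      rw [triangle_eq_poly]
      intro j
      rw [faceBound, show hz j 0 = 0 by have := hz_smul j 0 0; simpa using this, zero_add]
      exact hi j⟩
  rw [forall_zmod_six] at H
  simp only [h_one, h_two, h_three, h_five] at H
  obtain ⟨h0, h1, h2, h3, h4, h5⟩ := H
  have s : supp 0 = 1 ∧ supp 1 = 0 ∧ supp 2 = 0 ∧ supp 3 = 0 ∧ supp 4 = 1 ∧ supp 5 = 1 :=
    ⟨rfl, rfl, rfl, rfl, rfl, rfl⟩
  obtain ⟨s0, s1, s2, s3, s4, s5⟩ := s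
  have add : ∀ i j k : ZMod 6, i + j = k → supp (i + j) = supp k := fun _ _ _ h => by rw [h]
  rcases le_total 0 (h 0 z) with hx | hx <;> rcases le_total 0 (h 4 z) with hy | hy <;>
    rcases le_total 0 (h 0 z + h 4 z) with hs | hs
  · apply key 0
    rw [forall_zmod_six]
    simp only [h_one, h_two, h_three, h_five, zero_add, s0, s1, s2, s3, s4, s5]
    push_cast
    refine ⟨?_, ?_, ?_, ?_, ?_, ?_⟩ <;> linarith
  · apply key 0
    rw [forall_zmod_six]
    simp only [h_one, h_two, h_three, h_five, zero_add, s0, s1, s2, s3, s4, s5]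
    push_cast
    refine ⟨?_, ?_, ?_, ?_, ?_, ?_⟩ <;> linarith
  · apply key 5
    rw [forall_zmod_six]
    simp only [h_one, h_two, h_three, h_five, show (5 : ZMod 6) + 0 = 5 by decide,
      show (5 : ZMod 6) + 1 = 0 by decide, show (5 : ZMod 6) + 2 = 1 by decide,
      show (5 : ZMod 6) + 3 = 2 by decide, show (5 : ZMod 6) + 4 = 3 by decide,
      show (5 : ZMod 6) + 5 = 4 by decide, s0, s1, s2, s3, s4, s5]
    push_cast
    refine ⟨?_, ?_, ?_, ?_, ?_, ?_⟩ <;> linarith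
  · apply key 4
    rw [forall_zmod_six]
    simp only [h_one, h_two, h_three, h_five, show (4 : ZMod 6) + 0 = 4 by decide,
      show (4 : ZMod 6) + 1 = 5 by decide, show (4 : ZMod 6) + 2 = 0 by decide,
      show (4 : ZMod 6) + 3 = 1 by decide, show (4 : ZMod 6) + 4 = 2 by decide,
      show (4 : ZMod 6) + 5 = 3 by decide, s0, s1, s2, s3, s4, s5]
    push_cast
    refine ⟨?_, ?_, ?_, ?_, ?_, ?_⟩ <;> linarith
  · apply key 1
    rw [forall_zmod_six]
    simp only [h_one, h_two, h_three, h_five, show (1 : ZMod 6) + 0 = 1 by decide,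
      show (1 : ZMod 6) + 1 = 2 by decide, show (1 : ZMod 6) + 2 = 3 by decide,
      show (1 : ZMod 6) + 3 = 4 by decide, show (1 : ZMod 6) + 4 = 5 by decide,
      show (1 : ZMod 6) + 5 = 0 by decide, s0, s1, s2, s3, s4, s5]
    push_cast
    refine ⟨?_, ?_, ?_, ?_, ?_, ?_⟩ <;> linarith
  · apply key 2
    rw [forall_zmod_six]
    simp only [h_one, h_two, h_three, h_five, show (2 : ZMod 6) + 0 = 2 by decide,
      show (2 : ZMod 6) + 1 = 3 by decide, show (2 : ZMod 6) + 2 = 4 by decide,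
      show (2 : ZMod 6) + 3 = 5 by decide, show (2 : ZMod 6) + 4 = 0 by decide,
      show (2 : ZMod 6) + 5 = 1 by decide, s0, s1, s2, s3, s4, s5]
    push_cast
    refine ⟨?_, ?_, ?_, ?_, ?_, ?_⟩ <;> linarith
  all_goals
    apply key 3
    rw [forall_zmod_six]
    simp only [h_one, h_two, h_three, h_five, show (3 : ZMod 6) + 0 = 3 by decide,
      show (3 : ZMod 6) + 1 = 4 by decide, show (3 : ZMod 6) + 2 = 5 by decide,
      show (3 : ZMod 6) + 3 = 0 by decide, show (3 : ZMod 6) + 4 = 1 by decide,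
      show (3 : ZMod 6) + 5 = 2 by decide, s0, s1, s2, s3, s4, s5]
    push_cast
    refine ⟨?_, ?_, ?_, ?_, ?_, ?_⟩ <;> linarith

theorem h_le_of_mem_core {z : ℂ} {i : ZMod 6} (H : z ∈ triangle (toC 0) (zeta i)) (j : ZMod 6) :
    h j z ≤ 1 := by
  rw [triangle_eq_poly] at H
  have h1 := H j
  have h2 : ∀ k, supp k ≤ 1 := by decide
  have h3 : faceBound 0 i j ≤ 1 := by
    rw [faceBound, show hz j 0 = 0 by have := hz_smul j 0 0; simpa using this, zero_add]
    exact h2 _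
  exact h1.trans (by exact_mod_cast h3)

theorem hexagon_eq_image (β : ℂ) : hexagon β = (fun z => β * z + 0) '' hexagon 1 := by
  rw [hexagon, hexagon, image_convexHull_affine]
  congr 1
  ext z
  constructor
  · rintro ⟨i, rfl⟩; exact ⟨_, ⟨i, rfl⟩, by ring⟩
  · rintro ⟨_, ⟨i, rfl⟩, rfl⟩; exact ⟨i, by ring⟩

theorem mem_hexagon_one {z : ℂ} : z ∈ hexagon 1 ↔ ∀ i, h i z ≤ 1 := by
  have htip : ∀ i, zeta i ∈ hexagon 1 := fun i => subset_convexHull ℝ _ ⟨i.val, by rw [mul_one]; rfl⟩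
  constructor
  · intro H i
    have : hexagon 1 ⊆ {z | h i z ≤ 1} := by
      apply convexHull_min
      · rintro _ ⟨n, rfl⟩
        rw [mul_one, ← zeta_natCast, ← toC_unit, Set.mem_ofPred_eq, h_toC]
        have : ∀ i k, hz i (unit k) ≤ 1 := by decide
        exact_mod_cast this _ _
      · exact convex_halfSpace_le (h i).isLinear 1
    exact this H
  · intro H
    obtain ⟨i, hi⟩ := mem_core_of_le H
    refine convexHull_min ?_ (convex_convexHull ℝ _) hi
    have h0 : (0 : ℂ) ∈ hexagon 1 := by
      have := (convex_convexHull ℝ _) (htip 0) (htip 3) (by norm_num : (0 : ℝ) ≤ 1 / 2)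
        (by norm_num : (0 : ℝ) ≤ 1 / 2) (by norm_num)
      rwa [zeta_zero, zeta_three, smul_neg, add_neg_cancel] at this
    rintro w (rfl | rfl | rfl)
    · rwa [toC_zero]
    · rw [toC_zero, zero_add]; exact htip i
    · rw [toC_zero, zero_add, show α * zeta i = zeta (1 + i) by rw [zeta_add, zeta_one]]
      exact htip _

theorem mem_hexagon {β z : ℂ} (hβ : β ≠ 0) : z ∈ hexagon β ↔ ∀ i, h i (z / β) ≤ 1 := by
  rw [hexagon_eq_image, ← mem_hexagon_one]
  constructor
  · rintro ⟨w, hw, rfl⟩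
    simpa [mul_div_cancel_left₀ w hβ] using hw
  · intro H
    exact ⟨_, H, by simp only [add_zero]; rw [mul_div_cancel₀ _ hβ]⟩

theorem hexagon_zeta_mul (i : ZMod 6) (β : ℂ) : hexagon (zeta i * β) = hexagon β := by
  rw [hexagon, hexagon]
  congr 1
  ext z
  constructor
  · rintro ⟨n, rfl⟩
    exact ⟨n + i.val, by rw [zeta]; ring⟩
  · rintro ⟨n, rfl⟩
    refine ⟨n + (-i).val, ?_⟩
    have : α ^ (-i).val * zeta i = 1 := by
      have := zeta_mul_neg i
      rw [mul_comm] at this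
      exact this
    rw [pow_add]
    linear_combination (-α ^ n * β) * this

/-! ### The tiling by hexagons -/

theorem tileLattice_zeta_mul_eq (i : ZMod 6) (β : ℂ) :
    tileLattice (zeta i * β) = tileLattice β := by
  ext z
  constructor
  · rintro ⟨e, he, rfl⟩
    exact ⟨zeta i * e, lattice_zeta_mul i he, by ring⟩
  · rintro ⟨e, he, rfl⟩
    refine ⟨zeta (-i) * e, lattice_zeta_mul _ he, ?_⟩
    linear_combination (-β * (1 + α) * e) * zeta_mul_neg i

theorem mem_tileLattice_iff {β t : ℂ} :
    t ∈ tileLattice β ↔ ∃ u, col u = 0 ∧ t = β * toC u := by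
  constructor
  · rintro ⟨e, he, rfl⟩
    obtain ⟨w, rfl⟩ := mem_lattice_iff.1 he
    exact ⟨_, col_eq_zero_iff.2 ⟨w, (one_add_α_mul w).symm⟩, by rw [← one_add_α_mul]; ring⟩
  · rintro ⟨u, hu, rfl⟩
    obtain ⟨w, hw⟩ := col_eq_zero_iff.1 hu
    exact ⟨toC w, toC_mem w, by rw [hw]; ring⟩

/-- After division by β, the point lies in a unit face. One of its three vertices is a multiple of 1
+ α, and the unit hexagon about that vertex contains the face. -/
theorem exists_tile {β : ℂ} (hβ : β ≠ 0) (z : ℂ) :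
    ∃ t ∈ tileLattice β, z - t ∈ hexagon β := by
  obtain ⟨v, i, hv, -⟩ := exists_face (z / β)
  have h3 : ∀ (c : ZMod 3) i, c = 0 ∨ c + col (unit i) = 0 ∨ c + col (unit (i + 1)) = 0 := by
    decide
  obtain ⟨x, hx, hx0⟩ : ∃ x, (vtx x).1 ∈ (fac v i).1 ∧ col x = 0 := by
    rcases h3 (col v) i with hc | hc | hc
    · exact ⟨v, mem_fac.2 (Or.inl rfl), hc⟩
    · exact ⟨_, mem_fac.2 (Or.inr (Or.inl rfl)), by rw [col_add, hc]⟩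
    · exact ⟨_, mem_fac.2 (Or.inr (Or.inr rfl)), by rw [col_add, hc]⟩
  obtain ⟨j, hj⟩ := exists_fac_eq_of_mem hx
  refine ⟨β * toC x, mem_tileLattice_iff.2 ⟨x, hx0, rfl⟩, ?_⟩
  rw [mem_hexagon hβ, sub_div, mul_div_cancel_left₀ _ hβ]
  have h1 : z / β ∈ triangle (toC x) (zeta j) := by
    have h2 := congrArg Subtype.val hj
    simp only [fac] at h2
    rwa [← h2]
  intro k
  rw [triangle_eq_poly] at h1
  have h2 := h1 k
  have h4 : ∀ k, supp k ≤ 1 := by decide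
  have h5 : (supp (j + k) : ℝ) ≤ 1 := by exact_mod_cast h4 _
  rw [faceBound, Int.cast_add] at h2
  rw [map_sub, h_toC]
  linarith

theorem h_div_lt_of_mem_interior {β t z : ℂ} (hβ : β ≠ 0)
    (hz : z ∈ interior (translate t (hexagon β))) (i : ZMod 6) : h i ((z - t) / β) < 1 := by
  obtain ⟨ε, hε, hm⟩ := exists_add_mem_of_mem_interior hz (β * zeta (-i))
  rw [mem_translate, mem_hexagon hβ] at hm
  have h1 := hm i
  rw [show (z + ε * (β * zeta (-i)) - t) / β = (z - t) / β + ε * zeta (-i) by field_simp; ring,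
    map_add, h_real_mul, h_zeta_neg] at h1
  linarith

/-- Centers of distinct tiles, divided by β, differ by at least 2 in some functional, whereas
overlapping unit hexagons have centers that differ by less. -/
theorem eq_zero_of_hz_lt {u : ℤ × ℤ} (hu : col u = 0) (H : ∀ i, hz i u < 2) : u = 0 := by
  rw [forall_zmod_six] at H
  simp only [hz_zero, hz_one, hz_two, hz_three, hz_four, hz_five] at H
  have : (3 : ℤ) ∣ u.1 - u.2 := by
    have := (ZMod.intCast_zmod_eq_zero_iff_dvd (u.1 - u.2) 3).1 (by simpa [col] using hu)
    exact_mod_cast this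
  apply Prod.ext
  · simp only [Prod.fst_zero]; omega
  · simp only [Prod.snd_zero]; omega

theorem hexagonsTile {β : ℂ} (hβ : β ≠ 0) : HexagonsTile β := by
  constructor
  · refine Set.eq_univ_of_forall fun z => ?_
    obtain ⟨t, ht, hz⟩ := exists_tile hβ z
    exact Set.mem_biUnion ht (mem_translate.2 hz)
  · intro t ht t' ht' hne
    rw [Set.disjoint_left]
    intro z h1 h2
    apply hne
    obtain ⟨u, hu, hut⟩ := mem_tileLattice_iff.1 (tileLattice_sub ht ht')
    have : u = 0 := by
      refine eq_zero_of_hz_lt hu fun i => ?_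
      have e1 := h_div_lt_of_mem_interior hβ h1 (i + 3)
      have e2 := h_div_lt_of_mem_interior hβ h2 i
      rw [h_add_three] at e1
      have e3 : toC u = (z - t') / β - (z - t) / β := by
        rw [← sub_div, eq_div_iff hβ]; linear_combination -hut
      have e4 := h_toC i u
      rw [e3, map_sub] at e4
      have : (hz i u : ℝ) < 2 := by linarith
      exact_mod_cast this
    rw [this, toC_zero, mul_zero] at hut
    exact sub_eq_zero.1 hut

/-- The norm of `b.1 + b.2 α`. -/
def nrm (b : ℤ × ℤ) : ℤ := b.1 ^ 2 + b.1 * b.2 + b.2 ^ 2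

/-- The product of `w` with the conjugate of `b`. -/
def conjMul (b w : ℤ × ℤ) : ℤ × ℤ :=
  (w.1 * (b.1 + b.2) + w.2 * b.2, -w.1 * b.2 + w.2 * b.1)

theorem nrm_pos {b : ℤ × ℤ} (hb : b ≠ 0) : 0 < nrm b := by
  rw [nrm]
  by_contra hn
  apply hb
  have h2 : b.2 = 0 := by nlinarith [sq_nonneg (2 * b.1 + b.2), sq_nonneg b.2]
  have h1 : b.1 = 0 := by rw [h2] at hn; nlinarith [sq_nonneg b.1]
  exact Prod.ext h1 h2

theorem toC_ne_zero {b : ℤ × ℤ} : toC b ≠ 0 ↔ b ≠ 0 := by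
  rw [← toC_zero, ne_eq, toC_inj]

/-- Since w / b is w times the conjugate of b over the norm, membership in the hexagon of b becomes
a list of integer inequalities. -/
theorem nrm_mul_h_div {b : ℤ × ℤ} (hb : b ≠ 0) (w : ℤ × ℤ) (i : ZMod 6) :
    (nrm b : ℝ) * h i (toC w / toC b) = hz i (conjMul b w) := by
  have h0 := toC_ne_zero.2 hb
  rw [← h_toC, ← h_real_mul]
  congr 1
  rw [mul_div_assoc', div_eq_iff h0]
  simp only [toC, conjMul, nrm]
  push_cast
  linear_combination (-(-w.1 * b.2 + w.2 * b.1 : ℂ) * b.2) * α_sq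

theorem toC_mem_hexagon_iff {b w : ℤ × ℤ} (hb : b ≠ 0) :
    toC w ∈ hexagon (toC b) ↔ ∀ i, hz i (conjMul b w) ≤ nrm b := by
  rw [mem_hexagon (toC_ne_zero.2 hb)]
  have hN : (0 : ℝ) < nrm b := by exact_mod_cast nrm_pos hb
  refine forall_congr' fun i => ?_
  have := nrm_mul_h_div hb w i
  constructor
  · intro H
    have h1 := mul_le_mul_of_nonneg_left H hN.le
    rw [this, mul_one] at h1
    exact_mod_cast h1
  · intro H
    have h1 : (hz i (conjMul b w) : ℝ) ≤ nrm b := by exact_mod_cast H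
    rw [← this] at h1
    nlinarith

/-- The only lattice points on the boundary of the hexagon are its vertices. -/
theorem eq_tip_of_boundary {b w : ℤ × ℤ} (hb : IsCoprime b.1 b.2) (hb0 : b ≠ 0)
    (hw : toC w ∈ hexagon (toC b)) {i : ZMod 6} (hi : h i (toC w / toC b) = 1) :
    ∃ k, w = ro k b := by
  have hrot : ∀ j, h j (toC w / toC b) = h (j - i) (toC (ro i w) / toC b) := fun j => by
    rw [toC_ro, mul_div_assoc, h_zeta_mul, sub_add_cancel]
  suffices H : ∀ w, toC w ∈ hexagon (toC b) → h 0 (toC w / toC b) = 1 → w = b ∨ w = ro 5 b by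
    have h1 : toC (ro i w) ∈ hexagon (toC b) := by
      rw [mem_hexagon (toC_ne_zero.2 hb0)] at hw ⊢
      intro j
      have := hw (j + i)
      rwa [hrot, add_sub_cancel_right] at this
    have h2 := hrot i
    rw [sub_self, hi] at h2
    have h3 : w = ro (-i) (ro i w) := by rw [ro_ro, neg_add_cancel, ro_zero]
    rcases H _ h1 h2.symm with h4 | h4
    · exact ⟨-i, by rw [← h4, ← h3]⟩
    · exact ⟨-i + 5, by rw [← ro_ro, ← h4, ← h3]⟩
  clear hw hi hrot w
  intro w hw hi
  rw [toC_mem_hexagon_iff hb0, forall_zmod_six] at hw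
  have h0 := nrm_mul_h_div hb0 w 0
  rw [hi, mul_one] at h0
  have hN := nrm_pos hb0
  obtain ⟨a, b⟩ := b
  obtain ⟨x, y⟩ := w
  simp only [hz_zero, hz_one, hz_two, hz_three, hz_four, hz_five, conjMul, nrm] at hw h0 hN hb
  have h0 : a ^ 2 + a * b + b ^ 2 = x * (a + b) + y * b := by exact_mod_cast h0
  have hcop : IsCoprime b (a + b) := by
    obtain ⟨r, s, hrs⟩ := hb
    exact ⟨s - r, r, by linear_combination hrs⟩
  obtain ⟨s, r, hrs⟩ := hcop
  -- The line through the side consists of the points b + t(b.2, -(b.1 + b.2)). By the Bézout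
  -- relation the lattice points on it have integral t, and the two neighboring sides bound t
  -- between 0 and 1.
  obtain ⟨k, hk1, hk2⟩ : ∃ k, x = a + b * k ∧ y = b - (a + b) * k :=
    ⟨(x - a) * s - (y - b) * r, by linear_combination (-(x - a)) * hrs - r * h0,
      by linear_combination (-(y - b)) * hrs - s * h0⟩
  subst hk1 hk2
  have e1 : k * (a ^ 2 + a * b + b ^ 2) ≤ 1 * (a ^ 2 + a * b + b ^ 2) := by linarith [hw.2.1]
  have e2 : 0 * (a ^ 2 + a * b + b ^ 2) ≤ k * (a ^ 2 + a * b + b ^ 2) := by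
    linarith [hw.2.2.2.2.2]
  have k1 := le_of_mul_le_mul_right e1 hN
  have k2 := le_of_mul_le_mul_right e2 hN
  have : k = 0 ∨ k = 1 := by omega
  rcases this with rfl | rfl
  · left; simp
  · right
    simp only [ro, hz_five, show (5 : ZMod 6) + 4 = 3 by decide, hz_three]
    apply Prod.ext <;> simp

/-! ### The necklaces of a state

A state `(τ, p, q)` stands for the necklace whose trapezoids have diagonal sides of length `p`
and tops of length `q`, with an orientation `τ`. -/

abbrev State : Type := Bool × ℕ × ℕ

/-- The outermost vertex of the necklace. -/
def tip (s : State) : ℤ × ℤ := if s.1 then (s.2.1, s.2.2) else (s.2.2, s.2.1)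

/-- The state of the next necklace. -/
def nextState (s : State) : State :=
  if 2 * s.2.1 ≤ s.2.2 then (s.1, s.2.1, s.2.2 - s.2.1) else (!s.1, s.2.2 - s.2.1, s.2.1)

/-- The left end of the top of the first trapezoid. -/
def base (s : State) : ℤ × ℤ :=
  if s.1 then ((s.2.1 : ℤ) - s.2.2, (s.2.2 : ℤ)) else ((s.2.2 : ℤ), (s.2.1 : ℤ))

/-- The direction of the top of the first trapezoid. -/
def topDir (s : State) : ZMod 6 := if s.1 then 0 else 4

abbrev State.Valid (s : State) : Prop := 0 < s.2.1 ∧ s.2.1 ≤ s.2.2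

/-- The trapezoid with the top of the necklace of `s` and diagonal sides of length `d`. -/
def deepTrapezoid (s : State) (d : ℕ) (hd : 0 < d ∧ d ≤ s.2.2) (i : ZMod 6) : Trapezoid where
  corner := toC (ro i (base s))
  dir := zeta (i + topDir s)
  diag := d
  topLen := s.2.2
  corner_mem := toC_mem _
  dir_pow := zeta_pow_six _
  diag_pos := hd.1
  diag_le := hd.2

/-- The trapezoids of the necklace of the state `s`. -/
def neck (s : State) (i : ZMod 6) : Trapezoid :=
  if hs : s.Valid then deepTrapezoid s s.2.1 hs i else
    -- A dummy for invalid states; the flower uses `neck` only for valid ones.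
    ⟨0, 1, 1, 1, toC_zero ▸ toC_mem 0, one_pow 6, one_pos, le_rfl⟩

theorem neck_eq {s : State} (hs : s.Valid) (i : ZMod 6) :
    neck s i = deepTrapezoid s s.2.1 hs i := dif_pos hs

theorem mem_deepTrapezoid_region {s : State} {d : ℕ} (hd : 0 < d ∧ d ≤ s.2.2) (i : ZMod 6) {z : ℂ} :
    z ∈ (deepTrapezoid s d hd i).region ↔
    if s.1 then h 0 (zeta (-i) * z) ≤ s.2.1 ∧ s.2.1 ≤ h 5 (zeta (-i) * z) ∧
      s.2.2 - d ≤ h 4 (zeta (-i) * z) ∧ h 4 (zeta (-i) * z) ≤ s.2.2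
    else h 4 (zeta (-i) * z) ≤ s.2.1 ∧ s.2.1 ≤ h 5 (zeta (-i) * z) ∧
      s.2.2 - d ≤ h 0 (zeta (-i) * z) ∧ h 0 (zeta (-i) * z) ≤ s.2.2 := by
  have hset : (deepTrapezoid s d hd i).region = convexHull ℝ
      {toC (ro i (base s)), toC (ro i (base s)) + ((s.2.2 : ℝ) : ℂ) * zeta (i + topDir s),
      toC (ro i (base s)) + ((d : ℝ) : ℂ) * (zeta (i + topDir s) * α⁻¹),
      toC (ro i (base s)) + ((s.2.2 : ℝ) : ℂ) * zeta (i + topDir s) +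
        ((d : ℝ) : ℂ) * (zeta (i + topDir s) * α⁻¹ * α⁻¹)} := by
    simp only [Trapezoid.region, Trapezoid.vertices, Trapezoid.topLeft, Trapezoid.topRight,
      Trapezoid.bottomLeft, Trapezoid.bottomRight, deepTrapezoid, Complex.ofReal_natCast]
  rw [hset, convexHull_trapezoid _ _ _ _ (by exact_mod_cast hd.1) (by exact_mod_cast hd.2),
    Set.mem_ofPred_eq]
  have hr : ∀ j, h (j - (i + topDir s)) (z - toC (ro i (base s))) =
      h (j - topDir s) (zeta (-i) * z) - hz (j - topDir s) (base s) := fun j => by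
    rw [map_sub, h_toC, hz_ro, h_zeta_mul]
    congr 2
    · congr 1; ring
    · congr 1; ring
  rw [← zero_sub (i + topDir s), hr, hr, hr]
  obtain ⟨τ, p, q⟩ := s
  cases τ
  · simp only [base, topDir, Bool.false_eq_true, if_false, show (0 : ZMod 6) - 4 = 2 by decide,
      show (5 : ZMod 6) - 4 = 1 by decide, show (4 : ZMod 6) - 4 = 0 by decide, h_one, h_two, h_five,
      hz_zero, hz_one, hz_two]
    push_cast
    constructor
    · rintro ⟨h1, h2, h3, h4⟩
      refine ⟨?_, ?_, ?_, ?_⟩ <;> linarith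
    · rintro ⟨h1, h2, h3, h4⟩
      refine ⟨?_, ?_, ?_, ?_⟩ <;> linarith
  · simp only [base, topDir, if_true, sub_zero, h_five, hz_zero, hz_four, hz_five]
    push_cast
    constructor
    · rintro ⟨h1, h2, h3, h4⟩
      refine ⟨?_, ?_, ?_, ?_⟩ <;> linarith
    · rintro ⟨h1, h2, h3, h4⟩
      refine ⟨?_, ?_, ?_, ?_⟩ <;> linarith

/-- The bounds of the first trapezoid. -/
def trapBound (s : State) (j : ZMod 6) : ℤ :=
  if s.1 then (![(s.2.1 : ℤ), s.2.1 - s.2.2, -s.2.1, s.2.2 - s.2.1, s.2.2, s.2.1 + s.2.2] :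
    Fin 6 → ℤ) j
  else (![(s.2.2 : ℤ), s.2.2 - s.2.1, -s.2.1, s.2.1 - s.2.2, s.2.1, s.2.1 + s.2.2] :
    Fin 6 → ℤ) j

theorem neck_region {s : State} (hs : s.Valid) (i : ZMod 6) :
    (neck s i).region = poly fun j => trapBound s (j + i) := by
  ext z
  have e : (z ∈ poly fun j => trapBound s (j + i)) ↔
      ∀ j, h j (zeta (-i) * z) ≤ trapBound s j := by
    simp only [poly, Set.mem_ofPred_eq, h_zeta_mul]
    constructor
    · intro H j
      have := H (j + -i)
      rwa [add_assoc, neg_add_cancel, add_zero] at this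
    · intro H j
      have := H (j + i)
      rwa [add_assoc, add_neg_cancel, add_zero] at this
  rw [e, neck_eq hs, mem_deepTrapezoid_region, forall_zmod_six]
  simp only [h_one, h_two, h_three, h_five]
  generalize zeta (-i) * z = w
  obtain ⟨τ, p, q⟩ := s
  cases τ
  · simp [trapBound]
    constructor
    · rintro ⟨h1, h2, h3, h4⟩
      refine ⟨?_, ?_, ?_, ?_, ?_, ?_⟩ <;> linarith
    · rintro ⟨h1, h2, h3, h4, h5, h6⟩
      refine ⟨?_, ?_, ?_, ?_⟩ <;> linarith
  · simp [trapBound]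
    intro h1
    constructor
    · rintro ⟨h2, h3, h4⟩
      refine ⟨?_, ?_, ?_, ?_, ?_⟩ <;> linarith
    · rintro ⟨h2, h3, h4, h5, h6⟩
      refine ⟨?_, ?_, ?_⟩ <;> linarith

/-- The condition for a face with barycenter `B / 3` to lie in the first trapezoid. -/
def InTrap (s : State) (B : ℤ × ℤ) : Prop := ∀ j, hz j B ≤ 3 * trapBound s j

theorem inTrap_ro_iff {s : State} {i : ZMod 6} {B : ℤ × ℤ} :
    InTrap s (ro (-i) B) ↔ ∀ j, hz j B ≤ 3 * trapBound s (j + i) := by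
  simp only [InTrap, hz_ro]
  constructor
  · intro H j
    have := H (j + i)
    rwa [add_neg_cancel_right] at this
  · intro H j
    have := H (j + -i)
    rwa [neg_add_cancel_right] at this

theorem inTrap_pos_iff {p q : ℕ} {B : ℤ × ℤ} : InTrap (true, p, q) B ↔
    B.1 ≤ 3 * p ∧ 3 * p ≤ B.1 + B.2 ∧ 3 * ((q : ℤ) - p) ≤ B.2 ∧ B.2 ≤ 3 * q := by
  rw [InTrap, forall_zmod_six]
  simp only [hz_zero, hz_one, hz_two, hz_three, hz_four, hz_five]
  simp [trapBound]
  omega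

theorem inTrap_neg_iff {p q : ℕ} {B : ℤ × ℤ} : InTrap (false, p, q) B ↔
    B.2 ≤ 3 * p ∧ 3 * p ≤ B.1 + B.2 ∧ 3 * ((q : ℤ) - p) ≤ B.1 ∧ B.1 ≤ 3 * q := by
  rw [InTrap, forall_zmod_six]
  simp only [hz_zero, hz_one, hz_two, hz_three, hz_four, hz_five]
  simp [trapBound]
  omega

theorem fac_subset_neck_iff {s : State} (hs : s.Valid) {v : ℤ × ℤ} {k i : ZMod 6} :
    (fac v k).1 ⊆ (neck s i).region ↔ InTrap s (ro (-i) (bary v k)) := by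
  rw [neck_region hs, inTrap_ro_iff]
  exact triangle_subset_poly_iff

/-! ### Vertices and sides -/

theorem neck_topLeft {s : State} (hs : s.Valid) (i : ZMod 6) :
    (neck s i).topLeft = toC (ro i (base s)) := by
  rw [neck_eq hs]; rfl

theorem neck_topRight {s : State} (hs : s.Valid) (i : ZMod 6) :
    (neck s i).topRight = toC (ro i (base s + (s.2.2 : ℤ) • unit (topDir s))) := by
  rw [neck_eq hs, toC_ro, toC_add, toC_smul, toC_unit]
  simp only [Trapezoid.topRight, deepTrapezoid, toC_ro, zeta_add]
  push_cast; ring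

theorem neck_bottomLeft {s : State} (hs : s.Valid) (i : ZMod 6) :
    (neck s i).bottomLeft = toC (ro i (base s + (s.2.1 : ℤ) • unit (topDir s + 5))) := by
  rw [neck_eq hs, toC_ro, toC_add, toC_smul, toC_unit]
  simp only [Trapezoid.bottomLeft, Trapezoid.topLeft, deepTrapezoid, toC_ro, zeta_add, α_inv]
  push_cast; ring

theorem neck_bottomRight {s : State} (hs : s.Valid) (i : ZMod 6) :
    (neck s i).bottomRight = toC (ro i (base s + (s.2.2 : ℤ) • unit (topDir s) +
      (s.2.1 : ℤ) • unit (topDir s + 4))) := by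
  rw [neck_eq hs, toC_ro, toC_add, toC_add, toC_smul, toC_smul, toC_unit, toC_unit]
  simp only [Trapezoid.bottomRight, Trapezoid.topRight, deepTrapezoid, toC_ro, α_inv, zeta_add]
  have h5 : zeta 5 * zeta 5 = zeta 4 := by
    rw [← zeta_add, show (5 : ZMod 6) + 5 = 4 by decide]
  push_cast
  linear_combination (s.2.1 * zeta i * zeta (topDir s)) * h5

theorem neck_topRight_pos {p q : ℕ} (hs : State.Valid (true, p, q)) (i : ZMod 6) :
    (neck (true, p, q) i).topRight = toC (ro i (p, q)) := by
  rw [neck_topRight hs]; congr 2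
  apply Prod.ext <;> simp [base, topDir]

theorem neck_bottomLeft_pos {p q : ℕ} (hs : State.Valid (true, p, q)) (i : ZMod 6) :
    (neck (true, p, q) i).bottomLeft = toC (ro i (2 * p - q, q - p)) := by
  rw [neck_bottomLeft hs]; congr 2
  apply Prod.ext <;> simp [base, topDir] <;> ring

theorem neck_bottomRight_pos {p q : ℕ} (hs : State.Valid (true, p, q)) (i : ZMod 6) :
    (neck (true, p, q) i).bottomRight = toC (ro i (p, q - p)) := by
  rw [neck_bottomRight hs]; congr 2
  apply Prod.ext <;> simp [base, topDir]; ring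

theorem neck_topRight_neg {p q : ℕ} (hs : State.Valid (false, p, q)) (i : ZMod 6) :
    (neck (false, p, q) i).topRight = toC (ro i (q, p - q)) := by
  rw [neck_topRight hs]; congr 2
  apply Prod.ext <;> simp [base, topDir]; ring

theorem neck_bottomLeft_neg {p q : ℕ} (hs : State.Valid (false, p, q)) (i : ZMod 6) :
    (neck (false, p, q) i).bottomLeft = toC (ro i (q - p, p)) := by
  rw [neck_bottomLeft hs]; congr 2
  apply Prod.ext <;> simp [base, topDir, show (4 : ZMod 6) + 5 = 3 by decide]; ring

theorem neck_bottomRight_neg {p q : ℕ} (hs : State.Valid (false, p, q)) (i : ZMod 6) :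
    (neck (false, p, q) i).bottomRight = toC (ro i (q - p, 2 * p - q)) := by
  rw [neck_bottomRight hs]; congr 2
  apply Prod.ext <;> simp [base, topDir, show (4 : ZMod 6) + 4 = 2 by decide] <;> ring

theorem neck_topLeft_pos {p q : ℕ} (hs : State.Valid (true, p, q)) (i : ZMod 6) :
    (neck (true, p, q) i).topLeft = toC (ro i (p - q, q)) := neck_topLeft hs i

theorem neck_topLeft_neg {p q : ℕ} (hs : State.Valid (false, p, q)) (i : ZMod 6) :
    (neck (false, p, q) i).topLeft = toC (ro i (q, p)) := neck_topLeft hs i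

theorem ro_succ (i : ZMod 6) (x y : ℤ) : ro (i + 1) (x, y) = ro i (-y, x + y) := by
  rw [← ro_ro]; rfl

theorem ro_pred (i : ZMod 6) (x y : ℤ) : ro (i - 1) (x, y) = ro i (x + y, -x) := by
  rw [sub_eq_add_neg, ← ro_ro, show (-1 : ZMod 6) = 5 by decide]; rfl

theorem eq_of_mem_inter {c : ZMod 6 → ℤ} {i : ZMod 6} {z : ℂ} {v : ℤ × ℤ}
    (h1 : z ∈ poly fun j => c (j + i)) (h2 : z ∈ poly fun j => c (j + (i + 1)))
    (H : ∀ w : ℂ, (∀ j, h j w ≤ c j ∧ h j w ≤ c (j + 1)) → w = toC v) : z = toC (ro i v) := by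
  rw [toC_ro, ← H (zeta (-i) * z), ← mul_assoc, zeta_mul_neg, one_mul]
  intro j
  rw [h_zeta_mul]
  have e1 := h1 (j + -i)
  have e2 := h2 (j + -i)
  simp only at e1 e2
  rw [neg_add_cancel_right] at e1
  rw [← add_assoc, neg_add_cancel_right] at e2
  exact ⟨e1, e2⟩

theorem neck_meet {s : State} (hs : s.Valid) (i : ZMod 6) :
    ∃ z, (neck s i).region ∩ (neck s (i + 1)).region = {z} ∧
    z ∈ (neck s i).vertices ∧ z ∈ (neck s (i + 1)).vertices := by
  have hmem : ∀ k, ∀ z ∈ (neck s k).vertices, z ∈ (neck s k).region := fun k z hz =>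
    subset_convexHull ℝ _ hz
  obtain ⟨z, hu, h1, h2⟩ : ∃ z, (∀ w ∈ (neck s i).region ∩ (neck s (i + 1)).region, w = z) ∧
      z ∈ (neck s i).vertices ∧ z ∈ (neck s (i + 1)).vertices := by
    rw [neck_region hs, neck_region hs]
    obtain ⟨τ, p, q⟩ := s
    cases τ
    · refine ⟨toC (ro i (q - p, p)), ?_, ?_, ?_⟩
      · rintro w ⟨hw1, hw2⟩
        refine eq_of_mem_inter hw1 hw2 fun z H => ?_
        rw [forall_zmod_six] at H
        simp only [h_one, h_two, h_three, h_five, zero_add,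
          show (1 : ZMod 6) + 1 = 2 by decide, show (2 : ZMod 6) + 1 = 3 by decide,
          show (3 : ZMod 6) + 1 = 4 by decide, show (4 : ZMod 6) + 1 = 5 by decide,
          show (5 : ZMod 6) + 1 = 0 by decide] at H
        simp [trapBound] at H
        apply ext_coords <;> rw [h_toC] <;> simp <;> linarith
      · rw [← neck_bottomLeft_neg hs]; simp [Trapezoid.vertices]
      · rw [show ((q : ℤ) - p, (p : ℤ)) = (-((p : ℤ) - q), (q : ℤ) + (p - q)) by
          apply Prod.ext <;> simp, ← ro_succ, ← neck_topRight_neg hs]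
        simp [Trapezoid.vertices]
    · refine ⟨toC (ro i (p - q, q)), ?_, ?_, ?_⟩
      · rintro w ⟨hw1, hw2⟩
        refine eq_of_mem_inter hw1 hw2 fun z H => ?_
        rw [forall_zmod_six] at H
        simp only [h_one, h_two, h_three, h_five, zero_add,
          show (1 : ZMod 6) + 1 = 2 by decide, show (2 : ZMod 6) + 1 = 3 by decide,
          show (3 : ZMod 6) + 1 = 4 by decide, show (4 : ZMod 6) + 1 = 5 by decide,
          show (5 : ZMod 6) + 1 = 0 by decide] at H
        simp [trapBound] at H
        apply ext_coords <;> rw [h_toC] <;> simp <;> linarith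
      · rw [← neck_topLeft_pos hs]; simp [Trapezoid.vertices]
      · rw [show ((p : ℤ) - q, (q : ℤ)) = (-((q : ℤ) - p), (p : ℤ) + (q - p)) by
          apply Prod.ext <;> simp, ← ro_succ, ← neck_bottomRight_pos hs]
        simp [Trapezoid.vertices]
  refine ⟨z, Set.Subset.antisymm (fun w hw => hu w hw) ?_, h1, h2⟩
  rintro w rfl
  exact ⟨hmem _ _ h1, hmem _ _ h2⟩

/-- If 2p ≤ q, the new trapezoid hangs at the bottom of an old one and shares a diagonal line with a
neighbor of it. Otherwise the orientation flips: its top is a diagonal side of an old trapezoid and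
one of its diagonal sides is the bottom of a neighbor. -/
theorem neck_isNext {s : State} (hs : s.Valid) (hs' : (nextState s).Valid) :
    IsNext (neck s) (neck (nextState s)) := by
  obtain ⟨τ, p, q⟩ := s
  have hpq : p ≤ q := hs.2
  intro i
  rw [nextState] at hs' ⊢
  simp only at hs' ⊢
  split_ifs at hs' ⊢ with h2 <;> cases τ
  · refine ⟨i, i + 1, Or.inl rfl, ?_, Or.inl ?_⟩
    · right; left
      simp only [Trapezoid.top, Trapezoid.bottom, neck_topLeft_neg hs', neck_topRight_neg hs',
        neck_bottomLeft_neg hs, neck_bottomRight_neg hs]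
      congr 3 <;> apply Prod.ext <;> simp <;> omega
    · right; right; right
      simp only [Set.mem_singleton_iff, Trapezoid.left, Trapezoid.right, neck_topLeft_neg hs',
        neck_bottomLeft_neg hs', neck_topRight_neg hs, neck_bottomRight_neg hs, ro_succ]
      congr 3 <;> apply Prod.ext <;> simp <;> omega
  · refine ⟨i, i - 1, Or.inr (by ring), ?_, Or.inr ?_⟩
    · right; left
      simp only [Trapezoid.top, Trapezoid.bottom, neck_topLeft_pos hs', neck_topRight_pos hs',
        neck_bottomLeft_pos hs, neck_bottomRight_pos hs]
      congr 3 <;> apply Prod.ext <;> simp <;> omega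
    · right; right; left
      simp only [Trapezoid.left, Trapezoid.right, neck_topRight_pos hs',
        neck_bottomRight_pos hs', neck_topLeft_pos hs, neck_bottomLeft_pos hs, ro_pred]
      congr 3 <;> apply Prod.ext <;> simp <;> omega
  · simp only [Bool.not_false] at hs' ⊢
    refine ⟨i + 1, i, Or.inr rfl, ?_, Or.inr ?_⟩
    · right; right; right
      simp only [Set.mem_singleton_iff, Trapezoid.top, Trapezoid.right, neck_topLeft_pos hs',
        neck_topRight_pos hs', neck_topRight_neg hs, neck_bottomRight_neg hs, ro_succ]
      rw [segment_symm]
      congr 3 <;> apply Prod.ext <;> simp <;> omega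
    · right; left
      simp only [Trapezoid.bottom, Trapezoid.right, neck_topRight_pos hs',
        neck_bottomRight_pos hs', neck_bottomLeft_neg hs, neck_bottomRight_neg hs]
      congr 3 <;> apply Prod.ext <;> simp <;> omega
  · simp only [Bool.not_true] at hs' ⊢
    refine ⟨i - 1, i, Or.inl (by ring), ?_, Or.inl ?_⟩
    · right; right; left
      simp only [Trapezoid.top, Trapezoid.left, neck_topLeft_neg hs',
        neck_topRight_neg hs', neck_topLeft_pos hs, neck_bottomLeft_pos hs, ro_pred]
      congr 3 <;> apply Prod.ext <;> simp <;> omega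
    · right; left
      simp only [Trapezoid.bottom, Trapezoid.left, neck_topLeft_neg hs',
        neck_bottomLeft_neg hs', neck_bottomLeft_pos hs, neck_bottomRight_pos hs]
      rw [segment_symm]
      congr 3 <;> apply Prod.ext <;> simp <;> omega

/-! ### Star polygons -/

/-- The faces with barycenter `B / 3` in the star polygon whose tips are the rotations of `v`. -/
def InStar (v B : ℤ × ℤ) : Prop :=
  ∀ i, ¬(3 * v.2 ≤ hz (i + 4) B ∧ 3 * v.1 ≤ hz (i + 5) B)

theorem inStar_ro {v B : ℤ × ℤ} (k : ZMod 6) : InStar v (ro k B) ↔ InStar v B := by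
  simp only [InStar, hz_ro]
  constructor
  · intro H i
    have := H (i - k)
    rwa [show i - k + 4 + k = i + 4 by ring, show i - k + 5 + k = i + 5 by ring] at this
  · intro H i
    have := H (i + k)
    rwa [show i + k + 4 = i + 4 + k by ring, show i + k + 5 = i + 5 + k by ring] at this

theorem inStar_iff {v B : ℤ × ℤ} : InStar v B ↔
    ¬(3 * v.2 ≤ B.2 ∧ 3 * v.1 ≤ B.1 + B.2) ∧ ¬(3 * v.2 ≤ B.1 + B.2 ∧ 3 * v.1 ≤ B.1) ∧
    ¬(3 * v.2 ≤ B.1 ∧ 3 * v.1 ≤ -B.2) ∧ ¬(3 * v.2 ≤ -B.2 ∧ 3 * v.1 ≤ -B.1 - B.2) ∧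
    ¬(3 * v.2 ≤ -B.1 - B.2 ∧ 3 * v.1 ≤ -B.1) ∧ ¬(3 * v.2 ≤ -B.1 ∧ 3 * v.1 ≤ B.2) := by
  rw [InStar, forall_zmod_six]
  rfl

theorem isBary_ro {B : ℤ × ℤ} (hB : IsBary B) (i : ZMod 6) : IsBary (ro i B) := by
  obtain ⟨h1, h2⟩ := hB
  revert i
  rw [forall_zmod_six]
  simp only [IsBary, ro, hz_zero, hz_one, hz_two, hz_three, hz_four, zero_add,
    show (1 : ZMod 6) + 4 = 5 by decide, show (2 : ZMod 6) + 4 = 0 by decide,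
    show (3 : ZMod 6) + 4 = 1 by decide, show (4 : ZMod 6) + 4 = 2 by decide,
    show (5 : ZMod 6) + 4 = 3 by decide, hz_five]
  omega

/-- The flip of orientation is arranged so that both branches give the same formula. Up to rotation,
the new tip is the reentrant corner of the old star, that is, the apex of one of the cones in
`InStar`. -/
theorem tip_nextState {s : State} (hs : s.2.1 ≤ s.2.2) :
    tip (nextState s) = if s.1 then ((s.2.1 : ℤ), (s.2.2 : ℤ) - s.2.1)
      else ((s.2.2 : ℤ) - s.2.1, (s.2.1 : ℤ)) := by
  obtain ⟨τ, p, q⟩ := s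
  simp only at hs
  rw [nextState]
  split_ifs with h1 h2 h2 <;> simp only at h1 h2 <;> simp [tip, h2, Nat.cast_sub hs]

theorem InStar.of_next {s : State} (hs : s.2.1 ≤ s.2.2) {B : ℤ × ℤ}
    (H : InStar (tip (nextState s)) B) : InStar (tip s) B := by
  rw [tip_nextState hs] at H
  intro i hi
  apply H i
  obtain ⟨τ, p, q⟩ := s
  simp only [tip] at hi hs ⊢
  cases τ <;> simp at hi ⊢ <;> omega

/-- Together with `exists_inTrap` and `inTrap_unique` this says that the necklace fills the star of
s minus the star of the next state, without overlap. -/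
theorem InTrap.inStar {s : State} (hs : s.Valid) {B : ℤ × ℤ} (hB : IsBary B) (H : InTrap s B) :
    InStar (tip s) B ∧ ¬InStar (tip (nextState s)) B := by
  rw [tip_nextState hs.2]
  obtain ⟨τ, p, q⟩ := s
  obtain ⟨hp, hpq⟩ := hs
  obtain ⟨b1, b2⟩ := hB
  simp only at hp hpq
  cases τ
  · rw [inTrap_neg_iff] at H
    simp only [tip, Bool.false_eq_true, if_false]
    constructor
    · rw [inStar_iff]; simp only
      refine ⟨?_, ?_, ?_, ?_, ?_, ?_⟩ <;> omega
    · intro H2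
      rw [inStar_iff] at H2
      simp only at H2
      omega
  · rw [inTrap_pos_iff] at H
    simp only [tip, if_true]
    constructor
    · rw [inStar_iff]; simp only
      refine ⟨?_, ?_, ?_, ?_, ?_, ?_⟩ <;> omega
    · intro H2
      rw [inStar_iff] at H2
      simp only at H2
      omega

/-- A face outside the inner star lies in one of its six outer cones. What the outer star leaves of
that cone is a trapezoid; in negative orientation its index is shifted by one. -/
theorem exists_inTrap {s : State} (hs : s.Valid) {B : ℤ × ℤ}
    (H : InStar (tip s) B) (H' : ¬InStar (tip (nextState s)) B) :
    ∃ i, InTrap s (ro (-i) B) := by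
  rw [tip_nextState hs.2] at H'
  rw [InStar] at H'
  push Not at H'
  obtain ⟨i, h1, h2⟩ := H'
  obtain ⟨τ, p, q⟩ := s
  obtain ⟨hp, hpq⟩ := hs
  simp only at hp hpq
  cases τ
  · refine ⟨-(i - 1), ?_⟩
    rw [neg_neg]
    have H2 := (inStar_ro (i - 1)).2 H
    have e1 : hz (i + 4) B = (ro (i - 1) B).1 + (ro (i - 1) B).2 := by
      rw [← hz_five, hz_ro]; congr 1; ring
    have e2 : hz (i + 5) B = (ro (i - 1) B).1 := by
      rw [← hz_zero, hz_ro]; congr 1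
      have : (6 : ZMod 6) = 0 := by decide
      linear_combination this
    rw [e1] at h1
    rw [e2] at h2
    rw [inTrap_neg_iff]
    rw [inStar_iff] at H2
    simp [tip] at h1 h2 H2 ⊢
    omega
  · refine ⟨-i, ?_⟩
    rw [neg_neg]
    have H2 := (inStar_ro i).2 H
    have e1 : hz (i + 4) B = (ro i B).2 := by rw [← hz_four, hz_ro, add_comm]
    have e2 : hz (i + 5) B = (ro i B).1 + (ro i B).2 := by rw [← hz_five, hz_ro, add_comm]
    rw [e1] at h1
    rw [e2] at h2
    rw [inTrap_pos_iff]
    rw [inStar_iff] at H2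
    simp [tip] at h1 h2 H2 ⊢
    omega

theorem inTrap_unique {s : State} (hs : s.Valid) {B : ℤ × ℤ} (hB : IsBary B) {i j : ZMod 6}
    (hi : InTrap s (ro (-i) B)) (hj : InTrap s (ro (-j) B)) : i = j := by
  suffices H : ∀ B, IsBary B → InTrap s B → ∀ k, InTrap s (ro k B) → k = 0 by
    have h1 := H _ (isBary_ro hB (-i)) hi (i - j) (by
      rw [ro_ro, show i - j + -i = -j by ring]; exact hj)
    exact sub_eq_zero.1 h1
  clear hi hj hB B
  intro B hB H k
  obtain ⟨τ, p, q⟩ := s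
  obtain ⟨hp, hpq⟩ := hs
  obtain ⟨b1, b2⟩ := hB
  simp only at hp hpq
  have e : (1 : ZMod 6) + 4 = 5 ∧ (2 : ZMod 6) + 4 = 0 ∧ (3 : ZMod 6) + 4 = 1 ∧
      (4 : ZMod 6) + 4 = 2 ∧ (5 : ZMod 6) + 4 = 3 := by decide
  cases τ
  · rw [inTrap_neg_iff] at H ⊢
    revert k
    rw [forall_zmod_six]
    simp only [ro, e, hz_zero, hz_one, hz_two, hz_three, hz_four, hz_five]
    refine ⟨fun _ => trivial, ?_, ?_, ?_, ?_, ?_⟩ <;> intro h1 <;> exfalso <;> omega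
  · rw [inTrap_pos_iff] at H ⊢
    revert k
    rw [forall_zmod_six]
    simp only [ro, e, hz_zero, hz_one, hz_two, hz_three, hz_four, hz_five]
    refine ⟨fun _ => trivial, ?_, ?_, ?_, ?_, ?_⟩ <;> intro h1 <;> exfalso <;> omega

/-- The conditions on a state that are preserved by `nextState`. -/
def State.Good (s : State) : Prop := s.2.1 ≤ s.2.2 ∧ Nat.Coprime s.2.1 s.2.2

theorem State.Good.next {s : State} (hs : s.Good) : (nextState s).Good := by
  obtain ⟨τ, p, q⟩ := s
  obtain ⟨h1, h2⟩ := hs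
  simp only at h1 h2
  rw [nextState]
  split_ifs with h
  · exact ⟨by simp only at h ⊢; omega, (Nat.coprime_sub_self_right h1).2 h2⟩
  · exact ⟨by simp only at h ⊢; omega, ((Nat.coprime_sub_self_right h1).2 h2).symm⟩

theorem State.Good.iterate {s : State} (hs : s.Good) (k : ℕ) : (nextState^[k] s).Good := by
  induction k with
  | zero => exact hs
  | succ k ih => rw [Function.iterate_succ_apply']; exact ih.next

theorem State.Good.eq_one {s : State} (hs : s.Good) (h0 : s.2.1 = 0) : s.2.2 = 1 := by
  have := hs.2
  rw [h0] at this
  simpa using this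

/-- When p reaches 0, coprimality forces q = 1, and the star is the unit hexagon. -/
theorem inStar_core_iff {s : State} (hs : s.Good) (h0 : s.2.1 = 0) {B : ℤ × ℤ} (hB : IsBary B) :
    InStar (tip s) B ↔ ∃ i, B = delta i := by
  have h1 := hs.eq_one h0
  obtain ⟨τ, p, q⟩ := s
  obtain ⟨x, y⟩ := B
  obtain ⟨b1, b2⟩ := hB
  simp only at h0 h1 b1 b2
  subst h0 h1
  rw [inStar_iff, exists_zmod_six]
  simp only [delta_zero, delta_one, delta_two, delta_three, delta_four, delta_five, Prod.mk.injEq]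
  constructor
  · intro H
    have hx : -2 ≤ x ∧ x ≤ 2 ∧ -2 ≤ y ∧ y ≤ 2 := by
      cases τ <;> simp [tip] at H <;> refine ⟨?_, ?_, ?_, ?_⟩ <;> by_contra! h <;> omega
    obtain ⟨hx1, hx2, hy1, hy2⟩ := hx
    cases τ <;> simp [tip] at H <;> interval_cases x <;> interval_cases y <;> simp_all
  · rintro (⟨rfl, rfl⟩ | ⟨rfl, rfl⟩ | ⟨rfl, rfl⟩ | ⟨rfl, rfl⟩ | ⟨rfl, rfl⟩ | ⟨rfl, rfl⟩) <;>
      cases τ <;> simp [tip]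

theorem InStar.antitone {s : State} (hs : s.Good) {B : ℤ × ℤ} {k l : ℕ} (hkl : k ≤ l)
    (H : InStar (tip (nextState^[l] s)) B) : InStar (tip (nextState^[k] s)) B := by
  induction l, hkl using Nat.le_induction with
  | base => exact H
  | succ l _ ih =>
    rw [Function.iterate_succ_apply'] at H
    exact ih (H.of_next (hs.iterate l).1)

/-! ### Flowers -/

theorem neck_isNecklace {s : State} (hs : s.Valid) (hg : s.Good) : IsNecklace (neck s) where
  primitive i := by
    rw [neck_eq hs]
    exact hg.2
  disjoint i j hij := by
    rw [Set.disjoint_left]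
    intro z h1 h2
    rw [neck_region hs] at h1 h2
    obtain ⟨v, k, h3, h4⟩ := exists_face_of_mem_interior_poly h1 h2
    exact hij (inTrap_unique hs (isBary_bary v k) (inTrap_ro_iff.2 h3) (inTrap_ro_iff.2 h4))
  meet := neck_meet hs
  rotate i := by
    rw [neck_eq hs, neck_eq hs]
    simp only [deepTrapezoid, toC_ro, zeta_add, zeta_one]
    refine ⟨?_, ?_, trivial, trivial⟩ <;> ring

/-- The sequence of states from `s` stops after exactly `n` steps. -/
def IsRun (s : State) (n : ℕ) : Prop :=
  (∀ k < n, 0 < (nextState^[k] s).2.1) ∧ (nextState^[n] s).2.1 = 0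

theorem IsRun.valid {s : State} {n k : ℕ} (hr : IsRun s n) (hs : s.Good) (hk : k < n) :
    (nextState^[k] s).Valid := ⟨hr.1 k hk, (hs.iterate k).1⟩

/-! ### The convex hull of the flower -/

theorem zeta_mul_mem_hexagon {β z : ℂ} (i : ZMod 6) (hβ : β ≠ 0) (hz : z ∈ hexagon β) :
    zeta i * z ∈ hexagon β := by
  rw [mem_hexagon hβ] at hz ⊢
  intro j
  rw [mul_div_assoc, h_zeta_mul]
  exact hz _

theorem tip_ne_zero {s : State} (hs : s.Good) : tip s ≠ 0 := by
  obtain ⟨τ, p, q⟩ := s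
  obtain ⟨h1, h2⟩ := hs
  simp only at h1 h2
  have : q ≠ 0 := by
    rintro rfl
    have : p = 0 := by omega
    subst this
    simp at h2
  intro h
  cases τ <;> simp [tip] at h <;> omega

theorem mem_hexagon_of_sq {s : State} (hs : s.Good) {w : ℤ × ℤ}
    (H : ∀ i, hz i (conjMul (tip s) w) ≤ nrm (tip s)) : toC w ∈ hexagon (toC (tip s)) :=
  (toC_mem_hexagon_iff (tip_ne_zero hs)).2 H

theorem tip_nextState_mem_hexagon {s : State} (hs : s.Good) :
    toC (tip (nextState s)) ∈ hexagon (toC (tip s)) := by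
  apply mem_hexagon_of_sq hs
  rw [tip_nextState hs.1, forall_zmod_six]
  obtain ⟨τ, p, q⟩ := s
  have h1 : (p : ℤ) ≤ q := by exact_mod_cast hs.1
  have h2 : (p : ℤ) * p ≤ p * q := mul_le_mul_of_nonneg_left h1 (by positivity)
  have h3 : (p : ℤ) * q ≤ q * q := mul_le_mul_of_nonneg_right h1 (by positivity)
  have h4 : (0 : ℤ) ≤ p * p := by positivity
  simp only [hz_zero, hz_one, hz_two, hz_three, hz_four, hz_five, conjMul, nrm]
  cases τ <;> simp only [tip, if_true, if_false, Bool.false_eq_true] <;>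
    refine ⟨?_, ?_, ?_, ?_, ?_, ?_⟩ <;> linarith

theorem neck_region_subset {s : State} (hs : s.Good) (hv : s.Valid) (i : ZMod 6) :
    (neck s i).region ⊆ hexagon (toC (tip s)) := by
  have hb := toC_ne_zero.2 (tip_ne_zero hs)
  apply convexHull_min _ (convex_convexHull ℝ _)
  suffices H : ∀ w, (neck s i).vertices ⊆ {z | z ∈ hexagon (toC (tip s))} by
    exact H 0
  intro _
  obtain ⟨τ, p, q⟩ := s
  have key : ∀ w, (∀ i, hz i (conjMul (tip (τ, p, q)) w) ≤ nrm (tip (τ, p, q))) →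
      toC (ro i w) ∈ hexagon (toC (tip (τ, p, q))) := by
    intro w hw
    rw [toC_ro]
    exact zeta_mul_mem_hexagon i hb (mem_hexagon_of_sq hs hw)
  have h1 : (p : ℤ) ≤ q := by exact_mod_cast hs.1
  have h2 : (p : ℤ) * p ≤ p * q := mul_le_mul_of_nonneg_left h1 (by positivity)
  have h3 : (p : ℤ) * q ≤ q * q := mul_le_mul_of_nonneg_right h1 (by positivity)
  have h4 : (0 : ℤ) ≤ p * p := by positivity
  rintro z (rfl | rfl | rfl | rfl) <;> cases τ
  · rw [neck_topLeft_neg hv]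
    apply key
    rw [forall_zmod_six]
    simp only [hz_zero, hz_one, hz_two, hz_three, hz_four, hz_five, conjMul, nrm, tip,
      Bool.false_eq_true, if_false]
    refine ⟨?_, ?_, ?_, ?_, ?_, ?_⟩ <;> linarith
  · rw [neck_topLeft_pos hv]
    apply key
    rw [forall_zmod_six]
    simp only [hz_zero, hz_one, hz_two, hz_three, hz_four, hz_five, conjMul, nrm, tip, if_true]
    refine ⟨?_, ?_, ?_, ?_, ?_, ?_⟩ <;> linarith
  · rw [neck_topRight_neg hv]
    apply key
    rw [forall_zmod_six]
    simp only [hz_zero, hz_one, hz_two, hz_three, hz_four, hz_five, conjMul, nrm, tip,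
      Bool.false_eq_true, if_false]
    refine ⟨?_, ?_, ?_, ?_, ?_, ?_⟩ <;> linarith
  · rw [neck_topRight_pos hv]
    apply key
    rw [forall_zmod_six]
    simp only [hz_zero, hz_one, hz_two, hz_three, hz_four, hz_five, conjMul, nrm, tip, if_true]
    refine ⟨?_, ?_, ?_, ?_, ?_, ?_⟩ <;> linarith
  · rw [neck_bottomLeft_neg hv]
    apply key
    rw [forall_zmod_six]
    simp only [hz_zero, hz_one, hz_two, hz_three, hz_four, hz_five, conjMul, nrm, tip,
      Bool.false_eq_true, if_false]
    refine ⟨?_, ?_, ?_, ?_, ?_, ?_⟩ <;> linarith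
  · rw [neck_bottomLeft_pos hv]
    apply key
    rw [forall_zmod_six]
    simp only [hz_zero, hz_one, hz_two, hz_three, hz_four, hz_five, conjMul, nrm, tip, if_true]
    refine ⟨?_, ?_, ?_, ?_, ?_, ?_⟩ <;> linarith
  · rw [neck_bottomRight_neg hv]
    apply key
    rw [forall_zmod_six]
    simp only [hz_zero, hz_one, hz_two, hz_three, hz_four, hz_five, conjMul, nrm, tip,
      Bool.false_eq_true, if_false]
    refine ⟨?_, ?_, ?_, ?_, ?_, ?_⟩ <;> linarith
  · rw [neck_bottomRight_pos hv]
    apply key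
    rw [forall_zmod_six]
    simp only [hz_zero, hz_one, hz_two, hz_three, hz_four, hz_five, conjMul, nrm, tip, if_true]
    refine ⟨?_, ?_, ?_, ?_, ?_, ?_⟩ <;> linarith

theorem hexagon_subset_of_mem {β γ : ℂ} (hγ : γ ≠ 0) (H : β ∈ hexagon γ) :
    hexagon β ⊆ hexagon γ := by
  apply convexHull_min _ (convex_convexHull ℝ _)
  rintro _ ⟨i, rfl⟩
  rw [← zeta_natCast]
  exact zeta_mul_mem_hexagon _ hγ H

theorem hexagon_iterate_subset {s : State} (hs : s.Good) (k : ℕ) :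
    hexagon (toC (tip (nextState^[k] s))) ⊆ hexagon (toC (tip s)) := by
  induction k with
  | zero => exact subset_rfl
  | succ k ih =>
    rw [Function.iterate_succ_apply']
    refine (hexagon_subset_of_mem ?_ (tip_nextState_mem_hexagon (hs.iterate k))).trans ih
    exact toC_ne_zero.2 (tip_ne_zero (hs.iterate k))

theorem mem_flower {n : ℕ} {X : ℕ → ZMod 6 → Trapezoid} {z : ℂ} : z ∈ flower n X ↔
    (∃ k < n, ∃ i, z ∈ (X k i).region) ∨ ∃ i, z ∈ triangle (toC 0) (zeta i) := by
  simp only [flower, Set.mem_union, Set.mem_iUnion, core_eq, exists_prop]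
  refine or_congr Iff.rfl ⟨fun ⟨i, _, hi⟩ => ⟨_, hi⟩, fun ⟨i, hi⟩ => ⟨i.val, i.val_lt, ?_⟩⟩
  rwa [ZMod.natCast_val, ZMod.cast_id]

theorem exists_tip_eq_zeta {s : State} (hs : s.Good) (h0 : s.2.1 = 0) :
    ∃ k, toC (tip s) = zeta k := by
  have h1 := hs.eq_one h0
  obtain ⟨τ, p, q⟩ := s
  simp only at h0 h1
  subst h0 h1
  cases τ
  · exact ⟨0, by rw [← toC_unit]; simp [tip]⟩
  · exact ⟨1, by rw [← toC_unit]; simp [tip]⟩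

theorem flower_subset_hexagon {s : State} {n : ℕ} (hs : s.Good) (hr : IsRun s n) :
    flower n (fun k => neck (nextState^[k] s)) ⊆ hexagon (toC (tip s)) := by
  intro z hz
  rcases mem_flower.1 hz with ⟨k, hk, i, hi⟩ | ⟨i, hi⟩
  · exact hexagon_iterate_subset hs k
      (neck_region_subset (hs.iterate k) (hr.valid hs hk) i hi)
  · apply hexagon_iterate_subset hs n
    obtain ⟨k, hk⟩ := exists_tip_eq_zeta (hs.iterate n) hr.2
    rw [hk, ← mul_one (zeta k), hexagon_zeta_mul, mem_hexagon_one]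
    exact h_le_of_mem_core hi

theorem tip_mem_flower {s : State} {n : ℕ} (hs : s.Good) (hr : IsRun s n) (i : ZMod 6) :
    zeta i * toC (tip s) ∈ flower n (fun k => neck (nextState^[k] s)) := by
  rw [mem_flower]
  rcases Nat.eq_zero_or_pos n with rfl | hn
  · right
    obtain ⟨k, hk⟩ := exists_tip_eq_zeta hs hr.2
    refine ⟨i + k, subset_convexHull ℝ _ ?_⟩
    rw [hk, zeta_add, toC_zero]; simp
  · left
    have hv : s.Valid := hr.valid hs hn
    refine ⟨0, hn, i, subset_convexHull ℝ _ ?_⟩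
    rw [← toC_ro]
    obtain ⟨τ, p, q⟩ := s
    cases τ
    · exact Or.inl (neck_topLeft_neg hv i).symm
    · exact Or.inr (Or.inl (neck_topRight_pos hv i).symm)

theorem convexHull_flower {s : State} {n : ℕ} (hs : s.Good) (hr : IsRun s n) :
    convexHull ℝ (flower n fun k => neck (nextState^[k] s)) = hexagon (toC (tip s)) := by
  apply Set.Subset.antisymm
  · exact convexHull_min (flower_subset_hexagon hs hr) (convex_convexHull ℝ _)
  · apply convexHull_mono
    rintro _ ⟨i, rfl⟩
    rw [← zeta_natCast]
    exact tip_mem_flower hs hr i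

theorem inStar_of_core {s : State} {n : ℕ} (hs : s.Good) (hr : IsRun s n) {B : ℤ × ℤ} {i : ZMod 6}
    (hB : B = delta i) {k : ℕ} (hk : k ≤ n) : InStar (tip (nextState^[k] s)) B := by
  refine InStar.antitone hs hk ((inStar_core_iff (hs.iterate n) hr.2 ?_).2 ⟨i, hB⟩)
  have := isBary_bary 0 i
  rwa [bary, smul_zero, zero_add, ← hB] at this

theorem bary_zero (i : ZMod 6) : bary 0 i = delta i := by
  rw [bary, smul_zero, zero_add]

/-- Opposite bounds of a face have a constant sum, so an inequality in one direction is the reverse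
inequality in the opposite one. -/
theorem eq_of_faceBound_le {v w : ℤ × ℤ} {i j : ZMod 6}
    (H : ∀ k, faceBound v i k ≤ faceBound w j k) : bary v i = bary w j := by
  rw [← triangle_inj, triangle_eq_poly, triangle_eq_poly]
  refine (poly_subset_iff.2 H).antisymm (poly_subset_iff.2 fun k => ?_)
  have := H (k + 3)
  rw [faceBound_add_three, faceBound_add_three] at this
  linarith

theorem isFlower {s : State} {n : ℕ} (hs : s.Good) (hr : IsRun s n) :
    IsFlower (toC (tip s)) n fun k => neck (nextState^[k] s) where
  necklace k hk := neck_isNecklace (hr.valid hs hk) (hs.iterate k)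
  next k hk := by
    have h2 := hr.valid hs hk
    simp only [Function.iterate_succ_apply'] at h2 ⊢
    exact neck_isNext (hr.valid hs (by omega)) h2
  innermost k hk i := by
    have hv := hr.valid hs (show k < n by omega)
    have hg := hs.iterate k
    have h0 := hr.2
    rw [← hk, Function.iterate_succ_apply', nextState] at h0
    rw [neck_eq hv]
    simp only [Trapezoid.aspect, deepTrapezoid]
    -- A subtraction without flip keeps p positive, so the run can only end with a flip where q - p
    -- = 0.
    have : (nextState^[k] s).2.1 = (nextState^[k] s).2.2 := by
      have h1 := hv.1
      have h2 := hv.2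
      split_ifs at h0 with h3
      · simp only at h0; omega
      · simp only at h0; omega
    rw [this]
    have : ((nextState^[k] s).2.2 : ℚ) ≠ 0 := by
      have := lt_of_lt_of_le hv.1 hv.2
      exact_mod_cast this.ne'
    exact div_self this
  disjoint := by
    have key : ∀ k < n, ∀ l < n, k < l → ∀ i j,
        Disjoint (interior (neck (nextState^[k] s) i).region)
          (interior (neck (nextState^[l] s) j).region) := by
      intro k hk l hl hkl i j
      have hvk := hr.valid hs hk
      have hvl := hr.valid hs hl
      rw [Set.disjoint_left]
      intro z h1 h2
      rw [neck_region hvk] at h1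
      rw [neck_region hvl] at h2
      obtain ⟨v, m, h3, h4⟩ := exists_face_of_mem_interior_poly h1 h2
      have b := isBary_bary v m
      have t1 := ((inTrap_ro_iff.2 h3).inStar hvk (isBary_ro b _)).2
      have t2 := ((inTrap_ro_iff.2 h4).inStar hvl (isBary_ro b _)).1
      rw [inStar_ro] at t1 t2
      rw [← Function.iterate_succ_apply' nextState] at t1
      exact t1 (t2.antitone hs hkl)
    intro k hk l hl hkl i j
    rcases lt_or_gt_of_ne hkl with h | h
    · exact key k hk l hl h i j
    · exact (key l hl k hk h j i).symm
  disjoint_core k hk i j := by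
    have hvk := hr.valid hs hk
    rw [Set.disjoint_left]
    intro z h1 h2
    rw [neck_region hvk] at h1
    rw [core_eq, triangle_eq_poly] at h2
    obtain ⟨v, m, h3, h4⟩ := exists_face_of_mem_interior_poly h1 h2
    have b := isBary_bary v m
    have t1 := ((inTrap_ro_iff.2 h3).inStar hvk (isBary_ro b _)).2
    rw [inStar_ro, ← Function.iterate_succ_apply' nextState] at t1
    refine t1 (inStar_of_core hs hr (i := j) ?_ hk)
    rw [← bary_zero]
    exact eq_of_faceBound_le (faceBound_le_iff.2 h4)
  hull := convexHull_flower hs hr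

/-! ### Aspect ratios and the slow Gauss map -/

theorem slowGauss_aspect {s : State} (hs : s.Valid) :
    slowGauss ((s.2.1 : ℚ) / s.2.2) = ((nextState s).2.1 : ℚ) / (nextState s).2.2 := by
  obtain ⟨τ, p, q⟩ := s
  obtain ⟨h1, h2⟩ := hs
  simp only at h1 h2
  have hp : (0 : ℚ) < p := by exact_mod_cast h1
  have hpq : (p : ℚ) ≤ q := by exact_mod_cast h2
  have hq : (0 : ℚ) < q := hp.trans_le hpq
  unfold slowGauss nextState
  simp only
  split_ifs with h3 h4 h4
  · rw [div_le_div_iff₀ two_pos hq, one_mul] at h3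
    have h5 : (2 * p : ℚ) ≤ q := by exact_mod_cast h4
    simp only
    -- The case distinctions of `slowGauss` and `nextState` differ only at the ratio 1/2, where both
    -- rules give the value 1. By keeping the orientation there, `nextState` adds one more stripe,
    -- in accordance with a last partial quotient of at least 2.
    have h6 : q = 2 * p := by
      have : (q : ℚ) = 2 * p := by linarith
      exact_mod_cast this
    subst h6
    rw [show 2 * p - p = p by omega]
    push_cast
    field_simp
    norm_num
  · simp only
    push_cast [h2]
    field_simp
  · simp only
    have h5 : p < q := by omega
    have h6 : (p : ℚ) < q := by exact_mod_cast h5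
    push_cast [h2]
    have h7 : (q : ℚ) - p ≠ 0 := by linarith
    field_simp
  · exfalso
    apply h3
    rw [div_le_div_iff₀ two_pos hq, one_mul]
    have : q ≤ p * 2 := by omega
    exact_mod_cast this

theorem iterate_slowGauss {s : State} {n : ℕ} (hs : s.Good) (hr : IsRun s n) {k : ℕ} (hk : k ≤ n) :
    slowGauss^[k] ((s.2.1 : ℚ) / s.2.2) =
      ((nextState^[k] s).2.1 : ℚ) / (nextState^[k] s).2.2 := by
  induction k with
  | zero => rfl
  | succ k ih =>
    rw [Function.iterate_succ_apply', ih (by omega), slowGauss_aspect (hr.valid hs hk),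
      Function.iterate_succ_apply']

theorem neck_aspect {s : State} (hs : s.Valid) (i : ZMod 6) :
    (neck s i).aspect = (s.2.1 : ℚ) / s.2.2 := by
  rw [neck_eq hs]; rfl

/-! ### Stripes -/

/-- Sides are mere point sets, so their lengths are recovered as diameters. This is needed to show
that certain sides are different. -/
theorem Trapezoid.diam_top (Y : Trapezoid) : Metric.diam Y.top = Y.topLen := by
  have hd : ‖Y.dir‖ = 1 := Complex.norm_eq_one_of_pow_eq_one Y.dir_pow (by norm_num)
  rw [top, ← convexHull_pair, convexHull_diam, Metric.diam_pair, dist_comm, dist_eq_norm, topRight,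
    topLeft, add_sub_cancel_left, norm_mul, hd, mul_one, Complex.norm_natCast]

theorem Trapezoid.diam_bottom (Y : Trapezoid) : Metric.diam Y.bottom = Y.topLen - Y.diag := by
  have hd : ‖Y.dir‖ = 1 := Complex.norm_eq_one_of_pow_eq_one Y.dir_pow (by norm_num)
  have e : Y.bottomRight - Y.bottomLeft = ((Y.topLen - Y.diag : ℕ) : ℂ) * Y.dir := by
    rw [Nat.cast_sub Y.diag_le, bottomRight, bottomLeft, topRight, topLeft, α_inv, zeta_five]
    linear_combination (Y.diag * Y.dir) * α_sq
  rw [bottom, ← convexHull_pair, convexHull_diam, Metric.diam_pair, dist_comm, dist_eq_norm, e,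
    norm_mul, hd, mul_one, Complex.norm_natCast, Nat.cast_sub Y.diag_le]

theorem neck_bottom_eq_top {τ : Bool} {p q : ℕ} (h0 : 0 < p) (hq : 2 * p ≤ q) (i : ZMod 6) :
    (neck (τ, p, q) i).bottom = (neck (τ, p, q - p) i).top := by
  have h1 : State.Valid (τ, p, q) := ⟨h0, by simp only; omega⟩
  have h2 : State.Valid (τ, p, q - p) := ⟨h0, by simp only; omega⟩
  rw [Trapezoid.bottom, Trapezoid.top]
  cases τ
  · rw [neck_bottomLeft_neg h1, neck_bottomRight_neg h1, neck_topLeft_neg h2, neck_topRight_neg h2]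
    congr 4 <;> omega
  · rw [neck_bottomLeft_pos h1, neck_bottomRight_pos h1, neck_topLeft_pos h2, neck_topRight_pos h2]
    congr 4 <;> omega

theorem exists_stripe {p q y : ℝ} {m : ℕ} (hm : 0 < m) (h1 : q - m * p ≤ y) (h2 : y ≤ q) :
    ∃ s < m, q - s * p - p ≤ y ∧ y ≤ q - s * p := by
  induction m with
  | zero => omega
  | succ m ih =>
    rcases Nat.eq_zero_or_pos m with rfl | hm0
    · exact ⟨0, one_pos, by push_cast at h1 ⊢; linarith, by simpa using h2⟩
    by_cases h3 : q - m * p ≤ y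
    · obtain ⟨s, hs, h4⟩ := ih hm0 h3
      exact ⟨s, by omega, h4⟩
    · push Not at h3
      exact ⟨m, by omega, by push_cast at h1; linarith, h3.le⟩

/-- The two bounds given by the diagonal sides depend on p only and are common to all stripes; the
remaining coordinate is cut into intervals of length p. -/
theorem deepTrapezoid_region_eq {τ : Bool} {p q m : ℕ} (h0 : 0 < p) (hm : 0 < m) (hq : m * p ≤ q)
    (hd : 0 < m * p ∧ m * p ≤ q) (i : ZMod 6) :
    (deepTrapezoid (τ, p, q) (m * p) hd i).region =
      ⋃ s < m, (neck (τ, p, q - s * p) i).region := by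
  have hle : ∀ s < m, s * p + p ≤ q := fun s hs => by
    have : (s + 1) * p ≤ m * p := Nat.mul_le_mul_right p hs
    linarith
  have hv : ∀ s < m, State.Valid (τ, p, q - s * p) := fun s hs =>
    ⟨h0, by have := hle s hs; simp only; omega⟩
  have hp : (0 : ℝ) ≤ p := by positivity
  have hs1 : ∀ s < m, (0 : ℝ) ≤ s * p ∧ (s * p + p : ℝ) ≤ m * p := fun s hs => by
    refine ⟨by positivity, ?_⟩
    have : (s + 1) * p ≤ m * p := Nat.mul_le_mul_right p hs
    have : ((s + 1) * p : ℝ) ≤ m * p := by exact_mod_cast this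
    linarith
  ext z
  simp only [Set.mem_iUnion, exists_prop, mem_deepTrapezoid_region (s := (τ, p, q)) hd]
  constructor
  · intro H
    cases τ
    · simp only [Bool.false_eq_true, if_false] at H
      push_cast at H
      obtain ⟨s, hs, h3, h4⟩ := exists_stripe hm H.2.2.1 H.2.2.2
      refine ⟨s, hs, ?_⟩
      rw [neck_eq (hv s hs), mem_deepTrapezoid_region]
      have := hle s hs
      simp only [Bool.false_eq_true, if_false]
      push_cast [show s * p ≤ q by omega]
      exact ⟨H.1, H.2.1, h3, h4⟩
    · simp only [if_true] at H
      push_cast at H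
      obtain ⟨s, hs, h3, h4⟩ := exists_stripe hm H.2.2.1 H.2.2.2
      refine ⟨s, hs, ?_⟩
      rw [neck_eq (hv s hs), mem_deepTrapezoid_region]
      have := hle s hs
      simp only [if_true]
      push_cast [show s * p ≤ q by omega]
      exact ⟨H.1, H.2.1, h3, h4⟩
  · rintro ⟨s, hs, H⟩
    rw [neck_eq (hv s hs), mem_deepTrapezoid_region] at H
    have := hle s hs
    have := hs1 s hs
    cases τ
    · simp only [Bool.false_eq_true, if_false] at H ⊢
      push_cast [show s * p ≤ q by omega] at H ⊢
      exact ⟨H.1, H.2.1, by linarith, by linarith⟩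
    · simp only [if_true] at H ⊢
      push_cast [show s * p ≤ q by omega] at H ⊢
      exact ⟨H.1, H.2.1, by linarith, by linarith⟩

/-! ### Blocks of equal subtractions and the Euclidean algorithm -/

theorem iterate_nextState {τ : Bool} {p q : ℕ} {k : ℕ} (hk : k * p + p ≤ q) :
    nextState^[k] (τ, p, q) = (τ, p, q - k * p) := by
  induction k with
  | zero => simp
  | succ k ih =>
    have e : (k + 1) * p = k * p + p := by ring
    rw [e] at hk
    rw [Function.iterate_succ_apply', ih (by omega), nextState, if_pos (by simp only; omega), e,
      Nat.sub_sub]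

/-- Subtracting p as often as possible, with the flip at the last subtraction, amounts to one
division with remainder. -/
theorem iterate_nextState_div {τ : Bool} {p q : ℕ} (h0 : 0 < p) (hpq : p ≤ q) :
    nextState^[q / p] (τ, p, q) = (!τ, q % p, p) := by
  obtain ⟨c, hc⟩ : ∃ c, q / p = c + 1 :=
    Nat.exists_eq_succ_of_ne_zero (Nat.div_pos hpq h0).ne'
  have h1 := Nat.div_add_mod q p
  have h2 := Nat.mod_lt q h0
  have e : p * (c + 1) = c * p + p := by ring
  rw [hc, e] at h1
  have h3 : q - c * p = p + q % p := by omega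
  rw [hc, Function.iterate_succ_apply', iterate_nextState (by omega), nextState,
    if_neg (by simp only; omega), h3, Nat.add_sub_cancel_left]

/-- The `m` necklaces from `s` onwards form one block of stripes. -/
def IsBlock (s : State) (k m : ℕ) : Prop :=
  0 < (nextState^[k] s).2.1 ∧ m = (nextState^[k] s).2.2 / (nextState^[k] s).2.1 ∧
  ∀ k', k' + 1 = k → (nextState^[k'] s).2.2 < 2 * (nextState^[k'] s).2.1

/-- The blocks have the sizes of the partial quotients. -/
theorem exists_cf (q : ℕ) : ∀ (τ : Bool) (p : ℕ), State.Good (τ, p, q) →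
    ∃ l : List ℕ, IsRun (τ, p, q) l.sum ∧ IsCFExpansion l ((p : ℚ) / q) ∧
      ∀ (j : ℕ) (hj : j < l.length), IsBlock (τ, p, q) (l.take j).sum l[j] := by
  induction q using Nat.strong_induction_on with
  | _ q ih =>
  intro τ p hs
  rcases Nat.eq_zero_or_pos p with rfl | h0
  · exact ⟨[], ⟨by simp, by simp⟩, ⟨by simp, by simp, by simp [cfValue]⟩, by simp⟩
  have hpq : p ≤ q := hs.1
  have hcop : Nat.Coprime p q := hs.2
  have hc0 : 0 < q / p := Nat.div_pos hpq h0
  have hit := iterate_nextState_div (τ := τ) h0 hpq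
  have hp : (0 : ℚ) < p := by exact_mod_cast h0
  have hq0 : (0 : ℚ) < q := by exact_mod_cast h0.trans_le hpq
  have hdm : (p : ℚ) * (q / p : ℕ) + (q % p : ℕ) = q := by exact_mod_cast Nat.div_add_mod q p
  have hblock0 : IsBlock (τ, p, q) 0 (q / p) := ⟨h0, rfl, fun k' h => by omega⟩
  have hpos : ∀ k < q / p, 0 < (nextState^[k] (τ, p, q)).2.1 := by
    intro k hk
    have h3 : (k + 1) * p ≤ q := (Nat.mul_le_mul_right p hk).trans (Nat.div_mul_le_self q p)
    rw [iterate_nextState (by linarith)]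
    exact h0
  have hflip : ∀ k', k' + 1 = q / p →
      (nextState^[k'] (τ, p, q)).2.2 < 2 * (nextState^[k'] (τ, p, q)).2.1 := by
    intro k hk
    have h1 := Nat.div_add_mod q p
    have h2 := Nat.mod_lt q h0
    have e : p * (k + 1) = k * p + p := by ring
    rw [← hk, e] at h1
    rw [iterate_nextState (by omega)]
    simp only
    omega
  rcases eq_or_lt_of_le hpq with rfl | hlt
  · have h1 : p = 1 := by simpa using hcop
    subst h1
    refine ⟨[1], ⟨fun k hk => hpos k (by simpa using hk), ?_⟩, ⟨by simp, by simp, by simp [cfValue]⟩, ?_⟩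
    · simpa using congrArg (fun s : State => s.2.1) hit
    · intro j hj
      simp at hj
      subst hj
      simpa using hblock0
  obtain ⟨l, ⟨hr1, hr2⟩, ⟨hl1, hl2, hl3⟩, hl4⟩ := ih p hlt (!τ) (q % p)
    ⟨(Nat.mod_lt q h0).le, by
      have := hcop.symm
      rwa [Nat.Coprime, Nat.gcd_comm, Nat.gcd_rec] at this⟩
  have hadd : ∀ k, nextState^[q / p + k] (τ, p, q) = nextState^[k] (!τ, q % p, p) := fun k => by
    rw [add_comm, Function.iterate_add_apply, hit]
  refine ⟨(q / p) :: l, ⟨?_, ?_⟩, ⟨?_, ?_, ?_⟩, ?_⟩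
  · intro k hk
    rw [List.sum_cons] at hk
    rcases lt_or_ge k (q / p) with h1 | h1
    · exact hpos k h1
    · obtain ⟨k', rfl⟩ := Nat.exists_eq_add_of_le h1
      rw [hadd]
      exact hr1 k' (by omega)
  · rw [List.sum_cons, hadd]
    exact hr2
  · simp only [List.mem_cons, forall_eq_or_imp]
    exact ⟨hc0, hl1⟩
  · intro hne
    rcases l with _ | ⟨c, l⟩
    · simp only [List.getLast?_singleton, ne_eq, Option.some.injEq]
      intro h1
      rw [h1] at hne
      exact hne rfl
    · rw [List.getLast?_cons_cons]
      -- A tail `[1]` would have the value 1, but the value of the tail is (q % p) / p, which is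
      -- less than 1.
      apply hl2
      intro h1
      rw [h1] at hl3
      simp only [cfValue, Nat.cast_one, add_zero, div_one] at hl3
      have h2 := Nat.mod_lt q h0
      have h3 : ((q % p : ℕ) : ℚ) = p := by
        field_simp at hl3
        linarith
      have h4 : q % p = p := by exact_mod_cast h3
      omega
  · rw [cfValue, hl3, ← hdm]
    field_simp
  · intro j hj
    rcases j with _ | j
    · simpa using hblock0
    · simp only [List.take_succ_cons, List.sum_cons, List.getElem_cons_succ]
      have hj' : j < l.length := by simpa using hj
      obtain ⟨h1, h2, h3⟩ := hl4 j hj'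
      refine ⟨by rw [hadd]; exact h1, by rw [hadd]; exact h2, ?_⟩
      intro k' hk'
      rcases lt_or_ge k' (q / p) with h4 | h4
      · exact hflip k' (by omega)
      · obtain ⟨k'', rfl⟩ := Nat.exists_eq_add_of_le h4
        rw [hadd]
        exact h3 k'' (by omega)

/-- The bottom has length q - p, and after a flip the next top has length p. Equality would mean q =
2p, which the strict inequality excludes. -/
theorem not_bottom_eq_top {s : State} (hs : s.Valid) (hs' : (nextState s).Valid)
    (hflip : s.2.2 < 2 * s.2.1) (i j : ZMod 6) :
    (neck s i).bottom ≠ (neck (nextState s) j).top := by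
  intro H
  have h1 := congrArg Metric.diam H
  rw [Trapezoid.diam_bottom, Trapezoid.diam_top, neck_eq hs, neck_eq hs'] at h1
  have h3 : (nextState s).2.2 = s.2.1 := by rw [nextState, if_neg (by omega)]
  simp only [deepTrapezoid, h3] at h1
  have h2 : s.2.2 = s.2.1 + s.2.1 := by
    have : (s.2.2 : ℝ) = s.2.1 + s.2.1 := by linarith
    exact_mod_cast this
  omega

theorem IsBlock.isMaximalBlock {s : State} {n k m : ℕ} (hs : s.Good) (hr : IsRun s n)
    (hkm : k + m ≤ n) (H : IsBlock s k m) :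
    IsMaximalBlock n (fun k => neck (nextState^[k] s)) k m := by
  obtain ⟨h0, hm, hflip⟩ := H
  have hg := hs.iterate k
  have hshift : ∀ l, nextState^[k + l] s = nextState^[l] (nextState^[k] s) := fun l => by
    rw [add_comm, Function.iterate_add_apply]
  rcases hst : nextState^[k] s with ⟨τ, p, q⟩
  rw [hst] at h0 hm hg
  simp only at h0 hm
  have hpq : p ≤ q := hg.1
  have hm0 : 0 < m := hm ▸ Nat.div_pos hpq h0
  have hmq : m * p ≤ q := hm ▸ Nat.div_mul_le_self q p
  have hle : ∀ l < m, l * p + p ≤ q := fun l hl => by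
    have : (l + 1) * p ≤ m * p := Nat.mul_le_mul_right p hl
    linarith
  have hstate : ∀ l < m, nextState^[k + l] s = (τ, p, q - l * p) := fun l hl => by
    rw [hshift, hst, iterate_nextState (hle l hl)]
  have nostripe : ∀ k' m', k' < n → (nextState^[k'] s).2.2 < 2 * (nextState^[k'] s).2.1 →
      k' + 1 < n → ∀ i j, m' = k' + 1 →
      (neck (nextState^[k'] s) i).bottom ≠ (neck (nextState^[m'] s) j).top := by
    rintro k' m' h1 h2 h3 i j rfl
    have h4 := hr.valid hs h3
    rw [Function.iterate_succ_apply'] at h4 ⊢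
    exact not_bottom_eq_top (hr.valid hs h1) h4 h2 i j
  refine ⟨fun i => ⟨deepTrapezoid (τ, p, q) (m * p) ⟨by positivity, hmq⟩ i, hm0, hkm, ?_,
    fun _ => i, rfl, ?_, ?_⟩, ?_, ?_⟩
  · simp only [hst]
    rw [neck_eq ⟨h0, hpq⟩]
    rfl
  · rw [deepTrapezoid_region_eq h0 hm0 hmq]
    exact Set.iUnion₂_congr fun l hl => by simp only [hstate l hl]
  · intro l hl
    simp only [hstate l (by omega), hstate (l + 1) hl]
    have h1 := hle _ hl
    have e : (l + 1) * p = l * p + p := by ring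
    rw [e] at h1
    rw [e, ← Nat.sub_sub]
    exact neck_bottom_eq_top h0 (by omega) i
  · rintro i ⟨Z, -, h2, -, ι, -, -, h5⟩
    obtain ⟨c, rfl⟩ : ∃ c, m = c + 1 := Nat.exists_eq_succ_of_ne_zero hm0.ne'
    refine nostripe (k + c) (k + (c + 1)) (by omega) ?_ (by omega) _ _ rfl (h5 c (by omega))
    rw [hstate c (by omega)]
    simp only
    have h3 := hle c (by omega)
    have h1 := Nat.div_add_mod q p
    have h2 := Nat.mod_lt q h0
    have e : p * (c + 1) = c * p + p := by ring
    rw [← hm, e] at h1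
    omega
  · rintro k' rfl i ⟨Z, -, h2, -, ι, -, -, h5⟩
    exact nostripe k' _ (by omega) (hflip k' rfl) (by omega) _ _ rfl (h5 0 (by omega))

/-! ### The number of faces of a star polygon at a vertex, modulo three -/

/-- The indicator function of the rotations of `w`. -/
def tipCount (w v : ℤ × ℤ) : ZMod 3 := ∑ i : ZMod 6, if ro i v = w then 1 else 0

theorem tipCount_ro (j : ZMod 6) (w v : ℤ × ℤ) : tipCount (ro j w) v = tipCount w v := by
  rw [tipCount, tipCount, ← Equiv.sum_comp (Equiv.addLeft j)]
  refine Finset.sum_congr rfl fun i _ => ?_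
  have : ro (j + i) v = ro j w ↔ ro i v = w := by
    rw [← ro_ro]
    constructor
    · intro H
      have := congrArg (ro (-j)) H
      rwa [ro_ro, ro_ro, neg_add_cancel, zero_add, ro_ro, neg_add_cancel, ro_zero] at this
    · rintro rfl; rfl
  simp only [Equiv.coe_addLeft, this]

theorem bary_ro (i k : ZMod 6) (v : ℤ × ℤ) : ro i (bary v k) = bary (ro i v) (i + k) := by
  rw [bary, ro_add, ro_smul, ro_delta, bary]

theorem sum_zmod_six {M : Type*} [AddCommMonoid M] (f : ZMod 6 → M) :
    ∑ i, f i = f 0 + f 1 + f 2 + f 3 + f 4 + f 5 := Fin.sum_univ_six f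

/-- P and Q are the weak and the strict inequality for one wall of a cone, R and S those for the
other. A vertex inside the cone sees six faces of it and a vertex on a wall sees three, so modulo 3
only the apex counts. -/
theorem sum_of_nested {P Q R S : Prop} [Decidable P] [Decidable Q] [Decidable R] [Decidable S]
    (h1 : Q → P) (h2 : S → R) :
    ((if P ∧ R then 1 else 0) + (if P ∧ R then 1 else 0) + (if P ∧ S then 1 else 0) +
      (if Q ∧ S then 1 else 0) + (if Q ∧ S then 1 else 0) + (if Q ∧ R then 1 else 0) : ZMod 3) =
      if (P ∧ ¬Q) ∧ R ∧ ¬S then 2 else 0 := by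
  by_cases P <;> by_cases Q <;> by_cases R <;> by_cases S <;> simp_all <;> rfl

theorem sum_of_nested' {P Q R S : Prop} [Decidable P] [Decidable Q] [Decidable R] [Decidable S]
    (h1 : Q → P) (h2 : S → R) :
    ((if P ∧ R then 1 else 0) + (if P ∧ S then 1 else 0) + (if P ∧ S then 1 else 0) +
      (if Q ∧ S then 1 else 0) + (if Q ∧ R then 1 else 0) + (if Q ∧ R then 1 else 0) : ZMod 3) =
      if (P ∧ ¬Q) ∧ R ∧ ¬S then 1 else 0 := by
  by_cases P <;> by_cases Q <;> by_cases R <;> by_cases S <;> simp_all <;> rfl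

/-- This is the complementary cone at a reentrant corner of the star. Its angle is 120 degrees, so
it has two faces at its apex. -/
theorem cone_count_two (a b : ℤ) (v : ℤ × ℤ) :
    ∑ k, (if 3 * b ≤ hz 4 (bary v k) ∧ 3 * a ≤ hz 5 (bary v k) then 1 else 0 : ZMod 3) =
      if v = (a - b, b) then 2 else 0 := by
  obtain ⟨x, y⟩ := v
  have h1 : 3 * b ≤ 3 * y + 1 ↔ b ≤ y := by omega
  have h2 : 3 * b ≤ 3 * y + 2 ↔ b ≤ y := by omega
  have h3 : 3 * b ≤ 3 * y + -1 ↔ b < y := by omega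
  have h4 : 3 * b ≤ 3 * y + -2 ↔ b < y := by omega
  have g1 : 3 * a ≤ 3 * x + 1 + (3 * y + 1) ↔ a ≤ x + y := by omega
  have g2 : 3 * a ≤ 3 * x + -1 + (3 * y + 2) ↔ a ≤ x + y := by omega
  have g3 : 3 * a ≤ 3 * x + -2 + (3 * y + 1) ↔ a < x + y := by omega
  have g4 : 3 * a ≤ 3 * x + -1 + (3 * y + -1) ↔ a < x + y := by omega
  have g5 : 3 * a ≤ 3 * x + 1 + (3 * y + -2) ↔ a < x + y := by omega
  have g6 : 3 * a ≤ 3 * x + 2 + (3 * y + -1) ↔ a ≤ x + y := by omega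
  have e : (x, y) = (a - b, b) ↔ (b ≤ y ∧ ¬b < y) ∧ a ≤ x + y ∧ ¬a < x + y := by rw [Prod.mk.injEq]; omega
  rw [sum_zmod_six]
  simp only [hz_four, hz_five, bary, Prod.fst_add, Prod.snd_add, Prod.smul_fst, Prod.smul_snd,
    smul_eq_mul, delta_zero, delta_one, delta_two, delta_three, delta_four, delta_five,
    h1, h2, h3, h4, g1, g2, g3, g4, g5, g6, e]
  exact sum_of_nested (fun h => h.le) (fun h => h.le)

/-- This is the intersection of two neighboring complementary cones when a and b are nonnegative.
Its apex is a tip of the star, and its angle of 60 degrees holds one face there. -/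
theorem cone_count_one (a b : ℤ) (v : ℤ × ℤ) :
    ∑ k, (if 3 * b ≤ hz 4 (bary v k) ∧ 3 * a ≤ hz 0 (bary v k) then 1 else 0 : ZMod 3) =
      if v = (a, b) then 1 else 0 := by
  obtain ⟨x, y⟩ := v
  have h1 : 3 * b ≤ 3 * y + 1 ↔ b ≤ y := by omega
  have h2 : 3 * b ≤ 3 * y + 2 ↔ b ≤ y := by omega
  have h3 : 3 * b ≤ 3 * y + -1 ↔ b < y := by omega
  have h4 : 3 * b ≤ 3 * y + -2 ↔ b < y := by omega
  have g1 : 3 * a ≤ 3 * x + 1 ↔ a ≤ x := by omega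
  have g2 : 3 * a ≤ 3 * x + 2 ↔ a ≤ x := by omega
  have g3 : 3 * a ≤ 3 * x + -1 ↔ a < x := by omega
  have g4 : 3 * a ≤ 3 * x + -2 ↔ a < x := by omega
  have e : (x, y) = (a, b) ↔ (b ≤ y ∧ ¬b < y) ∧ a ≤ x ∧ ¬a < x := by rw [Prod.mk.injEq]; omega
  rw [sum_zmod_six]
  simp only [hz_four, hz_zero, bary, Prod.fst_add, Prod.snd_add, Prod.smul_fst, Prod.smul_snd,
    smul_eq_mul, delta_zero, delta_one, delta_two, delta_three, delta_four, delta_five,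
    h1, h2, h3, h4, g1, g2, g3, g4, e]
  exact sum_of_nested' (fun h => h.le) (fun h => h.le)

/-- Inclusion and exclusion for six sets in cyclic order of which only neighbors intersect, applied
to the cones that make up the complement of a star. -/
theorem indicator_of_cyclic : ∀ P : ZMod 6 → Bool, (∀ i, ¬(P i ∧ P (i + 2))) →
    (∀ i, ¬(P i ∧ P (i + 3))) → (if ∀ i, ¬P i then 1 else 0 : ZMod 3) =
      1 - (∑ i, if P i then 1 else 0) + ∑ i, if P i ∧ P (i + 1) then 1 else 0 := by
  decide

open Classical in
-- Summing the inclusion-exclusion formula over the six faces at v gives 6, minus 2 for each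
-- reentrant corner, plus 1 for each tip; modulo 3 both kinds of corners count 1.
theorem inStar_count {a b : ℤ} (ha : 0 ≤ a) (hb : 0 ≤ b) (v : ℤ × ℤ) :
    ∑ k, (if InStar (a, b) (bary v k) then 1 else 0 : ZMod 3) =
      tipCount (a, b) v + tipCount (a - b, b) v := by
  have key : ∀ B, IsBary B → (if InStar (a, b) B then 1 else 0 : ZMod 3) =
      1 - (∑ i, if 3 * b ≤ hz 4 (ro i B) ∧ 3 * a ≤ hz 5 (ro i B) then 1 else 0) +
      ∑ i, if 3 * b ≤ hz 4 (ro i B) ∧ 3 * a ≤ hz 0 (ro i B) then 1 else 0 := by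
    intro B hB
    have hdis : ∀ i, ¬((3 * b ≤ hz 4 (ro i B) ∧ 3 * a ≤ hz 5 (ro i B)) ∧
        (3 * b ≤ hz 4 (ro (i + 2) B) ∧ 3 * a ≤ hz 5 (ro (i + 2) B))) ∧
        ¬((3 * b ≤ hz 4 (ro i B) ∧ 3 * a ≤ hz 5 (ro i B)) ∧
        (3 * b ≤ hz 4 (ro (i + 3) B) ∧ 3 * a ≤ hz 5 (ro (i + 3) B))) := by
      intro i
      have h1 := isBary_ro hB i
      rw [add_comm i 2, add_comm i 3, ← ro_ro, ← ro_ro]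
      generalize ro i B = C at h1 ⊢
      obtain ⟨x, y⟩ := C
      obtain ⟨h1, h2⟩ := h1
      simp only [hz_ro, show (4 : ZMod 6) + 2 = 0 by decide, show (5 : ZMod 6) + 2 = 1 by decide,
        show (4 : ZMod 6) + 3 = 1 by decide, show (5 : ZMod 6) + 3 = 2 by decide,
        hz_zero, hz_one, hz_two, hz_four, hz_five] at *
      omega
    have H := indicator_of_cyclic (fun i => decide (3 * b ≤ hz 4 (ro i B) ∧ 3 * a ≤ hz 5 (ro i B)))
      (fun i => by simpa only [decide_eq_true_eq] using (hdis i).1)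
      (fun i => by simpa only [decide_eq_true_eq] using (hdis i).2)
    simp only [decide_eq_true_eq] at H
    convert H using 3
    · simp only [InStar, hz_ro, add_comm]
    · rename_i i _
      refine if_congr ?_ rfl rfl
      rw [add_comm i 1, ← ro_ro]
      simp only [hz_ro 4 1, hz_ro 5 1, show (4 : ZMod 6) + 1 = 5 by decide,
        show (5 : ZMod 6) + 1 = 0 by decide, hz_zero, hz_four, hz_five]
      constructor
      · rintro ⟨h1, h2⟩
        refine ⟨⟨h1, ?_⟩, ?_, h2⟩ <;> omega
      · rintro ⟨⟨h1, -⟩, -, h2⟩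
        exact ⟨h1, h2⟩
  simp only [key _ (isBary_bary v _), Finset.sum_add_distrib, Finset.sum_sub_distrib]
  rw [Finset.sum_comm, Finset.sum_comm (f := fun k i =>
    (if 3 * b ≤ hz 4 (ro i (bary v k)) ∧ 3 * a ≤ hz 0 (ro i (bary v k)) then 1 else 0 : ZMod 3))]
  have e2 : ∀ i, ∑ k, (if 3 * b ≤ hz 4 (ro i (bary v k)) ∧ 3 * a ≤ hz 5 (ro i (bary v k))
      then 1 else 0 : ZMod 3) = if ro i v = (a - b, b) then 2 else 0 := fun i => by
    rw [← cone_count_two, ← Equiv.sum_comp (Equiv.addLeft i) (fun k =>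
      (if 3 * b ≤ hz 4 (bary (ro i v) k) ∧ 3 * a ≤ hz 5 (bary (ro i v) k) then 1 else 0 : ZMod 3))]
    simp only [bary_ro, Equiv.coe_addLeft]
    exact Finset.sum_congr rfl fun x _ => if_congr Iff.rfl rfl rfl
  have e1 : ∀ i, ∑ k, (if 3 * b ≤ hz 4 (ro i (bary v k)) ∧ 3 * a ≤ hz 0 (ro i (bary v k))
      then 1 else 0 : ZMod 3) = if ro i v = (a, b) then 1 else 0 := fun i => by
    rw [← cone_count_one, ← Equiv.sum_comp (Equiv.addLeft i) (fun k =>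
      (if 3 * b ≤ hz 4 (bary (ro i v) k) ∧ 3 * a ≤ hz 0 (bary (ro i v) k) then 1 else 0 : ZMod 3))]
    simp only [bary_ro, Equiv.coe_addLeft]
    exact Finset.sum_congr rfl fun x _ => if_congr Iff.rfl rfl rfl
  simp only [e1, e2]
  have e3 : ∑ i, (if ro i v = (a - b, b) then 2 else 0 : ZMod 3) = 2 * tipCount (a - b, b) v := by
    rw [tipCount, Finset.mul_sum]
    exact Finset.sum_congr rfl fun i _ => by split_ifs <;> rfl
  rw [e3, ← tipCount]
  generalize tipCount (a - b, b) v = x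
  generalize tipCount (a, b) v = y
  rw [Finset.sum_const, Finset.card_univ, ZMod.card]
  revert x y
  decide

open Classical in
-- As the reentrant corners of a star are the tips of the next one, each corner is shared by two
-- successive stars. This makes the sum in `flowerColor_sum` telescope.
theorem inStar_count_state {s : State} (hs : s.2.1 ≤ s.2.2) (v : ℤ × ℤ) :
    ∑ k, (if InStar (tip s) (bary v k) then 1 else 0 : ZMod 3) =
      tipCount (tip s) v + tipCount (tip (nextState s)) v := by
  rw [tip_nextState hs]
  obtain ⟨τ, p, q⟩ := s
  cases τ
  · simp only [tip, Bool.false_eq_true, if_false]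
    exact inStar_count (by positivity) (by positivity) v
  · simp only [tip, if_true]
    rw [inStar_count (by positivity) (by positivity) v, ← tipCount_ro 1 (_, _ - _)]
    congr 3
    · simp
    · rw [show (1 : ZMod 6) + 4 = 5 by decide, hz_five]; ring

/-! ### The coloring of the filled and capped flower -/

/-- The coloring of the faces of the core. -/
def coreColor (e : Bool) (B : ℤ × ℤ) : Bool :=
  if B = delta 0 ∨ B = delta 2 ∨ B = delta 4 then e else !e

open Classical in
/-- The coloring of the plane by a single capped flower, in terms of barycenters. -/
def flowerColor (e : Bool) : ℕ → State → Bool → ℤ × ℤ → Bool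
  | 0, s, o, B => if InStar (tip s) B then coreColor e B else !o
  | n + 1, s, o, B => if InStar (tip s) B then flowerColor e n (nextState s) (!o) B else !o

theorem flowerColor_of_not_inStar {e : Bool} {n : ℕ} {s : State} {o : Bool} {B : ℤ × ℤ}
    (H : ¬InStar (tip s) B) : flowerColor e n s o B = !o := by
  cases n <;> rw [flowerColor, if_neg H]

theorem flowerColor_ro (e : Bool) (n : ℕ) (s : State) (o : Bool) {B : ℤ × ℤ} (j : ZMod 6) :
    flowerColor e n s o (ro (2 * j) B) = flowerColor e n s o B := by
  induction n generalizing s o with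
  | zero =>
    have h1 : ∀ j k, ro (2 * j) B = delta k ↔ B = delta (k - 2 * j) := fun j k => by
      constructor
      · intro H
        rw [sub_eq_neg_add, ← ro_delta, ← H, ro_ro, neg_add_cancel, ro_zero]
      · rintro rfl
        rw [ro_delta]; congr 1; ring
    have h2 : ∀ j : ZMod 6, 2 * j = 0 ∨ 2 * j = 2 ∨ 2 * j = 4 := by decide
    by_cases hB : InStar (tip s) B
    · rw [flowerColor, flowerColor, if_pos hB, if_pos ((inStar_ro _).2 hB)]
      simp only [coreColor, h1]
      refine if_congr ?_ rfl rfl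
      rcases h2 j with h | h | h <;> rw [h]
      · simp only [sub_zero]
      · simp only [show (0 : ZMod 6) - 2 = 4 by decide, show (2 : ZMod 6) - 2 = 0 by decide,
          show (4 : ZMod 6) - 2 = 2 by decide]
        tauto
      · simp only [show (0 : ZMod 6) - 4 = 2 by decide, show (2 : ZMod 6) - 4 = 4 by decide,
          show (4 : ZMod 6) - 4 = 0 by decide]
        tauto
    · rw [flowerColor_of_not_inStar hB, flowerColor_of_not_inStar fun h => hB ((inStar_ro _).1 h)]
  | succ n ih =>
    by_cases hB : InStar (tip s) B
    · rw [flowerColor, flowerColor, if_pos hB, if_pos ((inStar_ro _).2 hB), ih]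
    · rw [flowerColor_of_not_inStar hB, flowerColor_of_not_inStar fun h => hB ((inStar_ro _).1 h)]

/-- The center sees six alternating faces, and each of the six outer vertices sees two adjacent core
faces of opposite colors. -/
theorem core_sum (e : Bool) (v : ℤ × ℤ) :
    ∑ k, (if ∃ i, bary v k = delta i then sgn (coreColor e (bary v k)) else 0) = 0 := by
  have h1 : ∀ k i, bary v k = delta i → v = 0 ∨ ∃ l, v = unit l := by
    intro k i H
    rw [← bary_zero, ← fac_inj] at H
    have h2 : (vtx v).1 ∈ (fac 0 i).1 := by rw [← H]; exact mem_fac.2 (Or.inl rfl)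
    rw [mem_fac, zero_add, zero_add] at h2
    rcases h2 with h | h | h
    · exact Or.inl h
    · exact Or.inr ⟨_, h⟩
    · exact Or.inr ⟨_, h⟩
  by_cases h2 : v = 0 ∨ ∃ l, v = unit l
  · rcases h2 with rfl | ⟨l, rfl⟩
    · revert e; decide
    · revert e l; decide
  · refine Finset.sum_eq_zero fun k _ => if_neg ?_
    rintro ⟨i, hi⟩
    exact h2 (h1 k i hi)

theorem sgn_not (o : Bool) : sgn (!o) = -sgn o := by revert o; decide

theorem IsRun.next {s : State} {n : ℕ} (hr : IsRun s (n + 1)) : IsRun (nextState s) n :=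
  ⟨fun k hk => by rw [← Function.iterate_succ_apply]; exact hr.1 _ (by omega),
    by rw [← Function.iterate_succ_apply]; exact hr.2⟩

/-- The color sum of a single capped flower vanishes except at the tips. -/
theorem flowerColor_sum (e : Bool) {n : ℕ} {s : State} (hs : s.Good) (hr : IsRun s n) (o : Bool)
    (v : ℤ × ℤ) : ∑ k, sgn (flowerColor e n s o (bary v k)) = -sgn o * tipCount (tip s) v := by
  classical
  have hN := inStar_count_state hs.1 v
  have h6 : ∑ _k : ZMod 6, -sgn o = 0 := by
    rw [Finset.sum_const, Finset.card_univ, ZMod.card]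
    revert o; decide
  induction n generalizing s o with
  | zero =>
    have h0 : s.2.1 = 0 := hr.2
    have hnext : tip (nextState s) = tip s := by
      rw [tip_nextState hs.1, tip, h0]
      split_ifs <;> simp
    rw [hnext] at hN
    have key : ∀ k, sgn (flowerColor e 0 s o (bary v k)) =
        (if ∃ i, bary v k = delta i then sgn (coreColor e (bary v k)) else 0) +
        (-sgn o + sgn o * if InStar (tip s) (bary v k) then 1 else 0) := by
      intro k
      rw [flowerColor]
      have := inStar_core_iff hs h0 (isBary_bary v k)
      by_cases hk : InStar (tip s) (bary v k)
      · rw [if_pos hk, if_pos hk, if_pos (this.1 hk)]; ring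
      · rw [if_neg hk, if_neg hk, if_neg (fun h => hk (this.2 h)), sgn_not]; ring
    simp only [key, Finset.sum_add_distrib]
    have := core_sum e v
    rw [← Finset.mul_sum, hN, h6]
    rw [show (∑ k, if ∃ i, bary v k = delta i then sgn (coreColor e (bary v k)) else 0) = 0 by
      convert this]
    have : (3 : ZMod 3) = 0 := by decide
    linear_combination (sgn o * tipCount (tip s) v) * this
  | succ n ih =>
    -- Outside the outer star the inner coloring has its cap color o, which must become its
    -- opposite, so `-2 * sgn o` is added off the star. At the next tips, the inner sum and this
    -- correction then cancel modulo 3.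
    have key : ∀ k, sgn (flowerColor e (n + 1) s o (bary v k)) =
        sgn (flowerColor e n (nextState s) (!o) (bary v k)) +
        (-sgn o + -sgn o + 2 * sgn o * if InStar (tip s) (bary v k) then 1 else 0) := by
      intro k
      rw [flowerColor]
      by_cases hk : InStar (tip s) (bary v k)
      · rw [if_pos hk, if_pos hk]; ring
      · rw [if_neg hk, if_neg hk, flowerColor_of_not_inStar (fun h => hk (h.of_next hs.1))]
        simp only [sgn_not]; ring
    simp only [key, Finset.sum_add_distrib]
    rw [← Finset.mul_sum, hN, h6, ih hs.next hr.next _ (inStar_count_state hs.next.1 v)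
      (by rw [sgn_not, Finset.sum_neg_distrib, h6, neg_zero]), sgn_not]
    have : (3 : ZMod 3) = 0 := by decide
    linear_combination (sgn o * tipCount (tip s) v + sgn o * tipCount (tip (nextState s)) v) * this

theorem flowerColor_of_inTrap {e : Bool} {n : ℕ} {s : State} (hs : s.Good) (hr : IsRun s n)
    {o : Bool} {B : ℤ × ℤ} (hB : IsBary B) {k : ℕ} (hk : k < n) {i : ZMod 6}
    (H : InTrap (nextState^[k] s) (ro (-i) B)) : flowerColor e n s o B = alternate o k := by
  have hkin := H.inStar (hr.valid hs hk) (isBary_ro hB _)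
  rw [inStar_ro, inStar_ro] at hkin
  induction n generalizing s o k with
  | zero => omega
  | succ n ih =>
    rw [flowerColor, if_pos (show InStar (tip s) B from hkin.1.antitone hs (Nat.zero_le k))]
    rcases k with _ | k
    · rw [flowerColor_of_not_inStar (show ¬InStar (tip (nextState s)) B from hkin.2), Bool.not_not, alternate, if_pos (by decide)]
    · rw [ih hs.next hr.next (by omega) H hkin, alternate, alternate]
      by_cases h2 : Even k
      · rw [if_pos h2, if_neg (by rw [Nat.even_add_one]; simpa using h2)]
      · rw [if_neg h2, if_pos (by rw [Nat.even_add_one]; exact h2), Bool.not_not]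

theorem flowerColor_delta {e : Bool} {n : ℕ} {s : State} (hs : s.Good) (hr : IsRun s n)
    {o : Bool} (i : ZMod 6) : flowerColor e n s o (delta i) = alternate e i.val := by
  induction n generalizing s o with
  | zero =>
    rw [flowerColor, if_pos (show InStar (tip s) _ from inStar_of_core hs hr rfl le_rfl)]
    revert e i; decide
  | succ n ih =>
    rw [flowerColor, if_pos (show InStar (tip s) _ from inStar_of_core hs hr rfl (Nat.zero_le _)), ih hs.next hr.next]

theorem exists_piece {n : ℕ} {s : State} (hs : s.Good) (hr : IsRun s n) {B : ℤ × ℤ} (hB : IsBary B)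
    (H : InStar (tip s) B) :
    (∃ k < n, ∃ i, InTrap (nextState^[k] s) (ro (-i) B)) ∨ ∃ i, B = delta i := by
  induction n generalizing s with
  | zero => exact Or.inr ((inStar_core_iff hs hr.2 hB).1 H)
  | succ n ih =>
    by_cases h1 : InStar (tip (nextState s)) B
    · rcases ih hs.next hr.next h1 with ⟨k, hk, h2⟩ | h2
      · exact Or.inl ⟨k + 1, by omega, h2⟩
      · exact Or.inr h2
    · exact Or.inl ⟨0, by omega, exists_inTrap (hr.valid hs (by omega)) H h1⟩

/-! ### Points in two hexagons -/

theorem eq_of_mem_hexagon {γ t t' z : ℂ} (hγ : γ ≠ 0) (ht : t ∈ tileLattice γ)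
    (ht' : t' ∈ tileLattice γ) (h1 : z - t ∈ hexagon γ) (h2 : ∀ i, h i ((z - t') / γ) < 1) :
    t = t' := by
  obtain ⟨u, hu, hu2⟩ := mem_tileLattice_iff.1 (tileLattice_sub ht' ht)
  rw [mem_hexagon hγ] at h1
  have e : toC u = (z - t) / γ - (z - t') / γ := by
    rw [← sub_div, eq_div_iff hγ]
    linear_combination -hu2
  have hu0 : u = 0 := by
    refine eq_zero_of_hz_lt hu fun i => ?_
    have h3 : (hz i u : ℝ) = h i ((z - t) / γ) - h i ((z - t') / γ) := by rw [← h_toC, e, map_sub]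
    have h4 := h2 (i + 3)
    rw [h_add_three] at h4
    have h5 := h1 i
    have : (hz i u : ℝ) < 2 := by linarith
    exact_mod_cast this
  rw [hu0, toC_zero, mul_zero] at hu2
  exact (sub_eq_zero.1 hu2).symm

theorem exists_boundary {γ t t' z : ℂ} (hγ : γ ≠ 0) (ht : t ∈ tileLattice γ)
    (ht' : t' ∈ tileLattice γ) (hne : t ≠ t') (h1 : z - t ∈ hexagon γ) (h2 : z - t' ∈ hexagon γ) :
    ∃ i, h i ((z - t') / γ) = 1 := by
  by_contra! H
  rw [mem_hexagon hγ] at h2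
  exact hne (eq_of_mem_hexagon hγ ht ht' h1 fun i => lt_of_le_of_ne (h2 i) (H i))

theorem mem_fac_iff {v : ℤ × ℤ} {k : ZMod 6} {z : ℂ} :
    z ∈ (fac v k).1 ↔ ∀ j, h j z ≤ faceBound v k j := by
  change z ∈ triangle (toC v) (zeta k) ↔ _
  rw [triangle_eq_poly]; rfl

theorem h_div_lt_of_inner {γ z : ℂ} (hγ : γ ≠ 0) {v : ℤ × ℤ} {k : ZMod 6}
    (hz : ∀ j, h j z < faceBound v k j) (hsub : (fac v k).1 ⊆ hexagon γ) (i : ZMod 6) :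
    h i (z / γ) < 1 := by
  have hopen : IsOpen {w : ℂ | ∀ j, h j w < faceBound v k j} := by
    rw [Set.ofPred_forall]
    exact isOpen_iInter_of_finite fun j =>
      isOpen_lt (LinearMap.continuous_of_finiteDimensional _) continuous_const
  have hint : z ∈ interior (translate 0 (hexagon γ)) :=
    interior_maximal (fun w hw => mem_translate.2 (by
      rw [sub_zero]; exact hsub (mem_fac_iff.2 fun j => (hw j).le))) hopen hz
  have := h_div_lt_of_mem_interior hγ hint i
  rwa [sub_zero] at this

theorem mem_fac_sub {v τ : ℤ × ℤ} {k : ZMod 6} {z : ℂ} :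
    z - toC τ ∈ (fac (v - τ) k).1 ↔ z ∈ (fac v k).1 := by
  rw [mem_fac_iff, mem_fac_iff]
  refine forall_congr' fun j => ?_
  rw [map_sub, h_toC, faceBound, faceBound, hz_sub]
  push_cast
  constructor <;> intro h <;> linarith

theorem inner_sub {v τ : ℤ × ℤ} {k j : ZMod 6} {z : ℂ} (H : h j z < faceBound v k j) :
    h j (z - toC τ) < faceBound (v - τ) k j := by
  rw [map_sub, h_toC]
  rw [faceBound] at H ⊢
  rw [hz_sub]
  push_cast at H ⊢
  linarith

theorem bary_sub (v τ : ℤ × ℤ) (k : ZMod 6) : bary (v - τ) k = bary v k - (3 : ℤ) • τ := by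
  rw [bary, bary, smul_sub]; abel

theorem nrm_eq_normSq (b : ℤ × ℤ) : (nrm b : ℝ) = Complex.normSq (toC b) := by
  rw [normSq_toC, nrm]

/-- The boundary of a hexagon meets a face in its interior only at a tip. -/
theorem eq_tip_of_mem_fac {b : ℤ × ℤ} (hb : IsCoprime b.1 b.2) (hb0 : b ≠ 0) (hN : nrm b ≠ 1)
    {v : ℤ × ℤ} {k i : ZMod 6} (hsub : (fac v k).1 ⊆ hexagon (toC b)) {w : ℂ}
    (hw : w ∈ (fac v k).1) (hi : h i (w / toC b) = 1) : ∃ l, w = zeta l * toC b := by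
  have hγ := toC_ne_zero.2 hb0
  -- Adjacent vertices of the face cannot both lie on the side. Both would be tips, so that their
  -- difference would be a lattice multiple of b, and its norm 1 would be divisible by the norm of
  -- b.
  have hone : ∀ x y : ℤ × ℤ, (vtx x).1 ∈ (fac v k).1 → (vtx y).1 ∈ (fac v k).1 →
      (∃ j, y - x = unit j) → h i (toC x / toC b) = 1 → h i (toC y / toC b) ≠ 1 := by
    rintro x y hx hy ⟨j, hj⟩ h1 h2
    obtain ⟨l, rfl⟩ := eq_tip_of_boundary hb hb0 (hsub hx) h1
    obtain ⟨m, rfl⟩ := eq_tip_of_boundary hb hb0 (hsub hy) h2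
    have e : toC (unit m - unit l) * toC b = zeta j := by
      rw [← toC_unit j, ← hj, toC_sub, toC_sub, toC_ro, toC_ro, toC_unit, toC_unit]; ring
    have h3 := congrArg Complex.normSq e
    rw [map_mul, ← nrm_eq_normSq, ← nrm_eq_normSq, ← toC_unit, ← nrm_eq_normSq] at h3
    have h4 : ∀ j, nrm (unit j) = 1 := by decide
    rw [h4 j] at h3
    have h5 : nrm (unit m - unit l) * nrm b = 1 := by exact_mod_cast h3
    rcases Int.eq_one_or_neg_one_of_mul_eq_one' h5 with h6 | h6
    · exact hN h6.2
    · have := nrm_pos hb0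
      omega
  have m0 : (vtx v).1 ∈ (fac v k).1 := mem_fac.2 (Or.inl rfl)
  have m1 : (vtx (v + unit k)).1 ∈ (fac v k).1 := mem_fac.2 (Or.inr (Or.inl rfl))
  have m2 : (vtx (v + unit (k + 1))).1 ∈ (fac v k).1 := mem_fac.2 (Or.inr (Or.inr rfl))
  have b0 := (mem_hexagon hγ).1 (hsub m0) i
  have b1 := (mem_hexagon hγ).1 (hsub m1) i
  have b2 := (mem_hexagon hγ).1 (hsub m2) i
  simp only [vtx] at b0 b1 b2
  have htip : ∀ x, (vtx x).1 ∈ (fac v k).1 → h i (toC x / toC b) = 1 →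
      ∃ l, toC x = zeta l * toC b := fun x hx h1 => by
    obtain ⟨l, rfl⟩ := eq_tip_of_boundary hb hb0 (hsub hx) h1
    exact ⟨l, toC_ro _ _⟩
  obtain ⟨c0, c1, c2, p0, p1, p2, hsum, hcomb⟩ : ∃ c0 c1 c2 : ℝ, 0 ≤ c0 ∧ 0 ≤ c1 ∧ 0 ≤ c2 ∧
      c0 + c1 + c2 = 1 ∧
      w = c0 * toC v + c1 * toC (v + unit k) + c2 * toC (v + unit (k + 1)) := by
    have hw' : w ∈ convexHull ℝ {toC v, toC (v + unit k), toC (v + unit (k + 1))} := by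
      have e : (fac v k).1 = convexHull ℝ {toC v, toC (v + unit k), toC (v + unit (k + 1))} := by
        change triangle (toC v) (zeta k) = _
        rw [triangle, toC_add, toC_add, toC_unit, toC_unit, zeta_add, zeta_one, mul_comm α]
      rwa [← e]
    rw [convexHull_insert (by simp), convexHull_pair, mem_convexJoin] at hw'
    obtain ⟨_, rfl, y, ⟨a1, a2, q1, q2, hq, rfl⟩, ⟨a3, a4, q3, q4, hq', rfl⟩⟩ := hw'
    refine ⟨a3, a4 * a1, a4 * a2, q3, by positivity, by positivity, ?_, ?_⟩
    · rw [add_assoc, ← mul_add, hq, mul_one, hq']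
    · simp only [Complex.real_smul]; push_cast; ring
  have hf : h i (w / toC b) = c0 * h i (toC v / toC b) + c1 * h i (toC (v + unit k) / toC b) +
      c2 * h i (toC (v + unit (k + 1)) / toC b) := by
    rw [hcomb, add_div, add_div, map_add, map_add, mul_div_assoc, mul_div_assoc, mul_div_assoc,
      h_real_mul, h_real_mul, h_real_mul]
  rw [hi] at hf
  set f0 := h i (toC v / toC b) with hf0
  set f1 := h i (toC (v + unit k) / toC b) with hf1
  set f2 := h i (toC (v + unit (k + 1)) / toC b) with hf2
  -- The functional is at most 1 at the three vertices and equal to 1 at their convex combination w,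
  -- so only vertices on the side carry weight. There is just one such vertex, and it is w.
  have z0 := mul_nonneg p0 (sub_nonneg.2 b0)
  have z1 := mul_nonneg p1 (sub_nonneg.2 b1)
  have z2 := mul_nonneg p2 (sub_nonneg.2 b2)
  have w0 : c0 * (1 - f0) = 0 := by linarith
  have w1 : c1 * (1 - f1) = 0 := by linarith
  have w2 : c2 * (1 - f2) = 0 := by linarith
  have zero : ∀ c f : ℝ, c * (1 - f) = 0 → f ≠ 1 → c = 0 := fun c f h1 h2 =>
    (mul_eq_zero.1 h1).resolve_right (sub_ne_zero.2 h2.symm)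
  by_cases g0 : f0 = 1
  · have k1 := zero _ _ w1 (hone _ _ m0 m1 ⟨k, by abel⟩ g0)
    have k2 := zero _ _ w2 (hone _ _ m0 m2 ⟨k + 1, by abel⟩ g0)
    have k0 : c0 = 1 := by linarith
    obtain ⟨l, hl⟩ := htip _ m0 g0
    exact ⟨l, by rw [hcomb, k0, k1, k2, hl]; simp⟩
  have k0 := zero _ _ w0 g0
  by_cases g1 : f1 = 1
  · have hd : ∀ k, unit (k + 1) - unit k = unit (k + 2) := by decide
    have k2 := zero _ _ w2 (hone _ _ m1 m2 ⟨k + 2, by rw [← hd]; abel⟩ g1)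
    have k1 : c1 = 1 := by linarith
    obtain ⟨l, hl⟩ := htip _ m1 g1
    exact ⟨l, by rw [hcomb, k0, k1, k2, hl]; simp⟩
  have k1 := zero _ _ w1 g1
  have k2 : c2 = 1 := by linarith
  have g2 : f2 = 1 := by
    rw [k2] at w2; linarith
  obtain ⟨l, hl⟩ := htip _ m2 g2
  exact ⟨l, by rw [hcomb, k0, k1, k2, hl]; simp⟩

/-! ### The coloring of the plane -/

theorem tip_isCoprime {s : State} (hs : s.Good) : IsCoprime (tip s).1 (tip s).2 := by
  have h1 := Nat.isCoprime_iff_coprime.2 hs.2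
  rw [tip]
  split_ifs
  · exact h1
  · exact h1.symm

theorem eq_zero_of_nrm_eq_one {s : State} (hs : s.Good) (hN : nrm (tip s) = 1) : s.2.1 = 0 := by
  obtain ⟨τ, p, q⟩ := s
  have h1 : p ≤ q := hs.1
  by_contra h0
  have h2 : (1 : ℤ) ≤ p := by simp only at h0; omega
  have h3 : (1 : ℤ) ≤ q := by omega
  cases τ <;> simp [tip, nrm] at hN <;> nlinarith

variable {s : State} {n : ℕ}

theorem fac_subset_flower (hs : s.Good) (hr : IsRun s n) {v : ℤ × ℤ} {k : ZMod 6}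
    (H : InStar (tip s) (bary v k)) :
    (fac v k).1 ⊆ flower n fun k => neck (nextState^[k] s) := by
  intro z hz
  rw [mem_flower]
  rcases exists_piece hs hr (isBary_bary v k) H with ⟨l, hl, i, h1⟩ | ⟨i, h1⟩
  · exact Or.inl ⟨l, hl, i, (fac_subset_neck_iff (hr.valid hs hl)).2 h1 hz⟩
  · rw [← bary_zero, ← fac_inj] at h1
    rw [h1] at hz
    exact Or.inr ⟨i, hz⟩

theorem inStar_of_mem_flower (hs : s.Good) (hr : IsRun s n) {v : ℤ × ℤ} {k : ZMod 6} {z : ℂ}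
    (hz : ∀ j, h j z < faceBound v k j) (H : z ∈ flower n fun k => neck (nextState^[k] s)) :
    InStar (tip s) (bary v k) := by
  rcases mem_flower.1 H with ⟨l, hl, i, h1⟩ | ⟨i, h1⟩
  · have hv := hr.valid hs hl
    rw [neck_region hv] at h1
    have h2 := inTrap_ro_iff.2 (faceBound_le_iff.1 (faceBound_le_of_mem hz h1))
    have h3 := (h2.inStar hv (isBary_ro (isBary_bary v k) _)).1
    rw [inStar_ro] at h3
    exact h3.antitone (k := 0) hs (Nat.zero_le l)
  · rw [triangle_eq_poly] at h1
    have h2 := eq_of_faceBound_le (faceBound_le_of_mem hz h1)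
    rw [bary_zero] at h2
    exact inStar_of_core (k := 0) hs hr h2 (Nat.zero_le n)

open Classical in
/-- The color of the face with barycenter `B / 3` in the tiling by translates of the capped
flower. -/
def planeColor (e : Bool) (n : ℕ) (s : State) (o : Bool) (B : ℤ × ℤ) : Bool :=
  if H : ∃ τ, toC τ ∈ tileLattice (toC (tip s)) ∧ InStar (tip s) (B - (3 : ℤ) • τ) then
    flowerColor e n s o (B - (3 : ℤ) • H.choose) else !o

variable (e o : Bool)

/-- The choice made in `planeColor` is harmless: a face in a translated star lies in the hexagon of
that translate, so its inner points lie in no other tile. A face contained in no translated star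
gets the cap color from each tile that it meets. -/
theorem planeColor_eq (hs : s.Good) (hr : IsRun s n) {v τ : ℤ × ℤ} {k : ZMod 6} {z : ℂ}
    (hτ : toC τ ∈ tileLattice (toC (tip s))) (hz : ∀ j, h j z < faceBound v k j)
    (hm : z - toC τ ∈ hexagon (toC (tip s))) :
    planeColor e n s o (bary v k) = flowerColor e n s o (bary (v - τ) k) := by
  have hγ := toC_ne_zero.2 (tip_ne_zero hs)
  rw [planeColor]
  split_ifs with H
  · have h1 := H.choose_spec
    rw [← bary_sub] at h1
    have : toC τ = toC H.choose := eq_of_mem_hexagon hγ hτ h1.1 hm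
      (h_div_lt_of_inner hγ (fun j => inner_sub (hz j))
        ((fac_subset_flower hs hr h1.2).trans (flower_subset_hexagon hs hr)))
    rw [toC_inj] at this
    rw [← this, bary_sub]
  · rw [flowerColor_of_not_inStar]
    intro h1
    rw [bary_sub] at h1
    exact H ⟨τ, hτ, h1⟩

/-- A point in the interior of a face. -/
def innerPt (v : ℤ × ℤ) (k : ZMod 6) : ℂ := toC v + ((1 / 3 : ℝ) : ℂ) * toC (delta k)

theorem h_innerPt_lt (v : ℤ × ℤ) (k j : ZMod 6) : h j (innerPt v k) < faceBound v k j :=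
  inner_point v k j (by norm_num) le_rfl

theorem innerPt_act (v t : ℤ × ℤ) (k i : ZMod 6) :
    innerPt (ro i v + t) (i + k) = zeta i * innerPt v k + toC t := by
  rw [innerPt, innerPt, ← ro_delta, toC_add, toC_ro, toC_ro]; ring

theorem innerPt_mem (v : ℤ × ℤ) (k : ZMod 6) : innerPt v k ∈ (fac v k).1 :=
  mem_fac_iff.2 fun j => (h_innerPt_lt v k j).le

theorem planeColor_eq_of_inStar (hs : s.Good) (hr : IsRun s n) {v τ : ℤ × ℤ} {k : ZMod 6}
    (hτ : toC τ ∈ tileLattice (toC (tip s))) (H : InStar (tip s) (bary (v - τ) k)) :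
    planeColor e n s o (bary v k) = flowerColor e n s o (bary (v - τ) k) :=
  planeColor_eq e o hs hr hτ (h_innerPt_lt v k) (flower_subset_hexagon hs hr
    (fac_subset_flower hs hr H (mem_fac_sub.2 (innerPt_mem v k))))

theorem exists_tile_lattice (hs : s.Good) (z : ℂ) :
    ∃ τ, toC τ ∈ tileLattice (toC (tip s)) ∧ z - toC τ ∈ hexagon (toC (tip s)) := by
  obtain ⟨t, ht, hm⟩ := exists_tile (toC_ne_zero.2 (tip_ne_zero hs)) z
  obtain ⟨τ, rfl⟩ := mem_lattice_iff.1 (tileLattice_subset (toC_mem _) ht)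
  exact ⟨τ, ht, hm⟩

theorem planeColor_act (hs : s.Good) (hr : IsRun s n) {t : ℤ × ℤ}
    (ht : toC t ∈ tileLattice (toC (tip s))) (v : ℤ × ℤ) (k j : ZMod 6) :
    planeColor e n s o (bary (ro (2 * j) v + t) (2 * j + k)) = planeColor e n s o (bary v k) := by
  obtain ⟨τ, hτ, hm⟩ := exists_tile_lattice hs (innerPt v k)
  have hτ' : toC (ro (2 * j) τ + t) ∈ tileLattice (toC (tip s)) := by
    rw [toC_add, toC_ro]
    exact tileLattice_add (tileLattice_zeta_mul _ hτ) ht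
  rw [planeColor_eq e o hs hr hτ (h_innerPt_lt v k) hm,
    planeColor_eq e o hs hr hτ' (h_innerPt_lt _ _), add_sub_add_right_eq_sub, ← ro_sub, ← bary_ro,
    flowerColor_ro]
  rw [innerPt_act, toC_add, toC_ro, add_sub_add_right_eq_sub, ← mul_sub]
  exact zeta_mul_mem_hexagon _ (toC_ne_zero.2 (tip_ne_zero hs)) hm

/-- A cap does not overlap a translate of the flower. -/
theorem not_inStar_of_cap (hs : s.Good) (hr : IsRun s n) {v τ τ' : ℤ × ℤ} {k : ZMod 6} {z : ℂ}
    (hz : z ∈ (fac v k).1) (hτ : toC τ ∈ tileLattice (toC (tip s)))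
    (hτ' : toC τ' ∈ tileLattice (toC (tip s))) (h1 : z - toC τ ∈ hexagon (toC (tip s)))
    (h2 : z - toC τ ∉ flower n fun k => neck (nextState^[k] s)) :
    ¬InStar (tip s) (bary (v - τ') k) := by
  intro H
  have hγ := toC_ne_zero.2 (tip_ne_zero hs)
  have hfl := fac_subset_flower hs hr H
  have hsub := hfl.trans (flower_subset_hexagon hs hr)
  have hw := mem_fac_sub (τ := τ').2 hz
  by_cases hne : toC τ = toC τ'
  · rw [hne] at h2
    exact h2 (hfl hw)
  obtain ⟨i, hi⟩ := exists_boundary hγ hτ hτ' hne h1 (hsub hw)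
  -- If the norm is 1, the hexagon is filled by the core and there are no caps.
  by_cases hN : nrm (tip s) = 1
  · obtain ⟨l, hl⟩ := exists_tip_eq_zeta hs (eq_zero_of_nrm_eq_one hs hN)
    rw [hl, ← mul_one (zeta l), hexagon_zeta_mul, mem_hexagon_one] at h1
    exact h2 (mem_flower.2 (Or.inr (mem_core_of_le h1)))
  -- Otherwise z is a tip of the other tile, so that z - τ is β times a lattice point. Such a point
  -- of the hexagon is its center or one of its tips, and all of these belong to the flower.
  · obtain ⟨l, hl⟩ := eq_tip_of_mem_fac (tip_isCoprime hs) (tip_ne_zero hs) hN hsub hw hi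
    obtain ⟨u, -, hu⟩ := mem_tileLattice_iff.1 (tileLattice_sub hτ' hτ)
    have e : z - toC τ = toC (tip s) * toC (unit l + u) := by
      rw [toC_add, toC_unit]
      linear_combination hl + hu
    rw [e, mem_hexagon hγ] at h1
    simp only [mul_div_cancel_left₀ _ hγ] at h1
    obtain ⟨m, hm⟩ := mem_core_of_le h1
    apply h2
    rw [e]
    rcases toC_mem_triangle_iff.1 hm with h | h | h
    · rw [h, toC_zero, mul_zero, mem_flower]
      exact Or.inr ⟨0, toC_zero ▸ toC_mem_triangle_iff.2 (Or.inl rfl)⟩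
    · rw [h, zero_add, toC_unit, mul_comm]
      exact tip_mem_flower hs hr _
    · rw [h, zero_add, toC_unit, mul_comm]
      exact tip_mem_flower hs hr _

/-- The coloring of the faces of the plane. -/
def faceColor (n : ℕ) (s : State) (F : Face) : Bool :=
  planeColor e n s o (bary (exists_fac F).choose (exists_fac F).choose_spec.choose)

theorem faceColor_fac (v : ℤ × ℤ) (k : ZMod 6) :
    faceColor e o n s (fac v k) = planeColor e n s o (bary v k) := by
  rw [faceColor, ← fac_inj.1 (exists_fac (fac v k)).choose_spec.choose_spec]

theorem fac_subset_translate {v τ : ℤ × ℤ} {k : ZMod 6} {S : Set ℂ} :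
    (fac v k).1 ⊆ translate (toC τ) S ↔ (fac (v - τ) k).1 ⊆ S := by
  constructor
  · intro H z hz
    have h1 := H (mem_fac_sub (τ := τ).1 (by simpa using hz : z + toC τ - toC τ ∈ _))
    rw [mem_translate] at h1
    simpa using h1
  · intro H z hz
    exact mem_translate.2 (H (mem_fac_sub.2 hz))

theorem isTilingColoring_faceColor (hs : s.Good) (hr : IsRun s n) :
    IsTilingColoring (toC (tip s)) n (fun k => neck (nextState^[k] s)) o e (faceColor e o n s) where
  necklace t ht k hk i F hF := by
    obtain ⟨τ, rfl⟩ := mem_lattice_iff.1 (tileLattice_subset (toC_mem _) ht)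
    obtain ⟨v, l, rfl⟩ := exists_fac F
    have hv := hr.valid hs hk
    have h1 := (fac_subset_neck_iff hv).1 (fac_subset_translate.1 hF)
    have hB := isBary_bary (v - τ) l
    have h2 := (h1.inStar hv (isBary_ro hB _)).1
    rw [inStar_ro] at h2
    rw [faceColor_fac, planeColor_eq_of_inStar e o hs hr ht
      (h2.antitone (k := 0) hs (Nat.zero_le k)), flowerColor_of_inTrap hs hr hB hk h1]
  core t ht i hi F hF := by
    obtain ⟨τ, rfl⟩ := mem_lattice_iff.1 (tileLattice_subset (toC_mem _) ht)
    obtain ⟨v, l, rfl⟩ := exists_fac F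
    have h1 : (fac (v - τ) l).1 ⊆ (fac 0 (i : ZMod 6)).1 := by
      rw [core_eq] at hF
      exact fac_subset_translate.1 hF.subset
    change triangle (toC (v - τ)) (zeta l) ⊆ triangle (toC 0) (zeta i) at h1
    rw [triangle_eq_poly, triangle_eq_poly, poly_subset_iff] at h1
    have h2 := eq_of_faceBound_le h1
    rw [bary_zero] at h2
    rw [faceColor_fac, planeColor_eq_of_inStar e o hs hr ht
      (inStar_of_core (k := 0) hs hr h2 (Nat.zero_le n)), h2, flowerColor_delta hs hr,
      ZMod.val_natCast, Nat.mod_eq_of_lt hi]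
  cap t ht F hF := by
    obtain ⟨τ, rfl⟩ := mem_lattice_iff.1 (tileLattice_subset (toC_mem _) ht)
    obtain ⟨v, l, rfl⟩ := exists_fac F
    obtain ⟨z, hz, h1⟩ := hF
    rw [mem_translate] at h1
    rw [faceColor_fac, planeColor, dif_neg]
    rintro ⟨τ', hτ', H⟩
    rw [← bary_sub] at H
    exact not_inStar_of_cap hs hr hz ht hτ' h1.1 h1.2 H

/-- The barycenter of a face lies in some tile. There the face is in a trapezoid or in the core, or
else its barycenter belongs to the cap; each case prescribes the color. -/
theorem eq_faceColor (hs : s.Good) (hr : IsRun s n) {c : Face → Bool}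
    (hc : IsTilingColoring (toC (tip s)) n (fun k => neck (nextState^[k] s)) o e c) :
    c = faceColor e o n s := by
  funext F
  obtain ⟨v, l, rfl⟩ := exists_fac F
  obtain ⟨τ, hτ, hm⟩ := exists_tile_lattice hs (innerPt v l)
  rw [faceColor_fac, planeColor_eq e o hs hr hτ (h_innerPt_lt v l) hm]
  by_cases H : InStar (tip s) (bary (v - τ) l)
  · have hB := isBary_bary (v - τ) l
    rcases exists_piece hs hr hB H with ⟨k, hk, i, h1⟩ | ⟨i, h1⟩
    · rw [flowerColor_of_inTrap hs hr hB hk h1]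
      exact hc.necklace _ hτ k hk i _
        (fac_subset_translate.2 ((fac_subset_neck_iff (hr.valid hs hk)).2 h1))
    · rw [h1, flowerColor_delta hs hr]
      refine hc.core _ hτ _ i.val_lt _ ?_
      rw [core_eq, ZMod.natCast_val, ZMod.cast_id]
      rw [← bary_zero, ← fac_inj] at h1
      ext z
      rw [mem_translate]
      change z ∈ _ ↔ z - toC τ ∈ (fac 0 i).1
      rw [← h1, mem_fac_sub]
  · rw [flowerColor_of_not_inStar H]
    refine hc.cap _ hτ _ ⟨innerPt v l, innerPt_mem v l, mem_translate.2 ⟨hm, fun h1 => H ?_⟩⟩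
    exact inStar_of_mem_flower hs hr (fun j => inner_sub (h_innerPt_lt v l j)) h1

theorem isInvariant_faceColor (hs : s.Good) (hr : IsRun s n) :
    IsInvariant (toC (tip s)) (faceColor e o n s) := by
  intro g hg F F' hF
  obtain ⟨v, k, rfl⟩ := exists_fac F
  obtain ⟨j, t, ht, hj⟩ := exists_of_mem_G hg
  obtain ⟨τ, rfl⟩ := mem_lattice_iff.1 (tileLattice_subset (toC_mem _) ht)
  have : F' = fac (ro (2 * j) v + τ) (2 * j + k) := by
    apply Subtype.ext
    rw [← hF, add_comm (2 * j) k, ← image_fac_eq]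
    exact Set.image_congr' hj
  rw [this, faceColor_fac, faceColor_fac, planeColor_act e o hs hr ht]

/-! ### The coloring is good -/

/-- The lattice points on the boundary of a tile are tips, hence cone points. Any other vertex lies
in an open tile, and near it all six faces have the colors of a single capped flower, whose sum
vanishes off the tips. -/
theorem planeColor_sum_of_not_isCone (hs : s.Good) (hr : IsRun s n) {v : ℤ × ℤ}
    (hv : ¬IsCone (toC (tip s)) v) : ∑ k, sgn (planeColor e n s o (bary v k)) = 0 := by
  have hγ := toC_ne_zero.2 (tip_ne_zero hs)
  obtain ⟨τ, hτ, hm⟩ := exists_tile_lattice hs (toC v)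
  have hnt : ∀ i, v - τ ≠ ro i (tip s) := fun i hi => hv <| by
    obtain ⟨u, -, hu⟩ := mem_tileLattice_iff.1 hτ
    refine ⟨toC (unit i + u), toC_mem _, ?_⟩
    rw [eq_add_of_sub_eq hi, toC_add, toC_ro, hu, toC_add, toC_unit]; ring
  have hlt : ∀ i, h i ((toC v - toC τ) / toC (tip s)) < 1 := by
    intro i
    refine lt_of_le_of_ne ((mem_hexagon hγ).1 hm i) fun h1 => ?_
    rw [← toC_sub] at h1 hm
    obtain ⟨k, hk⟩ := eq_tip_of_boundary (tip_isCoprime hs) (tip_ne_zero hs) hm h1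
    exact hnt k hk
  have key : ∀ k, planeColor e n s o (bary v k) = flowerColor e n s o (bary (v - τ) k) := by
    intro k
    have hcont : ∀ i, Filter.Tendsto (fun ε : ℝ =>
        h i ((toC v + ε * toC (delta k) - toC τ) / toC (tip s))) (nhdsWithin 0 (Set.Ioi 0))
        (nhds (h i ((toC v - toC τ) / toC (tip s)))) := by
      intro i
      have hc : Continuous fun ε : ℝ => h i ((toC v + ε * toC (delta k) - toC τ) / toC (tip s)) :=
        (LinearMap.continuous_of_finiteDimensional (h i)).comp (by fun_prop)
      have := hc.tendsto 0
      simp only [Complex.ofReal_zero, zero_mul, add_zero] at this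
      exact this.mono_left nhdsWithin_le_nhds
    have hev : ∀ᶠ ε : ℝ in nhdsWithin 0 (Set.Ioi 0), ∀ i,
        h i ((toC v + ε * toC (delta k) - toC τ) / toC (tip s)) < 1 :=
      Filter.eventually_all.2 fun i => (hcont i).eventually_lt_const (hlt i)
    obtain ⟨ε, h1, h2, h3⟩ := (hev.and ((Ioc_mem_nhdsGT (show (0 : ℝ) < 1 / 3 by norm_num)))).exists
    exact planeColor_eq e o hs hr hτ (fun j => inner_point v k j h2 h3)
      ((mem_hexagon hγ).2 fun i => (h1 i).le)
  simp only [key]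
  rw [flowerColor_sum e hs hr, tipCount, Finset.sum_eq_zero, mul_zero]
  intro i _
  rw [if_neg]
  intro H
  apply hnt (-i)
  rw [← H, ro_ro, neg_add_cancel, ro_zero]

theorem ne_of_alternating : ∀ f : ZMod 6 → Bool, (∀ k, f (2 + k) = f k) →
    ∀ i, f i ≠ f (i + 1) → f 0 ≠ f 1 := by
  decide

theorem planeColor_cone_add_two (hs : s.Good) (hr : IsRun s n) {v : ℤ × ℤ}
    (hv : IsCone (toC (tip s)) v) (k : ZMod 6) :
    planeColor e n s o (bary v (2 + k)) = planeColor e n s o (bary v k) := by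
  obtain ⟨t, ht, H⟩ := hv.exists_act_eq 1
  have := planeColor_act e o hs hr ht v k 1
  rwa [H, mul_one] at this

/-- At a tip the star has a face of the outermost necklace, of color o, and the adjacent face meets
the cap, of the opposite color. If there are no necklaces, the tip lies on the core and two of its
faces serve. -/
theorem planeColor_tip_ne (hs : s.Good) (hr : IsRun s n) {v τ : ℤ × ℤ} {j : ZMod 6}
    (hτ : toC τ ∈ tileLattice (toC (tip s))) (hv : v - τ = ro j (tip s)) :
    ∃ i, planeColor e n s o (bary v i) ≠ planeColor e n s o (bary v (i + 1)) := by
  have hγ := toC_ne_zero.2 (tip_ne_zero hs)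
  rcases Nat.eq_zero_or_pos n with rfl | hn
  · obtain ⟨l, hl⟩ := exists_tip_eq_zeta hs hr.2
    rw [← toC_unit, toC_inj] at hl
    rw [hl, ro_unit] at hv
    generalize j + l = m at hv
    have d1 : bary (v - τ) (m + 2) = delta m := by
      rw [hv]; clear hv; revert m; decide
    have d2 : bary (v - τ) (m + 2 + 1) = delta (m + 5) := by
      rw [hv]; clear hv d1; revert m; decide
    refine ⟨m + 2, ?_⟩
    rw [planeColor_eq_of_inStar e o hs hr hτ (inStar_of_core (k := 0) hs hr d1 le_rfl),
      planeColor_eq_of_inStar e o hs hr hτ (inStar_of_core (k := 0) hs hr d2 le_rfl), d1, d2,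
      flowerColor_delta hs hr, flowerColor_delta hs hr]
    clear d1 d2 hv
    revert e m; decide
  have hsv : s.Valid := hr.valid (k := 0) hs hn
  have hpos : 0 < (tip s).1 ∧ 0 < (tip s).2 := by
    obtain ⟨τ, p, q⟩ := s
    obtain ⟨h1, h2⟩ := hsv
    simp only at h1 h2
    cases τ <;> simp [tip] <;> omega
  refine ⟨j + 2, ?_⟩
  have hcap : planeColor e n s o (bary v (j + 2)) = !o := by
    obtain ⟨hx, hy⟩ := hpos
    have hx' : (0 : ℝ) < (tip s).1 := by exact_mod_cast hx
    have hy' : (0 : ℝ) < (tip s).2 := by exact_mod_cast hy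
    -- The point tip + ε α² tip lies on the side of the hexagon that leads from this tip to the
    -- next. With ε = 1/(x + y + 1), where x and y are the coordinates of the tip, ε · tip is inside
    -- the triangle 0, 1, α, so the point is inside the face of direction 2.
    obtain ⟨ε, hε, hε'⟩ : ∃ ε : ℝ, 0 < ε ∧ ε * (tip s).1 + ε * (tip s).2 + ε = 1 :=
      ⟨1 / ((tip s).1 + (tip s).2 + 1), by positivity, by field_simp⟩
    have ex := mul_pos hε hx'
    have ey := mul_pos hε hy'
    have hkey : ∀ i, ε * hz i (tip s) < supp i := by
      rw [forall_zmod_six]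
      simp only [hz_zero, hz_one, hz_two, hz_three, hz_four, hz_five,
        show supp 0 = 1 from rfl, show supp 1 = 0 from rfl, show supp 2 = 0 from rfl,
        show supp 3 = 0 from rfl, show supp 4 = 1 from rfl, show supp 5 = 1 from rfl]
      push_cast
      refine ⟨?_, ?_, ?_, ?_, ?_, ?_⟩ <;> linarith
    have hin : ∀ m, h m (toC τ + zeta j * (toC (tip s) + ε * (zeta 2 * toC (tip s)))) <
        faceBound v (j + 2) m := by
      intro m
      have h1 := hkey (m + j + 2)
      rw [map_add, h_zeta_mul, map_add, h_real_mul, h_zeta_mul, h_toC, h_toC, h_toC, faceBound,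
        eq_add_of_sub_eq' hv, hz_add, hz_ro, show j + 2 + m = m + j + 2 by ring]
      push_cast
      linarith
    have hm : toC τ + zeta j * (toC (tip s) + ε * (zeta 2 * toC (tip s))) - toC τ ∈
        hexagon (toC (tip s)) := by
      rw [add_sub_cancel_left]
      refine zeta_mul_mem_hexagon _ hγ ((mem_hexagon hγ).2 ?_)
      rw [show (toC (tip s) + ε * (zeta 2 * toC (tip s))) / toC (tip s) =
        toC (unit 0) + ε * toC (unit 2) by
          rw [toC_unit, toC_unit, zeta_zero]; field_simp]
      simp only [map_add, h_real_mul, h_toC]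
      rw [forall_zmod_six]
      simp only [hz_zero, hz_one, hz_two, hz_three, hz_four, hz_five, unit_zero, unit_two]
      push_cast
      refine ⟨?_, ?_, ?_, ?_, ?_, ?_⟩ <;> linarith
    rw [planeColor_eq e o hs hr hτ hin hm, flowerColor_of_not_inStar]
    rw [hv, ← bary_ro, inStar_ro, inStar_iff]
    intro H
    apply H.1
    simp only [bary, delta_two, Prod.fst_add, Prod.snd_add, Prod.smul_fst, Prod.smul_snd,
      smul_eq_mul]
    omega
  have hring : planeColor e n s o (bary v (j + 2 + 1)) = o := by
    have hT : InTrap s (bary (tip s) 3) := by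
      obtain ⟨τ, p, q⟩ := s
      obtain ⟨h1, h2⟩ := hsv
      simp only at h1 h2
      cases τ
      · rw [inTrap_neg_iff]; simp [tip, bary]; omega
      · rw [inTrap_pos_iff]; simp [tip, bary]; omega
    have e1 : bary (v - τ) (j + 2 + 1) = ro j (bary (tip s) 3) := by
      rw [bary_ro, hv, add_assoc]; rfl
    have hS := (hT.inStar hsv (isBary_bary _ _)).1
    rw [planeColor_eq_of_inStar e o hs hr hτ (by rw [e1, inStar_ro]; exact hS),
      flowerColor_of_inTrap (k := 0) (i := j) hs hr (isBary_bary _ _) hn, alternate, if_pos (by decide)]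
    rw [e1, ro_ro, neg_add_cancel, ro_zero]
    exact hT
  rw [hcap, hring]
  cases o <;> decide

theorem planarGood_planeColor (hs : s.Good) (hr : IsRun s n) :
    PlanarGood (toC (tip s)) fun v k => planeColor e n s o (bary v k) := by
  have hcone : ∀ v, IsCone (toC (tip s)) v →
      planeColor e n s o (bary v 0) ≠ planeColor e n s o (bary v 1) := by
    intro v hv
    obtain ⟨i, hi⟩ : ∃ i, planeColor e n s o (bary v i) ≠ planeColor e n s o (bary v (i + 1)) := by
      obtain ⟨w, hw, h1⟩ := hv
      obtain ⟨u, rfl⟩ := mem_lattice_iff.1 hw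
      -- Cone points βu with u divisible by 1 + α are centers of tiles; all others are tips of a
      -- tile.
      by_cases hu : col u = 0
      · have ht : toC v ∈ tileLattice (toC (tip s)) := mem_tileLattice_iff.2 ⟨u, hu, h1⟩
        have d : ∀ k, bary (v - v) k = delta k := fun k => by rw [sub_self, bary_zero]
        have hc : ∀ k, planeColor e n s o (bary v k) = alternate e k.val := fun k => by
          rw [planeColor_eq_of_inStar e o hs hr ht
            (inStar_of_core (k := 0) hs hr (d k) (Nat.zero_le n)), d, flowerColor_delta hs hr]
        refine ⟨0, ?_⟩
        rw [hc, hc]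
        cases e <;> decide
      · have hcol : ∀ c : ZMod 3, c ≠ 0 → ∃ j, c - col (unit j) = 0 := by decide
        obtain ⟨j, hj⟩ := hcol _ hu
        refine planeColor_tip_ne e o hs hr (τ := v - ro j (tip s)) (j := j) ?_ (by abel)
        refine mem_tileLattice_iff.2 ⟨u - unit j, ?_, ?_⟩
        · have := col_add (u - unit j) (unit j)
          rw [sub_add_cancel] at this
          rw [this, add_sub_cancel_right] at hj
          exact hj
        · rw [toC_sub, toC_sub, h1, toC_ro, toC_unit]; ring
    exact ne_of_alternating (fun k => planeColor e n s o (bary v k))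
      (planeColor_cone_add_two e o hs hr hv) i hi
  refine ⟨fun v => ?_, hcone⟩
  by_cases hv : IsCone (toC (tip s)) v
  · have h1 := planeColor_cone_add_two e o hs hr hv
    rw [sum_zmod_six]
    have e2 := h1 0
    have e3 := h1 1
    have e4 := h1 2
    have e5 := h1 3
    simp only [show (2 : ZMod 6) + 0 = 2 by decide, show (2 : ZMod 6) + 1 = 3 by decide,
      show (2 : ZMod 6) + 2 = 4 by decide, show (2 : ZMod 6) + 3 = 5 by decide] at e2 e3 e4 e5
    simp only [e4, e5, e2, e3]
    have : (3 : ZMod 3) = 0 := by decide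
    linear_combination (sgn (planeColor e n s o (bary v 0)) +
      sgn (planeColor e n s o (bary v 1))) * this
  · exact planeColor_sum_of_not_isCone e o hs hr hv

/-! ### Reduction to a sector -/

theorem isCoprime_ro {v : ℤ × ℤ} (hv : IsCoprime v.1 v.2) (i : ZMod 6) :
    IsCoprime (ro i v).1 (ro i v).2 := by
  have h1 : IsCoprime v.1 (v.1 + v.2) := by
    have := hv.add_mul_left_right 1
    rwa [mul_one, add_comm] at this
  have h2 : IsCoprime v.2 (v.1 + v.2) := by
    have := hv.symm.add_mul_left_right 1
    rwa [mul_one] at this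
  have e : -v.1 - v.2 = -(v.1 + v.2) := by ring
  revert i
  rw [forall_zmod_six]
  simp only [ro, zero_add, show (1 : ZMod 6) + 4 = 5 by decide, show (2 : ZMod 6) + 4 = 0 by decide,
    show (3 : ZMod 6) + 4 = 1 by decide, show (4 : ZMod 6) + 4 = 2 by decide,
    show (5 : ZMod 6) + 4 = 3 by decide, hz_zero, hz_one, hz_two, hz_three, hz_four, hz_five, e]
  exact ⟨hv, h2.neg_left, h1.symm.neg_left, hv.neg_neg, h2.neg_right, h1.symm.neg_right⟩

theorem exists_ro_nonneg (v : ℤ × ℤ) : ∃ i, 0 ≤ (ro i v).1 ∧ 0 ≤ (ro i v).2 := by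
  rw [exists_zmod_six]
  simp only [ro, zero_add, show (1 : ZMod 6) + 4 = 5 by decide, show (2 : ZMod 6) + 4 = 0 by decide,
    show (3 : ZMod 6) + 4 = 1 by decide, show (4 : ZMod 6) + 4 = 2 by decide,
    show (5 : ZMod 6) + 4 = 3 by decide, hz_zero, hz_one, hz_two, hz_three, hz_four, hz_five]
  omega

theorem exists_state {w : ℤ × ℤ} (hw : IsCoprime w.1 w.2) (h1 : 0 ≤ w.1) (h2 : 0 ≤ w.2) :
    ∃ s : State, s.Good ∧ w = tip s ∧ (w.1 ≤ w.2 → s.1 = true) := by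
  obtain ⟨x, y⟩ := w
  obtain ⟨p, rfl⟩ := Int.eq_ofNat_of_zero_le h1
  obtain ⟨q, rfl⟩ := Int.eq_ofNat_of_zero_le h2
  have h3 : Nat.Coprime p q := Nat.isCoprime_iff_coprime.1 hw
  rcases le_or_gt p q with h | h
  · exact ⟨(true, p, q), ⟨h, h3⟩, rfl, fun _ => rfl⟩
  · exact ⟨(false, q, p), ⟨h.le, h3.symm⟩, rfl, fun h4 => by simp at h4; omega⟩

theorem exists_ro_tip {v : ℤ × ℤ} (hv : IsCoprime v.1 v.2) :
    ∃ (s : State) (r : ZMod 6), s.Good ∧ v = ro r (tip s) ∧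
      (0 ≤ v.1 → v.1 ≤ v.2 → (s.2.1 : ℤ) = v.1 ∧ (s.2.2 : ℤ) = v.2) := by
  by_cases h : 0 ≤ v.1 ∧ v.1 ≤ v.2
  · obtain ⟨s, hs, h1, h2⟩ := exists_state hv h.1 (h.1.trans h.2)
    refine ⟨s, 0, hs, by rw [ro_zero]; exact h1, fun _ _ => ?_⟩
    rw [h1, tip, if_pos (h2 h.2)]
    exact ⟨rfl, rfl⟩
  · obtain ⟨i, hi1, hi2⟩ := exists_ro_nonneg v
    obtain ⟨s, hs, h1, -⟩ := exists_state (isCoprime_ro hv i) hi1 hi2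
    refine ⟨s, -i, hs, ?_, fun h1 h2 => absurd ⟨h1, h2⟩ h⟩
    rw [← h1, ro_ro, neg_add_cancel, ro_zero]

theorem conj_α : conj α = 1 - α := by
  apply Complex.ext
  · simp [α]; norm_num
  · simp [α]

theorem isReduction_tip {s : State} (hs : s.Good) (r : ZMod 6) :
    IsReduction (zeta r * toC (tip s)) s.2.1 s.2.2 := by
  refine ⟨hs.1, hs.2, ?_⟩
  obtain ⟨τ, p, q⟩ := s
  cases τ
  -- In negative orientation a reflection is needed: q + pα is α times the conjugate of p + qα.
  · refine ⟨zeta (r + 1), zeta_pow_six _, Or.inr ?_⟩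
    simp only [tip, toC, Bool.false_eq_true, if_false, map_add, map_mul, map_natCast, conj_α,
      zeta_add, zeta_one]
    push_cast
    linear_combination (zeta r * q) * α_sq
  · refine ⟨zeta r, zeta_pow_six _, Or.inl ?_⟩
    simp [tip, toC]

/-- Multiplying β by a sixth root of unity changes neither the group nor the cone points, the
hexagon or the tile lattice, so what holds for the tip of a state carries over to β. -/
theorem G_zeta_mul (r : ZMod 6) (γ : ℂ) : G (zeta r * γ) = G γ := by
  rw [G, G]
  congr 1
  ext g
  constructor
  · rintro ⟨e, he, rfl⟩
    exact ⟨zeta r * e, lattice_zeta_mul r he, by congr 1; ring⟩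
  · rintro ⟨e, he, rfl⟩
    refine ⟨zeta (-r) * e, lattice_zeta_mul _ he, ?_⟩
    congr 1
    linear_combination (-γ * e) * zeta_mul_neg r

theorem isCone_zeta_mul (r : ZMod 6) (γ : ℂ) (v : ℤ × ℤ) :
    IsCone (zeta r * γ) v ↔ IsCone γ v := by
  constructor
  · rintro ⟨e, he, h⟩
    exact ⟨zeta r * e, lattice_zeta_mul r he, by rw [h]; ring⟩
  · rintro ⟨e, he, h⟩
    refine ⟨zeta (-r) * e, lattice_zeta_mul _ he, ?_⟩
    rw [h]
    linear_combination (-γ * e) * zeta_mul_neg r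

theorem isFlower_zeta_mul {r : ZMod 6} {γ : ℂ} {n : ℕ} {X : ℕ → ZMod 6 → Trapezoid}
    (H : IsFlower γ n X) : IsFlower (zeta r * γ) n X :=
  { H with hull := by rw [hexagon_zeta_mul]; exact H.hull }

theorem isTilingColoring_zeta_mul {r : ZMod 6} {γ : ℂ} {n : ℕ} {X : ℕ → ZMod 6 → Trapezoid}
    {o e : Bool} {c : Face → Bool} :
    IsTilingColoring (zeta r * γ) n X o e c ↔ IsTilingColoring γ n X o e c := by
  constructor
  · rintro ⟨h1, h2, h3⟩
    rw [tileLattice_zeta_mul_eq] at h1 h2 h3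
    rw [hexagon_zeta_mul] at h3
    exact ⟨h1, h2, h3⟩
  · rintro ⟨h1, h2, h3⟩
    rw [← tileLattice_zeta_mul_eq r] at h1 h2 h3
    rw [← hexagon_zeta_mul r] at h3
    exact ⟨h1, h2, h3⟩

theorem exists_descent {β : ℂ} {c : Face → Bool} (hc : IsInvariant β c) :
    ∃ C : TFace β → Bool, ∀ F, C (toTFace β F) = c F :=
  ⟨Quotient.lift c fun F F' ⟨g, hg, H⟩ => (hc g hg F F' H).symm, fun _ => rfl⟩

end

end Eisenstein

theorem mainTheorem4 (a b : ℤ) (hab : IsCoprime a b) (β : ℂ)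
    (hβ : β = (a : ℂ) + (b : ℂ) * Eisenstein.α) :
    -- the quotient is a triangulation of the sphere with degrees 6, …, 6, 2, 2, 2
    Eisenstein.IsSphereTriangulation (Eisenstein.incVE β) (Eisenstein.incVF β)
      (Eisenstein.incEF β) ∧
    {v | Eisenstein.degree β v = 2}.ncard = 3 ∧
    (∀ v, Eisenstein.degree β v = 2 ∨ Eisenstein.degree β v = 6) ∧
    -- good face colorings are those induced by proper vertex colorings
    (∀ C : Eisenstein.TFace β → Bool, Eisenstein.IsGood β C ↔
      ∃ κ, Eisenstein.IsProper β κ ∧ Eisenstein.Induces β κ C) ∧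
    -- the hexagonal tiling
    Eisenstein.HexagonsTile β ∧
    -- the flower of β
    ∃ p q : ℕ, Eisenstein.IsReduction β p q ∧
      (0 ≤ a → a ≤ b → (p : ℤ) = a ∧ (q : ℤ) = b) ∧
      ∃ (n : ℕ) (X : ℕ → ZMod 6 → Eisenstein.Trapezoid), Eisenstein.IsFlower β n X ∧
        -- it implements the slow Gauss map and the continued fraction expansion
        (∀ k < n, ∀ i, (X k i).aspect = Eisenstein.slowGauss^[k] ((p : ℚ) / q)) ∧
        (∃ l : List ℕ, Eisenstein.IsCFExpansion l ((p : ℚ) / q) ∧ l.sum = n ∧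
          ∀ (j : ℕ) (hj : j < l.length),
            Eisenstein.IsMaximalBlock n X (l.take j).sum l[j]) ∧
        -- the coloring of the plane and of the sphere
        ∀ o e : Bool, ∃ c : Eisenstein.Face → Bool,
          Eisenstein.IsTilingColoring β n X o e c ∧
          (∀ c', Eisenstein.IsTilingColoring β n X o e c' → c' = c) ∧
          Eisenstein.IsInvariant β c ∧
          ∃ C : Eisenstein.TFace β → Bool, (∀ F, C (Eisenstein.toTFace β F) = c F) ∧
            Eisenstein.IsGood β C ∧
            ∃ κ, Eisenstein.IsProper β κ ∧ Eisenstein.Induces β κ C := by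
  obtain ⟨s, r, hs, hv, hpq⟩ := Eisenstein.exists_ro_tip (v := (a, b)) hab
  have hβv : β = Eisenstein.toC (a, b) := hβ
  have hβr : β = Eisenstein.zeta r * Eisenstein.toC (Eisenstein.tip s) := by
    rw [hβv, hv, Eisenstein.toC_ro]
  have hmem : β ∈ Eisenstein.lattice := hβv ▸ Eisenstein.toC_mem _
  have h0 : β ≠ 0 := by
    rw [hβv, Eisenstein.toC_ne_zero]
    rintro h
    rw [Prod.mk_eq_zero] at h
    rw [h.1, h.2, isCoprime_self] at hab
    exact not_isUnit_zero hab
  refine ⟨Eisenstein.isSphereTriangulation hmem h0, Eisenstein.ncard_degree_two hmem h0,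
    fun v => ?_, fun C => Eisenstein.isGood_iff_exists hmem C, Eisenstein.hexagonsTile h0,
    s.2.1, s.2.2, hβr ▸ Eisenstein.isReduction_tip hs r, hpq, ?_⟩
  · obtain ⟨w, rfl⟩ := Eisenstein.exists_toTVertex v
    by_cases hw : Eisenstein.IsCone β w
    · exact Or.inl (Eisenstein.degree_of_isCone hmem hw)
    · exact Or.inr (Eisenstein.degree_of_not_isCone hmem hw)
  obtain ⟨l, hr, hcf, hblock⟩ := Eisenstein.exists_cf s.2.2 s.1 s.2.1 hs
  refine ⟨l.sum, fun k => Eisenstein.neck (Eisenstein.nextState^[k] s),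
    hβr ▸ Eisenstein.isFlower_zeta_mul (Eisenstein.isFlower hs hr), fun k hk i => ?_,
    ⟨l, hcf, rfl, fun j hj => ?_⟩, fun o e => ?_⟩
  · rw [Eisenstein.iterate_slowGauss hs hr hk.le]
    exact Eisenstein.neck_aspect (hr.valid hs hk) i
  · refine (hblock j hj).isMaximalBlock hs hr ?_
    rw [← List.sum_take_succ, ← List.sum_take_add_sum_drop l (j + 1)]
    exact Nat.le_add_right _ _
  · have hinv : Eisenstein.IsInvariant β (Eisenstein.faceColor e o l.sum s) := by
      have := Eisenstein.isInvariant_faceColor e o hs hr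
      rwa [Eisenstein.IsInvariant, ← Eisenstein.G_zeta_mul r, ← hβr] at this
    obtain ⟨C, hC⟩ := Eisenstein.exists_descent hinv
    have hgood : Eisenstein.IsGood β C := by
      rw [Eisenstein.isGood_iff hmem]
      simp only [hC, Eisenstein.faceColor_fac]
      have := Eisenstein.planarGood_planeColor e o hs hr
      refine ⟨this.1, fun v hv => this.2 v ?_⟩
      rwa [hβr, Eisenstein.isCone_zeta_mul] at hv
    refine ⟨_, ?_, fun c' hc' => ?_, hinv, C, hC, hgood,
      (Eisenstein.isGood_iff_exists hmem C).1 hgood⟩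
    · rw [hβr, Eisenstein.isTilingColoring_zeta_mul]
      exact Eisenstein.isTilingColoring_faceColor e o hs hr
    · rw [hβr, Eisenstein.isTilingColoring_zeta_mul] at hc'
      exact Eisenstein.eq_faceColor e o hs hr hc'
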